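/- **Setting.** Let $\Omega\subset\mathbb R^3$ be a connected open set with a polyhedral mesh, i.e. finite families $\mathcal T_h,\mathcal F_h,\mathcal E_h,\mathcal V_h$ of pairwise disjoint open cells, relatively open faces, open edges and vertices, such that: $\overline\Omega=\bigcup_T\overline T$; cells are bounded convex open sets; faces are non-empty, planar, bounded, convex and relatively open; edges are open segments between two distinct vertices; $\partial T$ is the union of the $\overline F$, $F\in\mathcal F_T:=\{F: F\subset\partial T\}$; the relative boundary $\partial F$ is the union of the $\overline E$, $E\in\mathcal E_F:=\{E:E\subset\partial F\}$; each face belongs to some $\mathcal F_T$, each edge to some $\mathcal E_F$, each vertex is an end point of some edge. Fix points $x_T\in T$, $x_F\in F$, unit normals $n_F$, unit tangents $t_E$; $n_{FE}$ is the unit vector in the plane of $F$ normal to $E$ with $(t_E,n_{FE},n_F)$ right-handed; $\omega_{TF},\omega_{FE}\in\{\pm1\}$ are such that $\omega_{TF}n_F$ points out of $T$ and $\omega_{FE}n_{FE}$ out of $F$. On a face, fields are tangential unless they are stated to be $\mathbb R^3$-valued, and differential operators are those of the oriented plane: in right-handed orthonormal coordinates $\mathrm{rot}\,w=\partial_1w_2-\partial_2w_1$,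 $\mathbf{rot}\,q=(\partial_2q,-\partial_1q)$, and $\perp$ is the rotation by $\pi/2$. Differential operators act on matrices row by row. **Polynomials.** $\mathcal P^m(X)$ is the space of polynomials of degree $\le m$ on $X$ ($\{0\}$ if $m<0$), bold letters denote vector-valued polynomials, $\mathcal P^{0,m}$ the subspace of zero integral, $\pi_S$ the $L^2$-orthogonal projection on a space $S$, $\mathcal P_c^m(\mathcal E_h)$ the continuous functions on the edge skeleton that are in $\mathcal P^m$ on each edge. For $X\in\{T,F\}$: $\mathcal G^m(X)=\nabla\mathcal P^{m+1}(X)$, $\mathcal R^{c,m}(X)=(x-x_X)\mathcal P^{m-1}(X)$, $\mathcal R^m(T)=\mathrm{curl}\,\boldsymbol{\mathcal P}^{m+1}(T)$, $\mathcal R^m(F)=\mathbf{rot}\,\mathcal P^{m+1}(F)$, $\mathcal G^{c,m}(T)=(x-x_T)\times\boldsymbol{\mathcal P}^{m-1}(T)$, $\mathcal G^{c,m}(F)=(x-x_F)^\perp\mathcal P^{m-1}(F)$. $\mathbb R^{c,m}(X)$ is the space of square matrix fields with rows in $\mathcal R^{c,m}(X)$ and zero trace; $\mathbb R^{m}(X)$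 is that of square matrix fields $W$ with rows in $\mathcal R^{c,m}(X)$ and $\mathrm{div}\,W=\nabla q$ for some $q\in\mathcal P^{0,m}(X)$. **Discrete spaces** ($k\ge0$ an integer; indices $V,E,F,T$ run over all mesh entities; $\mathcal P^k_\perp(E)=\{g\in\boldsymbol{\mathcal P}^k(E):g\cdot t_E=0\}$, where $\boldsymbol{\mathcal P}^k(E)$ is $\mathbb R^3$-valued). * $X_{\nabla}$ (the space $\underline X^k_{\mathrm{GRAD},h}$): $q=(G_V,q_E,G_E,q_F,G_F,q_T)$ with $G_V\in\mathbb R^3$, $(q_E)_E\in\mathcal P_c^{k+1}(\mathcal E_h)$, $G_E\in\mathcal P^k_\perp(E)$, $q_F,G_F\in\mathcal P^{k-1}(F)$, $q_T\in\mathcal P^{k-1}(T)$. * $X_{\mathrm{curl}}$: $v=(R_V,v_E,R_E,v_{\mathcal R,F},v^c_{\mathcal R,F},v_F,G_F,G^c_F,v_{\mathcal R,T},v^c_{\mathcal R,T})$ with $R_V\in\mathbb R^3$, $(v_E)_E\in\boldsymbol{\mathcal P}^{k+2}_c(\mathcal E_h)$ and $R_E\in\boldsymbol{\mathcal P}^{k+1}(E)$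 $\mathbb R^3$-valued, $v_{\mathcal R,X}\in\mathcal R^{k-1}(X)$, $v^c_{\mathcal R,X}\in\mathcal R^{c,k}(X)$, $v_F\in\mathcal P^{k-1}(F)$, $G_F\in\mathcal G^k(F)$, $G_F^c\in\mathcal G^{c,k}(F)$. * $X_{J}$ (the space $\underline{\mathbf X}^k_{\nabla,h}$): $w=(w_E,w_F,w_{\mathcal G,F},w^c_{\mathcal G,F},w_{\mathcal G,T},w^c_{\mathcal G,T})$ with $(w_E)_E\in\boldsymbol{\mathcal P}_c^{k+3}(\mathcal E_h)$ $\mathbb R^3$-valued, $w_F\in\mathcal P^k(F)$, $w_{\mathcal G,F}\in\mathcal G^k(F)$, $w^c_{\mathcal G,F}\in\mathcal G^{c,k}(F)$, $w_{\mathcal G,T}\in\mathcal G^{k-1}(T)$, $w^c_{\mathcal G,T}\in\mathcal G^{c,k}(T)$. * $\mathcal P^k(\mathcal T_h)$: families $(q_T)_T$, $q_T\in\mathcal P^k(T)$. The interpolate $I(q)\in X_\nabla$ of a $C^1$ function $q$ has components $\nabla q(x_V)$; the $q_E\in\mathcal P^{k+1}(E)$ with the end point values of $q$ and $\pi_{\mathcal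 P^{k-1}(E)}q_E=\pi_{\mathcal P^{k-1}(E)}q$; $\pi_{\boldsymbol{\mathcal P}^k(E)}(t_E\times(\nabla q\times t_E))$; $\pi_{\mathcal P^{k-1}(F)}q$; $\pi_{\mathcal P^{k-1}(F)}(\nabla q\cdot n_F)$; $\pi_{\mathcal P^{k-1}(T)}q$. **Gradient.** For $q\in X_\nabla$: $v_E\in\boldsymbol{\mathcal P}^{k+2}(E)$ has $\pi_{\boldsymbol{\mathcal P}^k(E)}v_E=q_E't_E+G_E$ and the values $G_V$ at the end points $V$ of $E$. $\mathsf G_Fq,\mathsf G_F^\perp q\in\boldsymbol{\mathcal P}^k(F)$, $\gamma_Fq\in\mathcal P^{k+1}(F)$, $\mathsf G_Tq\in\boldsymbol{\mathcal P}^k(T)$ are given by $$\int_F\mathsf G_Fq\cdot w=-\int_Fq_F\,\mathrm{div}\,w+\sum_{E\in\mathcal E_F}\omega_{FE}\int_Eq_E\,w\cdot n_{FE},\qquad \int_F\mathsf G_F^\perp q\cdot w=-\int_FG_F\,\mathrm{rot}\,w-\sum_{E\in\mathcal E_F}\omega_{FE}\int_E(G_E\cdot n_F)(w\cdot t_E)$$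 for $w\in\boldsymbol{\mathcal P}^k(F)$, $$\int_F\gamma_Fq\,\mathrm{div}\,v=-\int_F\mathsf G_Fq\cdot v+\sum_{E\in\mathcal E_F}\omega_{FE}\int_Eq_E\,v\cdot n_{FE}\quad\text{for } v\in\mathcal R^{c,k+2}(F),$$ $$\int_T\mathsf G_Tq\cdot w=-\int_Tq_T\,\mathrm{div}\,w+\sum_{F\in\mathcal F_T}\omega_{TF}\int_F\gamma_Fq\,w\cdot n_F\quad\text{for } w\in\boldsymbol{\mathcal P}^k(T).$$ Then $\mathbf G_h^kq=\big(0,\ v_E,\ v_E'\times t_E,\ \pi_{\mathcal R^{k-1}(F)}\mathsf G_Fq,\ \pi_{\mathcal R^{c,k}(F)}\mathsf G_Fq,\ G_F,\ \pi_{\mathcal G^k(F)}\mathsf G^\perp_Fq,\ \pi_{\mathcal G^{c,k}(F)}\mathsf G^\perp_Fq,\ \pi_{\mathcal R^{k-1}(T)}\mathsf G_Tq,\ \pi_{\mathcal R^{c,k}(T)}\mathsf G_Tq\big)$. **Curl.** For $v\in X_{\mathrm{curl}}$: $C_Ev\in\boldsymbol{\mathcal P}^{k+3}(E)$ has $\pi_{\boldsymbol{\mathcal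 P}^{k+1}(E)}C_Ev=R_E-v_E'\times t_E$ and the values $R_V$ at the end points of $E$. $C_Fv\in\mathcal P^k(F)$, $\mathbf C_Fv\in\boldsymbol{\mathcal P}^k(F)$, $\gamma_{t,F}v\in\boldsymbol{\mathcal P}^k(F)$, $\mathbf C_Tv\in\boldsymbol{\mathcal P}^k(T)$ are given by $$\int_FC_Fv\,r=\int_Fv_{\mathcal R,F}\cdot\mathbf{rot}\,r-\sum_{E\in\mathcal E_F}\omega_{FE}\int_E(v_E\cdot t_E)\,r\quad\text{for } r\in\mathcal P^k(F),$$ $$\int_F\mathbf C_Fv\cdot r=\int_Fv_F\,\mathrm{rot}\,r+\sum_{E\in\mathcal E_F}\omega_{FE}\int_E(v_E\cdot n_F)(r\cdot t_E)\quad\text{for } r\in\boldsymbol{\mathcal P}^k(F),$$ $$\int_F\gamma_{t,F}v\cdot(\mathbf{rot}\,r+w)=\int_FC_Fv\,r+\sum_{E\in\mathcal E_F}\omega_{FE}\int_E(v_E\cdot t_E)\,r+\int_Fv^c_{\mathcal R,F}\cdot w\quad\text{for } r\in\mathcal P^{0,k+1}(F),\ w\in\mathcal R^{c,k}(F),$$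 $$\int_T\mathbf C_Tv\cdot r=\int_Tv_{\mathcal R,T}\cdot\mathrm{curl}\,r+\sum_{F\in\mathcal F_T}\omega_{TF}\int_F\gamma_{t,F}v\cdot(r\times n_F)\quad\text{for } r\in\boldsymbol{\mathcal P}^k(T).$$ Then $\mathbf C_h^kv=\big(C_Ev,\ C_Fv,\ \pi_{\mathcal G^k(F)}\mathbf C_Fv+G_F,\ \pi_{\mathcal G^{c,k}(F)}\mathbf C_Fv+G^c_F,\ \pi_{\mathcal G^{k-1}(T)}\mathbf C_Tv,\ \pi_{\mathcal G^{c,k}(T)}\mathbf C_Tv\big)$. **Divergence.** For $w\in X_J$: $J_F$ belongs to the space of tensors $V=V_1+V_2+V_3+n_F\otimes z$ with $V_1\in\mathbb R^{c,k+1}(F)$, $V_2\in\mathbb R^{k+1}(F)$, $V_3$ a $2\times2$ tangential field with rows in $\mathcal R^{k+1}(F)$, $z\in\boldsymbol{\mathcal P}^{k+1}(F)$, and for all such $V$ $$\int_FJ_F:V=-\int_Fw^c_{\mathcal G,F}\cdot\mathrm{div}\,V_1-\int_Fw_{\mathcal G,F}\cdot\mathrm{div}\,V_2-\int_Fw_F\,\mathrm{div}\,z+\sum_{E\in\mathcal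 E_F}\omega_{FE}\int_Ew_E\cdot Vn_{FE};$$ $\gamma_{J,F}\in\mathcal P^{k+2}(F)^3$ (an $\mathbb R^3$-valued field) satisfies $\int_F\gamma_{J,F}\cdot\mathrm{div}\,V=-\int_FJ_F:V+\sum_{E\in\mathcal E_F}\omega_{FE}\int_Ew_E\cdot Vn_{FE}$ for all $V$ with three rows in $\mathcal R^{c,k+3}(F)$; $J_T$ belongs to the space of $V=V_1+V_2+V_3$ with $V_1\in\mathbb R^{c,k+1}(T)$, $V_2\in\mathbb R^k(T)$, $V_3$ a $3\times3$ field with rows in $\mathcal R^k(T)$, and for all such $V$ $$\int_TJ_T:V=-\int_Tw^c_{\mathcal G,T}\cdot\mathrm{div}\,V_1-\int_Tw_{\mathcal G,T}\cdot\mathrm{div}\,V_2+\sum_{F\in\mathcal F_T}\omega_{TF}\int_F\gamma_{J,F}\cdot Vn_F.$$ Then $D_h^kw=(\mathrm{tr}\,J_T)_{T\in\mathcal T_h}$. **Theorem (Complex property).** For every integer $k\ge0$, each of the problems above that define the local operators has exactly one solution, and these formulas define linear maps $\mathbf G_h^k:X_\nabla\to X_{\mathrm{curl}}$, $\mathbf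 C_h^k:X_{\mathrm{curl}}\to X_J$, $D_h^k:X_J\to\mathcal P^k(\mathcal T_h)$ that form a complex: $$I(\mathbb R)=\ker\mathbf G_h^k,\qquad \operatorname{Im}\mathbf G_h^k\subset\ker\mathbf C_h^k,\qquad \operatorname{Im}\mathbf C_h^k\subset\ker D_h^k,\qquad \operatorname{Im}D_h^k=\mathcal P^k(\mathcal T_h),$$ where $I(\mathbb R)$ is the set of the interpolates of the constant functions. -/

import Mathlib

open MeasureTheory Polynomial
open scoped Matrix

noncomputable section

namespace StokesComplex

/-! ### Polynomial spaces and differential operators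

Points of space are coordinate vectors `Fin 3 → ℝ`; lengths and angles are always taken through the
dot product `⬝ᵥ` (the sup norm of the function type is used only through the topology, the
boundedness notion and the derivative it induces, which are the Euclidean ones).
Cells carry polynomials in the Cartesian coordinates, a face carries polynomials in two orthonormal
coordinates of its plane, an edge carries polynomials in its arc length. -/

abbrev R2 := Fin 2 → ℝ
abbrev R3 := Fin 3 → ℝ
abbrev P2 := MvPolynomial (Fin 2) ℝ
abbrev P3 := MvPolynomial (Fin 3) ℝ

/-- Polynomials of total degree at most `m`; the zero space if `m < 0`. -/
def Poly (σ : Type*) (m : ℤ) : Submodule ℝ (MvPolynomial σ ℝ) :=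
  if 0 ≤ m then MvPolynomial.restrictTotalDegree σ ℝ m.toNat else ⊥

/-- Vector polynomials all of whose components have total degree at most `m`. -/
def VPoly (ι σ : Type*) (m : ℤ) : Submodule ℝ (ι → MvPolynomial σ ℝ) :=
  Submodule.pi Set.univ (fun _ => Poly σ m)

/-- Univariate polynomials of degree at most `m` (for edges); the zero space if `m < 0`. -/
def PolyE (m : ℤ) : Submodule ℝ ℝ[X] := Polynomial.degreeLT ℝ (m + 1).toNat

/-- The partial derivative. -/
def pd {σ : Type*} (i : σ) : MvPolynomial σ ℝ →ₗ[ℝ] MvPolynomial σ ℝ :=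
  (MvPolynomial.pderiv i).toLinearMap

/-- The gradient. -/
def grad (σ : Type*) : MvPolynomial σ ℝ →ₗ[ℝ] (σ → MvPolynomial σ ℝ) :=
  LinearMap.pi (fun i => pd i)

/-- The divergence. -/
def div {σ : Type*} [Fintype σ] : (σ → MvPolynomial σ ℝ) →ₗ[ℝ] MvPolynomial σ ℝ :=
  ∑ i, (pd i).comp (LinearMap.proj i)

/-- The row-wise divergence of a matrix polynomial. -/
def tdiv {σ ι : Type*} [Fintype σ] (W : ι → σ → MvPolynomial σ ℝ) : ι → MvPolynomial σ ℝ :=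
  fun i => div (W i)

/-- The vector rotational `(∂₂ q, -∂₁ q)` of a scalar function of two variables. -/
def vrot : P2 →ₗ[ℝ] (Fin 2 → P2) := LinearMap.pi ![pd 1, -pd 0]

/-- The scalar rotational `∂₁ w₂ - ∂₂ w₁` of a vector function of two variables. -/
def rot (w : Fin 2 → P2) : P2 := pd 0 (w 1) - pd 1 (w 0)

/-- The curl in dimension three. -/
def curl : (Fin 3 → P3) →ₗ[ℝ] (Fin 3 → P3) :=
  LinearMap.pi
    ![(pd 1).comp (LinearMap.proj 2) - (pd 2).comp (LinearMap.proj 1),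
      (pd 2).comp (LinearMap.proj 0) - (pd 0).comp (LinearMap.proj 2),
      (pd 0).comp (LinearMap.proj 1) - (pd 1).comp (LinearMap.proj 0)]

/-- The contraction `∑ i, a i • v i` of a constant vector `a` with a vector `v` of polynomials. -/
def dotc {ι A : Type*} [Fintype ι] [AddCommMonoid A] [Module ℝ A] (a : ι → ℝ) (v : ι → A) : A :=
  ∑ i, a i • v i

/-- Multiplication of a scalar polynomial by the vector polynomial `y`. -/
def smulVec {σ : Type*} (y : σ → MvPolynomial σ ℝ) :
    MvPolynomial σ ℝ →ₗ[ℝ] (σ → MvPolynomial σ ℝ) :=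
  LinearMap.pi (fun i => LinearMap.mulLeft ℝ (y i))

/-- `𝒢^m = GRAD 𝒫^{m+1}`. -/
def Goly (σ : Type*) (m : ℤ) : Submodule ℝ (σ → MvPolynomial σ ℝ) := (Poly σ (m + 1)).map (grad σ)

/-- `ℛ^{c,m} = y 𝒫^{m-1}`, where `y` is the position vector relative to the chosen point. -/
def Rc {σ : Type*} (y : σ → MvPolynomial σ ℝ) (m : ℤ) : Submodule ℝ (σ → MvPolynomial σ ℝ) :=
  (Poly σ (m - 1)).map (smulVec y)

/-- `ℛ^m(F) = VROT 𝒫^{m+1}(F)`. -/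
def RolyF (m : ℤ) : Submodule ℝ (Fin 2 → P2) := (Poly (Fin 2) (m + 1)).map vrot

/-- The position vector on a face relative to its origin, in the orthonormal face coordinates. -/
def posF : Fin 2 → P2 := fun i => MvPolynomial.X i

/-- `𝒢^{c,m}(F) = (x - x_F)^⊥ 𝒫^{m-1}(F)`. -/
def GcF (m : ℤ) : Submodule ℝ (Fin 2 → P2) :=
  (Poly (Fin 2) (m - 1)).map (smulVec ![-posF 1, posF 0])

/-- `ℛ^m(T) = CURL 𝒫^{m+1}(T)³`. -/
def RolyT (m : ℤ) : Submodule ℝ (Fin 3 → P3) := (VPoly (Fin 3) (Fin 3) (m + 1)).map curl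

/-- The position vector `x - a` in dimension three. -/
def posT (a : R3) : Fin 3 → P3 := fun i => MvPolynomial.X i - MvPolynomial.C (a i)

/-- `𝒢^{c,m}(T) = (x - x_T) × 𝒫^{m-1}(T)³`. -/
def GcT (a : R3) (m : ℤ) : Submodule ℝ (Fin 3 → P3) :=
  (VPoly (Fin 3) (Fin 3) (m - 1)).map ((crossProduct (posT a)).restrictScalars ℝ)

/-- Matrices with rows in `ℛ^{c,m}` and zero trace. -/
def Rbc {σ : Type*} [Fintype σ] (y : σ → MvPolynomial σ ℝ) (m : ℤ) :
    Set (σ → σ → MvPolynomial σ ℝ) :=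
  {W | (∀ i, W i ∈ Rc y m) ∧ ∑ i, W i i = 0}

/-- The matrices `W` with rows in `ℛ^{c,m}` whose row-wise divergence is `GRAD q` for some
`q ∈ 𝒫^m` of zero integral: the image of `𝒫^{0,m}` under (row-wise `DIV⁻¹`) `∘ GRAD`, where `DIV⁻¹`
is the inverse of `DIV : ℛ^{c,m} → 𝒫^{m-1}`. The argument `I` is the integral. -/
def Rb {σ : Type*} [Fintype σ] (I : MvPolynomial σ ℝ → ℝ) (y : σ → MvPolynomial σ ℝ) (m : ℤ) :
    Set (σ → σ → MvPolynomial σ ℝ) :=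
  {W | (∀ i, W i ∈ Rc y m) ∧ ∃ q ∈ Poly σ m, I q = 0 ∧ tdiv W = grad σ q}

/-- Full contraction of two matrices of polynomials. -/
def tdot {ι κ A : Type*} [Fintype ι] [Fintype κ] [CommRing A] (V W : ι → κ → A) : A :=
  ∑ i, ∑ j, V i j * W i j

/-- The unique `x` with the property `p` (and `0` if there is no such `x` or more than one). -/
def theUnique {α : Type*} [Zero α] (p : α → Prop) : α :=
  open Classical in if h : ∃! x, p x then h.choose else 0

/-! ### Polyhedral meshes -/

/-- The data of a mesh with cells `𝒯`, faces `ℱ`, edges `ℰ` and vertices `𝒱`.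
The order of the two end points of an edge is its orientation. A face is described by an origin
(the point `x_F`), a frame of its plane and its domain in the coordinates given by these. -/
structure MeshData (𝒯 ℱ ℰ 𝒱 : Type*) where
  pt : 𝒱 → R3
  src : ℰ → 𝒱
  tgt : ℰ → 𝒱
  origin : ℱ → R3
  frame : ℱ → Fin 2 → R3
  faceDom : ℱ → Set R2
  cell : 𝒯 → Set R3
  center : 𝒯 → R3

variable {𝒯 ℱ ℰ 𝒱 : Type*} [Fintype 𝒯] [Fintype ℱ] [Fintype ℰ] [Fintype 𝒱]

namespace MeshData

variable (M : MeshData 𝒯 ℱ ℰ 𝒱)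

/-- The length of an edge. -/
def len (E : ℰ) : ℝ :=
  √((M.pt (M.tgt E) - M.pt (M.src E)) ⬝ᵥ (M.pt (M.tgt E) - M.pt (M.src E)))

/-- The unit tangent `t_E`. -/
def tangent (E : ℰ) : R3 := (M.len E)⁻¹ • (M.pt (M.tgt E) - M.pt (M.src E))

/-- Arc length parametrization of an edge, on `[0, len E]`. -/
def edgePt (E : ℰ) (s : ℝ) : R3 := M.pt (M.src E) + s • M.tangent E

/-- The open edge. -/
def edge (E : ℰ) : Set R3 := openSegment ℝ (M.pt (M.src E)) (M.pt (M.tgt E))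

/-- The isometric parametrization of the plane of a face. -/
def faceMap (F : ℱ) (y : R2) : R3 := M.origin F + ∑ i, y i • M.frame F i

/-- The (relatively open) face. -/
def face (F : ℱ) : Set R3 := M.faceMap F '' M.faceDom F

/-- The relative boundary of a face. -/
def faceBdry (F : ℱ) : Set R3 := M.faceMap F '' frontier (M.faceDom F)

/-- The unit normal `n_F`. -/
def normal (F : ℱ) : R3 := crossProduct (M.frame F 0) (M.frame F 1)

/-- The right-handed orthonormal basis `(n₁, n₂, n_F)` attached to a face. -/
def frame3 (F : ℱ) : Fin 3 → R3 := ![M.frame F 0, M.frame F 1, M.normal F]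

/-- The unit vector `n_{FE}` of the plane of `F`, normal to `E`, for which `(t_E, n_{FE}, n_F)` is
right-handed. -/
def normalFE (F : ℱ) (E : ℰ) : R3 := crossProduct (M.normal F) (M.tangent E)

/-- The coordinates in the frame of `F` of a vector of the plane of `F`. -/
def tang (F : ℱ) (a : R3) : R2 := fun i => M.frame F i ⬝ᵥ a

open Classical in
/-- The faces of a cell. -/
def facesOf (T : 𝒯) : Finset ℱ := Finset.univ.filter (fun F => M.face F ⊆ frontier (M.cell T))

open Classical in
/-- The edges of a face. -/
def edgesOf (F : ℱ) : Finset ℰ := Finset.univ.filter (fun E => M.edge E ⊆ M.faceBdry F)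

open Classical in
/-- `ω_{TF} = 1` if `n_F` points out of the (convex) cell `T`, and `-1` otherwise. -/
def ωT (T : 𝒯) (F : ℱ) : ℝ :=
  if ∀ x ∈ M.cell T, (x - M.origin F) ⬝ᵥ M.normal F < 0 then 1 else -1

open Classical in
/-- `ω_{FE} = 1` if `n_{FE}` points out of the (convex) face `F`, and `-1` otherwise. -/
def ωF (F : ℱ) (E : ℰ) : ℝ :=
  if ∀ x ∈ M.face F, (x - M.pt (M.src E)) ⬝ᵥ M.normalFE F E < 0 then 1 else -1

/-- All the mesh entities: open cells, open faces, open edges and vertices. -/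
def entity : 𝒯 ⊕ ℱ ⊕ ℰ ⊕ 𝒱 → Set R3 :=
  Sum.elim M.cell (Sum.elim M.face (Sum.elim M.edge (fun V => {M.pt V})))

/-- `M` is a polyhedral mesh of the domain `Ω`. Cells are open convex polyhedra: their boundary is
the union of finitely many closed planar polygons. A flat side of a cell may be made of several mesh
faces, and a straight side of a face of several mesh edges. -/
structure IsPolyhedralMesh (Ω : Set R3) : Prop where
  cover : closure Ω = ⋃ T, closure (M.cell T)
  cell_open : ∀ T, IsOpen (M.cell T)
  cell_convex : ∀ T, Convex ℝ (M.cell T)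
  cell_bounded : ∀ T, Bornology.IsBounded (M.cell T)
  center_mem : ∀ T, M.center T ∈ M.cell T
  frame_unit : ∀ F i, M.frame F i ⬝ᵥ M.frame F i = 1
  frame_orth : ∀ F, M.frame F 0 ⬝ᵥ M.frame F 1 = 0
  face_open : ∀ F, IsOpen (M.faceDom F)
  face_convex : ∀ F, Convex ℝ (M.faceDom F)
  face_bounded : ∀ F, Bornology.IsBounded (M.faceDom F)
  origin_mem : ∀ F, M.origin F ∈ M.face F
  edge_ne : ∀ E, M.src E ≠ M.tgt E
  disjoint : Pairwise (fun a b => Disjoint (M.entity a) (M.entity b))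
  cell_bdry : ∀ T, frontier (M.cell T) = ⋃ F ∈ M.facesOf T, closure (M.face F)
  face_bdry : ∀ F, M.faceBdry F =
    ⋃ E ∈ M.edgesOf F, segment ℝ (M.pt (M.src E)) (M.pt (M.tgt E))
  face_used : ∀ F, ∃ T, F ∈ M.facesOf T
  edge_used : ∀ E, ∃ F, E ∈ M.edgesOf F
  vertex_used : ∀ V, ∃ E, M.src E = V ∨ M.tgt E = V

/-! ### Integrals and restrictions -/

/-- The integral of a polynomial over a cell. -/
def intT (T : 𝒯) (p : P3) : ℝ := ∫ x in M.cell T, MvPolynomial.eval x p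

/-- The integral of a polynomial over a face. -/
def intF (F : ℱ) (p : P2) : ℝ := ∫ y in M.faceDom F, MvPolynomial.eval y p

/-- The integral of a polynomial over an edge. -/
def intE (E : ℰ) (p : ℝ[X]) : ℝ := ∫ s in (0 : ℝ)..(M.len E), p.eval s

/-- Restriction of polynomials from space to a face. -/
def resF (F : ℱ) : P3 →ₐ[ℝ] P2 :=
  MvPolynomial.aeval (fun j => MvPolynomial.C (M.origin F j) +
    ∑ i, MvPolynomial.C (M.frame F i j) * MvPolynomial.X i)

/-- Restriction of polynomials from a face to one of its edges. -/
def resE (F : ℱ) (E : ℰ) : P2 →ₐ[ℝ] ℝ[X] :=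
  MvPolynomial.aeval (fun i => Polynomial.C (M.tang F (M.pt (M.src E) - M.origin F) i) +
    Polynomial.C (M.tang F (M.tangent E) i) * Polynomial.X)

/-- `(w_F)_{|E} · n_{FE}`. -/
def dotNFE (F : ℱ) (E : ℰ) (w : Fin 2 → P2) : ℝ[X] :=
  M.resE F E (dotc (M.tang F (M.normalFE F E)) w)

/-- `(w_F)_{|E} · t_E`. -/
def dotTE (F : ℱ) (E : ℰ) (w : Fin 2 → P2) : ℝ[X] :=
  M.resE F E (dotc (M.tang F (M.tangent E)) w)

/-- `(w_T)_{|F} · n_F`. -/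
def dotNF (F : ℱ) (w : Fin 3 → P3) : P2 := M.resF F (dotc (M.normal F) w)

/-- `(r_T)_{|F} × n_F`, in the frame of `F`. -/
def crossNF (F : ℱ) (r : Fin 3 → P3) : Fin 2 → P2 := fun i =>
  M.resF F (dotc (M.frame F i) (crossProduct r (fun j => MvPolynomial.C (M.normal F j))))

/-- `v_E × t_E`. -/
def crossTE (E : ℰ) (v : Fin 3 → ℝ[X]) : Fin 3 → ℝ[X] :=
  crossProduct v (fun j => Polynomial.C (M.tangent E j))

/-- The derivative of a vector polynomial along an edge. -/
def dE (v : Fin 3 → ℝ[X]) : Fin 3 → ℝ[X] := fun i => derivative (v i)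

/-! ### Projections -/

/-- `y` is the `L²(F)`-orthogonal projection of `x` on the space `S` of tangential fields. -/
def IsProjF (F : ℱ) (S : Submodule ℝ (Fin 2 → P2)) (x y : Fin 2 → P2) : Prop :=
  y ∈ S ∧ ∀ r ∈ S, M.intF F (y ⬝ᵥ r) = M.intF F (x ⬝ᵥ r)

def projF (F : ℱ) (S : Submodule ℝ (Fin 2 → P2)) (x : Fin 2 → P2) : Fin 2 → P2 :=
  theUnique (M.IsProjF F S x)

/-- `y` is the `L²(T)`-orthogonal projection of `x` on the space `S` of vector fields. -/
def IsProjT (T : 𝒯) (S : Submodule ℝ (Fin 3 → P3)) (x y : Fin 3 → P3) : Prop :=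
  y ∈ S ∧ ∀ r ∈ S, M.intT T (y ⬝ᵥ r) = M.intT T (x ⬝ᵥ r)

def projT (T : 𝒯) (S : Submodule ℝ (Fin 3 → P3)) (x : Fin 3 → P3) : Fin 3 → P3 :=
  theUnique (M.IsProjT T S x)

/-- `p ∈ 𝒫^{m+2}(E)` has the same `L²(E)`-projection on `𝒫^m(E)` as `f`, and takes the values
`a`, `b` at the first and at the second end point of `E`. -/
def IsEdgePoly (E : ℰ) (m : ℤ) (f : ℝ → ℝ) (a b : ℝ) (p : ℝ[X]) : Prop :=
  p ∈ PolyE (m + 2) ∧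
  (∀ r ∈ PolyE m, ∫ s in (0 : ℝ)..(M.len E), p.eval s * r.eval s =
    ∫ s in (0 : ℝ)..(M.len E), f s * r.eval s) ∧
  p.eval 0 = a ∧ p.eval (M.len E) = b

def edgePoly (E : ℰ) (m : ℤ) (f : ℝ → ℝ) (a b : ℝ) : ℝ[X] := theUnique (M.IsEdgePoly E m f a b)

/-- The `L²`-projection of a function on `𝒫^m(E)`. -/
def projFunE (E : ℰ) (m : ℤ) (f : R3 → ℝ) : ℝ[X] :=
  theUnique (fun p => p ∈ PolyE m ∧ ∀ r ∈ PolyE m,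
    ∫ s in (0 : ℝ)..(M.len E), p.eval s * r.eval s =
      ∫ s in (0 : ℝ)..(M.len E), f (M.edgePt E s) * r.eval s)

/-- The `L²`-projection of a function on `𝒫^m(F)`. -/
def projFunF (F : ℱ) (m : ℤ) (f : R3 → ℝ) : P2 :=
  theUnique (fun p => p ∈ Poly (Fin 2) m ∧ ∀ r ∈ Poly (Fin 2) m,
    ∫ y in M.faceDom F, MvPolynomial.eval y p * MvPolynomial.eval y r =
      ∫ y in M.faceDom F, f (M.faceMap F y) * MvPolynomial.eval y r)

/-- The `L²`-projection of a function on `𝒫^m(T)`. -/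
def projFunT (T : 𝒯) (m : ℤ) (f : R3 → ℝ) : P3 :=
  theUnique (fun p => p ∈ Poly (Fin 3) m ∧ ∀ r ∈ Poly (Fin 3) m,
    ∫ x in M.cell T, MvPolynomial.eval x p * MvPolynomial.eval x r =
      ∫ x in M.cell T, f x * MvPolynomial.eval x r)

end MeshData

/-! ### Discrete spaces -/

/-- Families `(G_{q,V}), (q_E), (G_{q,E}), (q_F), (G_{q,F}), (q_T)`. -/
abbrev GradDofs (𝒯 ℱ ℰ 𝒱 : Type*) :=
  (𝒱 → R3) × (ℰ → ℝ[X]) × (ℰ → Fin 3 → ℝ[X]) × (ℱ → P2) × (ℱ → P2) × (𝒯 → P3)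

namespace GradDofs
def GV (q : GradDofs 𝒯 ℱ ℰ 𝒱) : 𝒱 → R3 := q.1
def qE (q : GradDofs 𝒯 ℱ ℰ 𝒱) : ℰ → ℝ[X] := q.2.1
def GE (q : GradDofs 𝒯 ℱ ℰ 𝒱) : ℰ → Fin 3 → ℝ[X] := q.2.2.1
def qF (q : GradDofs 𝒯 ℱ ℰ 𝒱) : ℱ → P2 := q.2.2.2.1
def GF (q : GradDofs 𝒯 ℱ ℰ 𝒱) : ℱ → P2 := q.2.2.2.2.1
def qT (q : GradDofs 𝒯 ℱ ℰ 𝒱) : 𝒯 → P3 := q.2.2.2.2.2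
end GradDofs

/-- Families `(R_{v,V}), (v_E), (R_{v,E}), (v_{ℛ,F}), (v^c_{ℛ,F}), (v_F), (G_{v,F}), (G^c_{v,F}),
(v_{ℛ,T}), (v^c_{ℛ,T})`. -/
abbrev CurlDofs (𝒯 ℱ ℰ 𝒱 : Type*) :=
  (𝒱 → R3) × (ℰ → Fin 3 → ℝ[X]) × (ℰ → Fin 3 → ℝ[X]) ×
  (ℱ → Fin 2 → P2) × (ℱ → Fin 2 → P2) × (ℱ → P2) × (ℱ → Fin 2 → P2) × (ℱ → Fin 2 → P2) ×
  (𝒯 → Fin 3 → P3) × (𝒯 → Fin 3 → P3)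

namespace CurlDofs
def RV (v : CurlDofs 𝒯 ℱ ℰ 𝒱) : 𝒱 → R3 := v.1
def vE (v : CurlDofs 𝒯 ℱ ℰ 𝒱) : ℰ → Fin 3 → ℝ[X] := v.2.1
def RE (v : CurlDofs 𝒯 ℱ ℰ 𝒱) : ℰ → Fin 3 → ℝ[X] := v.2.2.1
def rF (v : CurlDofs 𝒯 ℱ ℰ 𝒱) : ℱ → Fin 2 → P2 := v.2.2.2.1
def rcF (v : CurlDofs 𝒯 ℱ ℰ 𝒱) : ℱ → Fin 2 → P2 := v.2.2.2.2.1
def vF (v : CurlDofs 𝒯 ℱ ℰ 𝒱) : ℱ → P2 := v.2.2.2.2.2.1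
def GF (v : CurlDofs 𝒯 ℱ ℰ 𝒱) : ℱ → Fin 2 → P2 := v.2.2.2.2.2.2.1
def GcF (v : CurlDofs 𝒯 ℱ ℰ 𝒱) : ℱ → Fin 2 → P2 := v.2.2.2.2.2.2.2.1
def rT (v : CurlDofs 𝒯 ℱ ℰ 𝒱) : 𝒯 → Fin 3 → P3 := v.2.2.2.2.2.2.2.2.1
def rcT (v : CurlDofs 𝒯 ℱ ℰ 𝒱) : 𝒯 → Fin 3 → P3 := v.2.2.2.2.2.2.2.2.2
end CurlDofs

/-- Families `(w_E), (w_F), (w_{𝒢,F}), (w^c_{𝒢,F}), (w_{𝒢,T}), (w^c_{𝒢,T})`. -/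
abbrev JacDofs (𝒯 ℱ ℰ : Type*) :=
  (ℰ → Fin 3 → ℝ[X]) × (ℱ → P2) × (ℱ → Fin 2 → P2) × (ℱ → Fin 2 → P2) ×
  (𝒯 → Fin 3 → P3) × (𝒯 → Fin 3 → P3)

namespace JacDofs
def wE (w : JacDofs 𝒯 ℱ ℰ) : ℰ → Fin 3 → ℝ[X] := w.1
def wF (w : JacDofs 𝒯 ℱ ℰ) : ℱ → P2 := w.2.1
def gF (w : JacDofs 𝒯 ℱ ℰ) : ℱ → Fin 2 → P2 := w.2.2.1
def gcF (w : JacDofs 𝒯 ℱ ℰ) : ℱ → Fin 2 → P2 := w.2.2.2.1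
def gT (w : JacDofs 𝒯 ℱ ℰ) : 𝒯 → Fin 3 → P3 := w.2.2.2.2.1
def gcT (w : JacDofs 𝒯 ℱ ℰ) : 𝒯 → Fin 3 → P3 := w.2.2.2.2.2
end JacDofs

namespace MeshData

variable (M : MeshData 𝒯 ℱ ℰ 𝒱) (k : ℤ)

/-- Continuous functions on the edge skeleton that are polynomial of degree at most `m` on each edge:
the values at the end points of the edges come from one value for each vertex. -/
def PolyC (m : ℤ) : Submodule ℝ (ℰ → ℝ[X]) where
  carrier := {q | (∀ E, q E ∈ PolyE m) ∧ ∃ u : 𝒱 → ℝ, ∀ E,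
    (q E).eval 0 = u (M.src E) ∧ (q E).eval (M.len E) = u (M.tgt E)}
  zero_mem' := ⟨fun _ => Submodule.zero_mem _, 0, fun _ => by simp⟩
  add_mem' := by
    rintro p q ⟨hp, u, hu⟩ ⟨hq, v, hv⟩
    exact ⟨fun E => Submodule.add_mem _ (hp E) (hq E), u + v, fun E => by simp [hu E, hv E]⟩
  smul_mem' := by
    rintro c p ⟨hp, u, hu⟩
    exact ⟨fun E => Submodule.smul_mem _ c (hp E), c • u, fun E => by simp [hu E]⟩

/-- The vector version of `PolyC`. -/
def VPolyC (m : ℤ) : Submodule ℝ (ℰ → Fin 3 → ℝ[X]) where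
  carrier := {v | ∀ i, (fun E => v E i) ∈ M.PolyC m}
  zero_mem' := fun _ => Submodule.zero_mem (M.PolyC m)
  add_mem' := fun hp hq i => Submodule.add_mem (M.PolyC m) (hp i) (hq i)
  smul_mem' := fun c _ hp i => Submodule.smul_mem (M.PolyC m) c (hp i)

/-- Vector polynomials of degree at most `m` on the edge `E` that are normal to `E`. -/
def PolyPerpE (m : ℤ) (E : ℰ) : Submodule ℝ (Fin 3 → ℝ[X]) where
  carrier := {g | (∀ i, g i ∈ PolyE m) ∧ dotc (M.tangent E) g = 0}
  zero_mem' := ⟨fun _ => Submodule.zero_mem _, by simp [dotc]⟩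
  add_mem' := by
    rintro p q ⟨hp, hp2⟩ ⟨hq, hq2⟩
    refine ⟨fun i => Submodule.add_mem _ (hp i) (hq i), ?_⟩
    simp only [dotc, Pi.add_apply, smul_add, Finset.sum_add_distrib] at *
    rw [hp2, hq2, add_zero]
  smul_mem' := by
    rintro c p ⟨hp, hp2⟩
    refine ⟨fun i => Submodule.smul_mem _ c (hp i), ?_⟩
    simp only [dotc, Pi.smul_apply, smul_comm _ c, ← Finset.smul_sum] at *
    rw [hp2, smul_zero]

/-- The discrete space `X_{GRAD,h}^k`. -/
def XGrad : Submodule ℝ (GradDofs 𝒯 ℱ ℰ 𝒱) :=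
  (⊤ : Submodule ℝ (𝒱 → R3)).prod <|
  (M.PolyC (k + 1)).prod <|
  (Submodule.pi Set.univ (fun E => M.PolyPerpE k E)).prod <|
  (Submodule.pi Set.univ (fun _ : ℱ => Poly (Fin 2) (k - 1))).prod <|
  (Submodule.pi Set.univ (fun _ : ℱ => Poly (Fin 2) (k - 1))).prod <|
  Submodule.pi Set.univ (fun _ : 𝒯 => Poly (Fin 3) (k - 1))

/-- The discrete space `X_{CURL,h}^k`. -/
def XCurl : Submodule ℝ (CurlDofs 𝒯 ℱ ℰ 𝒱) :=
  (⊤ : Submodule ℝ (𝒱 → R3)).prod <|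
  (M.VPolyC (k + 2)).prod <|
  (Submodule.pi Set.univ
    (fun _ : ℰ => Submodule.pi Set.univ (fun _ : Fin 3 => PolyE (k + 1)))).prod <|
  (Submodule.pi Set.univ (fun _ : ℱ => RolyF (k - 1))).prod <|
  (Submodule.pi Set.univ (fun _ : ℱ => Rc posF k)).prod <|
  (Submodule.pi Set.univ (fun _ : ℱ => Poly (Fin 2) (k - 1))).prod <|
  (Submodule.pi Set.univ (fun _ : ℱ => Goly (Fin 2) k)).prod <|
  (Submodule.pi Set.univ (fun _ : ℱ => GcF k)).prod <|
  (Submodule.pi Set.univ (fun _ : 𝒯 => RolyT (k - 1))).prod <|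
  Submodule.pi Set.univ (fun T : 𝒯 => Rc (posT (M.center T)) k)

/-- The discrete space `X_{∇,h}^k`. -/
def XJac : Submodule ℝ (JacDofs 𝒯 ℱ ℰ) :=
  (M.VPolyC (k + 3)).prod <|
  (Submodule.pi Set.univ (fun _ : ℱ => Poly (Fin 2) k)).prod <|
  (Submodule.pi Set.univ (fun _ : ℱ => Goly (Fin 2) k)).prod <|
  (Submodule.pi Set.univ (fun _ : ℱ => GcF k)).prod <|
  (Submodule.pi Set.univ (fun _ : 𝒯 => Goly (Fin 3) (k - 1))).prod <|
  Submodule.pi Set.univ (fun T : 𝒯 => GcT (M.center T) k)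

/-- The space `𝒫^k(𝒯_h)` of broken polynomials, which is also `X_{L²,h}^k`. -/
def BrokenPoly (_M : MeshData 𝒯 ℱ ℰ 𝒱) (k : ℤ) : Submodule ℝ (𝒯 → P3) :=
  Submodule.pi Set.univ (fun _ => Poly (Fin 3) k)

/-! ### The interpolator on `X_{GRAD,h}^k` -/

/-- The gradient of a function on space. -/
def gradFun (q : R3 → ℝ) (x : R3) : R3 := fun i => fderiv ℝ q x (Pi.single i 1)

/-- The interpolator on `X_{GRAD,h}^k`. -/
def interpGrad (q : R3 → ℝ) : GradDofs 𝒯 ℱ ℰ 𝒱 :=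
  (fun V => gradFun q (M.pt V),
   fun E => M.edgePoly E (k - 1) (fun s => q (M.edgePt E s)) (q (M.pt (M.src E)))
      (q (M.pt (M.tgt E))),
   fun E i => M.projFunE E k (fun x =>
      crossProduct (M.tangent E) (crossProduct (gradFun q x) (M.tangent E)) i),
   fun F => M.projFunF F (k - 1) q,
   fun F => M.projFunF F (k - 1) (fun x => gradFun q x ⬝ᵥ M.normal F),
   fun T => M.projFunT T (k - 1) q)

/-! ### The discrete gradient -/

/-- The edge component `v_E` of the discrete gradient. -/
def gradE (q : GradDofs 𝒯 ℱ ℰ 𝒱) (E : ℰ) : Fin 3 → ℝ[X] := fun i =>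
  M.edgePoly E k
    (fun s => (derivative (q.qE E) * Polynomial.C (M.tangent E i) + q.GE E i).eval s)
    (q.GV (M.src E) i) (q.GV (M.tgt E) i)

/-- The defining relation of `g = G_F^k q`. -/
def IsGradF (F : ℱ) (q : GradDofs 𝒯 ℱ ℰ 𝒱) (g : Fin 2 → P2) : Prop :=
  g ∈ VPoly (Fin 2) (Fin 2) k ∧ ∀ w ∈ VPoly (Fin 2) (Fin 2) k,
    M.intF F (g ⬝ᵥ w) = -M.intF F (q.qF F * div w) +
      ∑ E ∈ M.edgesOf F, M.ωF F E * M.intE E (q.qE E * M.dotNFE F E w)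

def gradF (F : ℱ) (q : GradDofs 𝒯 ℱ ℰ 𝒱) : Fin 2 → P2 := theUnique (M.IsGradF k F q)

/-- The defining relation of `g = G_F^{⊥k} q`. -/
def IsGradPerpF (F : ℱ) (q : GradDofs 𝒯 ℱ ℰ 𝒱) (g : Fin 2 → P2) : Prop :=
  g ∈ VPoly (Fin 2) (Fin 2) k ∧ ∀ w ∈ VPoly (Fin 2) (Fin 2) k,
    M.intF F (g ⬝ᵥ w) = -M.intF F (q.GF F * rot w) -
      ∑ E ∈ M.edgesOf F,
        M.ωF F E * M.intE E (dotc (M.normal F) (q.GE E) * M.dotTE F E w)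

def gradPerpF (F : ℱ) (q : GradDofs 𝒯 ℱ ℰ 𝒱) : Fin 2 → P2 := theUnique (M.IsGradPerpF k F q)

/-- The defining relation of the scalar trace `p = γ_{GRAD,F}^{k+1} q`. -/
def IsTraceGradF (F : ℱ) (q : GradDofs 𝒯 ℱ ℰ 𝒱) (p : P2) : Prop :=
  p ∈ Poly (Fin 2) (k + 1) ∧ ∀ v ∈ Rc posF (k + 2),
    M.intF F (p * div v) = -M.intF F (M.gradF k F q ⬝ᵥ v) +
      ∑ E ∈ M.edgesOf F, M.ωF F E * M.intE E (q.qE E * M.dotNFE F E v)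

def traceGradF (F : ℱ) (q : GradDofs 𝒯 ℱ ℰ 𝒱) : P2 := theUnique (M.IsTraceGradF k F q)

/-- The defining relation of `g = G_T^k q`. -/
def IsGradT (T : 𝒯) (q : GradDofs 𝒯 ℱ ℰ 𝒱) (g : Fin 3 → P3) : Prop :=
  g ∈ VPoly (Fin 3) (Fin 3) k ∧ ∀ w ∈ VPoly (Fin 3) (Fin 3) k,
    M.intT T (g ⬝ᵥ w) = -M.intT T (q.qT T * div w) +
      ∑ F ∈ M.facesOf T, M.ωT T F * M.intF F (M.traceGradF k F q * M.dotNF F w)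

def gradT (T : 𝒯) (q : GradDofs 𝒯 ℱ ℰ 𝒱) : Fin 3 → P3 := theUnique (M.IsGradT k T q)

/-- The discrete gradient `G_h^k`. -/
def gradH (q : GradDofs 𝒯 ℱ ℰ 𝒱) : CurlDofs 𝒯 ℱ ℰ 𝒱 :=
  (fun _ => 0,
   fun E => M.gradE k q E,
   fun E => M.crossTE E (dE (M.gradE k q E)),
   fun F => M.projF F (RolyF (k - 1)) (M.gradF k F q),
   fun F => M.projF F (Rc posF k) (M.gradF k F q),
   fun F => q.GF F,
   fun F => M.projF F (Goly (Fin 2) k) (M.gradPerpF k F q),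
   fun F => M.projF F (GcF k) (M.gradPerpF k F q),
   fun T => M.projT T (RolyT (k - 1)) (M.gradT k T q),
   fun T => M.projT T (Rc (posT (M.center T)) k) (M.gradT k T q))

/-! ### The discrete curl -/

/-- The edge component `C_E^k v` of the discrete curl. -/
def curlE (v : CurlDofs 𝒯 ℱ ℰ 𝒱) (E : ℰ) : Fin 3 → ℝ[X] := fun i =>
  M.edgePoly E (k + 1) (fun s => (v.RE E i - M.crossTE E (dE (v.vE E)) i).eval s)
    (v.RV (M.src E) i) (v.RV (M.tgt E) i)

/-- The defining relation of the scalar face curl `p = C_F^k v`. -/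
def IsCurlF (F : ℱ) (v : CurlDofs 𝒯 ℱ ℰ 𝒱) (p : P2) : Prop :=
  p ∈ Poly (Fin 2) k ∧ ∀ r ∈ Poly (Fin 2) k,
    M.intF F (p * r) = M.intF F (v.rF F ⬝ᵥ vrot r) -
      ∑ E ∈ M.edgesOf F,
        M.ωF F E * M.intE E (dotc (M.tangent E) (v.vE E) * M.resE F E r)

def curlF (F : ℱ) (v : CurlDofs 𝒯 ℱ ℰ 𝒱) : P2 := theUnique (M.IsCurlF k F v)

/-- The defining relation of the vector face curl `g = 𝐂_F^k v`. -/
def IsVCurlF (F : ℱ) (v : CurlDofs 𝒯 ℱ ℰ 𝒱) (g : Fin 2 → P2) : Prop :=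
  g ∈ VPoly (Fin 2) (Fin 2) k ∧ ∀ r ∈ VPoly (Fin 2) (Fin 2) k,
    M.intF F (g ⬝ᵥ r) = M.intF F (v.vF F * rot r) +
      ∑ E ∈ M.edgesOf F,
        M.ωF F E * M.intE E (dotc (M.normal F) (v.vE E) * M.dotTE F E r)

def vcurlF (F : ℱ) (v : CurlDofs 𝒯 ℱ ℰ 𝒱) : Fin 2 → P2 := theUnique (M.IsVCurlF k F v)

/-- The defining relation of the tangential trace `g = γ_{t,ROT,F}^k v`. -/
def IsTraceTF (F : ℱ) (v : CurlDofs 𝒯 ℱ ℰ 𝒱) (g : Fin 2 → P2) : Prop :=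
  g ∈ VPoly (Fin 2) (Fin 2) k ∧
  ∀ r ∈ Poly (Fin 2) (k + 1), M.intF F r = 0 → ∀ w ∈ Rc posF k,
    M.intF F (g ⬝ᵥ (vrot r + w)) = M.intF F (M.curlF k F v * r) +
      ∑ E ∈ M.edgesOf F,
        M.ωF F E * M.intE E (dotc (M.tangent E) (v.vE E) * M.resE F E r) +
      M.intF F (v.rcF F ⬝ᵥ w)

def traceTF (F : ℱ) (v : CurlDofs 𝒯 ℱ ℰ 𝒱) : Fin 2 → P2 := theUnique (M.IsTraceTF k F v)

/-- The defining relation of the cell curl `g = 𝐂_T^k v`. -/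
def IsCurlT (T : 𝒯) (v : CurlDofs 𝒯 ℱ ℰ 𝒱) (g : Fin 3 → P3) : Prop :=
  g ∈ VPoly (Fin 3) (Fin 3) k ∧ ∀ r ∈ VPoly (Fin 3) (Fin 3) k,
    M.intT T (g ⬝ᵥ r) = M.intT T (v.rT T ⬝ᵥ curl r) +
      ∑ F ∈ M.facesOf T, M.ωT T F * M.intF F (M.traceTF k F v ⬝ᵥ M.crossNF F r)

def curlT (T : 𝒯) (v : CurlDofs 𝒯 ℱ ℰ 𝒱) : Fin 3 → P3 := theUnique (M.IsCurlT k T v)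

/-- The discrete curl `C_h^k`. -/
def curlH (v : CurlDofs 𝒯 ℱ ℰ 𝒱) : JacDofs 𝒯 ℱ ℰ :=
  (fun E => M.curlE k v E,
   fun F => M.curlF k F v,
   fun F => M.projF F (Goly (Fin 2) k) (M.vcurlF k F v) + v.GF F,
   fun F => M.projF F (GcF k) (M.vcurlF k F v) + v.GcF F,
   fun T => M.projT T (Goly (Fin 3) (k - 1)) (M.curlT k T v),
   fun T => M.projT T (GcT (M.center T) k) (M.curlT k T v))

/-! ### The discrete Jacobian and the discrete divergence -/

/-- The tensor with tangential rows `V` and normal row `w`: rows refer to the basis `(n₁, n₂, n_F)`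
of the face, columns to `(n₁, n₂)`. -/
def faceTensor (V : Fin 2 → Fin 2 → P2) (w : Fin 2 → P2) : Fin 3 → Fin 2 → P2 := ![V 0, V 1, w]

/-- `∑_E ω_{FE} ∫_E w_E · (V n_{FE})`, for a tensor `V` on the face `F`. -/
def edgeFlux (F : ℱ) (w : JacDofs 𝒯 ℱ ℰ) (V : Fin 3 → Fin 2 → P2) : ℝ :=
  ∑ E ∈ M.edgesOf F, M.ωF F E *
    M.intE E (∑ i, dotc (M.frame3 F i) (w.wE E) * M.dotNFE F E (V i))

/-- The defining relation of the face Jacobian `J = ∇_F^{k+1} w`. It belongs to the space of tensors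
`V₁ + V₂ + V₃ + n_F ⊗ z` below, and is tested against this space. -/
def IsJacF (F : ℱ) (w : JacDofs 𝒯 ℱ ℰ) (J : Fin 3 → Fin 2 → P2) : Prop :=
  (∃ V₁ ∈ Rbc posF (k + 1), ∃ V₂ ∈ Rb (M.intF F) posF (k + 1),
    ∃ V₃ : Fin 2 → Fin 2 → P2, (∀ i, V₃ i ∈ RolyF (k + 1)) ∧
    ∃ z ∈ VPoly (Fin 2) (Fin 2) (k + 1), J = faceTensor (V₁ + V₂ + V₃) z) ∧
  ∀ V₁ ∈ Rbc posF (k + 1), ∀ V₂ ∈ Rb (M.intF F) posF (k + 1),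
    ∀ V₃ : Fin 2 → Fin 2 → P2, (∀ i, V₃ i ∈ RolyF (k + 1)) →
    ∀ z ∈ VPoly (Fin 2) (Fin 2) (k + 1),
    M.intF F (tdot J (faceTensor (V₁ + V₂ + V₃) z)) =
      -M.intF F (w.gcF F ⬝ᵥ tdiv V₁) - M.intF F (w.gF F ⬝ᵥ tdiv V₂) - M.intF F (w.wF F * div z) +
      M.edgeFlux F w (faceTensor (V₁ + V₂ + V₃) z)

def jacF (F : ℱ) (w : JacDofs 𝒯 ℱ ℰ) : Fin 3 → Fin 2 → P2 := theUnique (M.IsJacF k F w)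

/-- The defining relation of the trace `g = γ_{∇,F}^{k+2} w`, whose three components refer to the
basis `(n₁, n₂, n_F)` of the face. -/
def IsTraceJacF (F : ℱ) (w : JacDofs 𝒯 ℱ ℰ) (g : Fin 3 → P2) : Prop :=
  g ∈ VPoly (Fin 3) (Fin 2) (k + 2) ∧
  ∀ V : Fin 3 → Fin 2 → P2, (∀ i, V i ∈ Rc posF (k + 3)) →
    M.intF F (g ⬝ᵥ tdiv V) = -M.intF F (tdot (M.jacF k F w) V) + M.edgeFlux F w V

def traceJacF (F : ℱ) (w : JacDofs 𝒯 ℱ ℰ) : Fin 3 → P2 := theUnique (M.IsTraceJacF k F w)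

/-- The defining relation of the cell Jacobian `J = ∇_T^{k+1} w`. It belongs to the space of matrices
`V₁ + V₂ + V₃` below, and is tested against this space. -/
def IsJacT (T : 𝒯) (w : JacDofs 𝒯 ℱ ℰ) (J : Fin 3 → Fin 3 → P3) : Prop :=
  (∃ V₁ ∈ Rbc (posT (M.center T)) (k + 1), ∃ V₂ ∈ Rb (M.intT T) (posT (M.center T)) k,
    ∃ V₃ : Fin 3 → Fin 3 → P3, (∀ i, V₃ i ∈ RolyT k) ∧ J = V₁ + V₂ + V₃) ∧
  ∀ V₁ ∈ Rbc (posT (M.center T)) (k + 1), ∀ V₂ ∈ Rb (M.intT T) (posT (M.center T)) k,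
    ∀ V₃ : Fin 3 → Fin 3 → P3, (∀ i, V₃ i ∈ RolyT k) →
    M.intT T (tdot J (V₁ + V₂ + V₃)) =
      -M.intT T (w.gcT T ⬝ᵥ tdiv V₁) - M.intT T (w.gT T ⬝ᵥ tdiv V₂) +
      ∑ F ∈ M.facesOf T, M.ωT T F * M.intF F (∑ a, M.traceJacF k F w a *
        M.dotNF F (fun j => dotc (M.frame3 F a) (fun i => (V₁ + V₂ + V₃) i j)))

def jacT (T : 𝒯) (w : JacDofs 𝒯 ℱ ℰ) : Fin 3 → Fin 3 → P3 := theUnique (M.IsJacT k T w)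

/-- The discrete divergence `D_h^k`: on each cell, the trace of the cell Jacobian. -/
def divH (w : JacDofs 𝒯 ℱ ℰ) : 𝒯 → P3 := fun T => ∑ i, M.jacT k T w i i

/-! ### Well-posedness of the implicit definitions -/

/-- Each of the relations that define the local operators and projections has exactly one solution. -/
structure WellPosed : Prop where
  projF : ∀ F S, S ≤ VPoly (Fin 2) (Fin 2) k → ∀ x, ∃! y, M.IsProjF F S x y
  projT : ∀ T S, S ≤ VPoly (Fin 3) (Fin 3) k → ∀ x, ∃! y, M.IsProjT T S x y
  edgePoly : ∀ E (m : ℤ) (f : ℝ[X]) a b, -1 ≤ m →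
    ∃! p, M.IsEdgePoly E m (fun s => f.eval s) a b p
  gradF : ∀ F, ∀ q ∈ M.XGrad k, ∃! g, M.IsGradF k F q g
  gradPerpF : ∀ F, ∀ q ∈ M.XGrad k, ∃! g, M.IsGradPerpF k F q g
  traceGradF : ∀ F, ∀ q ∈ M.XGrad k, ∃! p, M.IsTraceGradF k F q p
  gradT : ∀ T, ∀ q ∈ M.XGrad k, ∃! g, M.IsGradT k T q g
  curlF : ∀ F, ∀ v ∈ M.XCurl k, ∃! p, M.IsCurlF k F v p
  vcurlF : ∀ F, ∀ v ∈ M.XCurl k, ∃! g, M.IsVCurlF k F v g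
  traceTF : ∀ F, ∀ v ∈ M.XCurl k, ∃! g, M.IsTraceTF k F v g
  curlT : ∀ T, ∀ v ∈ M.XCurl k, ∃! g, M.IsCurlT k T v g
  jacF : ∀ F, ∀ w ∈ M.XJac k, ∃! J, M.IsJacF k F w J
  traceJacF : ∀ F, ∀ w ∈ M.XJac k, ∃! g, M.IsTraceJacF k F w g
  jacT : ∀ T, ∀ w ∈ M.XJac k, ∃! J, M.IsJacT k T w J

end MeshData

end StokesComplex

end

/-!
The complex property reduces to finite-dimensional integration by parts for polynomials on convex
polytopes, together with two topological facts about the mesh.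

*Polynomials.* The operator `c + (x - a) · ∇` multiplies the homogeneous part of degree `j` about
`a` by `c + j`, so it is bijective on `𝒫^m` for `c > 0` (`exists_eul_eq`). Since
`div ((x - a) p) = (n + (x - a) · ∇) p`, the divergence is a bijection from `ℛ^{c,m}` to
`𝒫^{m-1}` (`exists_Rc_div_eq`). The inverse of the operator also gives explicit
potentials of divergence-free fields (`exists_vrot_eq`, `exists_curl_eq`), hence
`𝒫^m = ℛ^m + ℛ^{c,m}` on a face.

*Well-posedness.* Each local problem asks for an element of the image of a space of test functions
`x` under a linear map `d`, with prescribed products with all `d x`. It has exactly one solution,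
which depends linearly on the data, as soon as the right-hand side only depends on `d x`
(`exists_solution_operator`). This is clear except for the Jacobians, where a decomposition
`V₁ + V₂ + V₃` is not unique; the data enter through `div V₁` and `div V₂`, which are determined by
the sum (`tdiv_eq_zero_of_add_eq_zero`).

*Geometry.* The divergence theorem holds on cells and faces: on almost every line parallel to a
coordinate axis it is the fundamental theorem of calculus, and the end points of the segment cut
out by the line are accounted for by the faces through them (`integral_pd_eq_sum_flux`). As
polynomials are dense in the continuous functions on a compact set, they separate the cells, the
edges and the vertices, so that the divergence theorem yields the combinatorial identities
"the boundary of a boundary is zero" (`sum_edgesOf_vertex`, `sum_facesOf_edgesOf`) and the fact that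
no non-zero combination of cells is a cycle (`eq_zero_of_sum_cells`). The edge skeleton is connected
because the boundary of a bounded open convex set of dimension at least two is a sphere and `Ω` is
connected (`label_const`).

*Curl of a gradient.* On edges it vanishes by definition. On a face, the curl of `G q` tested with
`r` is a sum over the edges of the differences of the end point values of `q_E r`, which telescopes
(`curlF_gradH`). On a cell, the tangential traces of `G q` and the face gradients of `q` have the
same moments against `𝒫^{k-1} + ℛ^{c,k}`; this space contains `r × n_F` for all test fields `r` in
use, so that the curl of `G q` reduces to the boundary of a boundary (`intT_curlT_gradH`).

*Divergence of a curl.* Testing the Jacobian on a cell with `q I` expresses the moments of its trace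
by `w_{𝒢,T}` and `w_F` alone: `∫ (tr J_T) q = -∫ w_{𝒢,T} · ∇q + Σ_F ω_{TF} ∫_F w_F q`
(`intT_divH`). For `w = C v` the right-hand side is a sum of edge terms over the boundary of a
boundary (`divH_curlH`).

*Surjectivity.* By the same formula it suffices to find face components whose outward fluxes match
the integrals of the given polynomials, which is dual to `eq_zero_of_sum_cells`
(`exists_face_flux`); the other moments are supplied by `w_{𝒢,T}` (`exists_divH_eq`).

*Kernel of the gradient.* If `G q = 0`, the edge components are constant on each edge, hence equal
to one constant `c` by connectedness. The face and cell gradients then have no moments against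
`ℛ^c`, and as the divergence maps `ℛ^{c,k}` onto `𝒫^{k-1}`, the moments of `q_F` and `q_T` are
those of `c` (`exists_isConst_of_gradH_eq_zero`).
-/

set_option linter.unusedSectionVars false

noncomputable section

namespace StokesComplex

/-! ### Polynomials of bounded degree -/

section Degree

variable {σ ι : Type*}

theorem mem_Poly_iff {m : ℤ} {p : MvPolynomial σ ℝ} :
    p ∈ Poly σ m ↔ ∀ d ∈ p.support, (d.degree : ℤ) ≤ m := by
  unfold Poly
  split_ifs with h
  · change (∀ d ∈ p.support, d.sum (fun _ e => e) ≤ m.toNat) ↔ _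
    refine forall₂_congr fun d _ => ?_
    rw [Finsupp.degree_apply, Finsupp.sum]
    omega
  · rw [Submodule.mem_bot, ← MvPolynomial.support_eq_empty, Finset.eq_empty_iff_forall_notMem]
    refine forall_congr' fun d => ⟨fun h' h'' => absurd h'' h', fun h' h'' => ?_⟩
    have := h' h''
    omega

theorem Poly_mono {m n : ℤ} (h : m ≤ n) : Poly σ m ≤ Poly σ n := fun _ hp =>
  mem_Poly_iff.2 fun d hd => (mem_Poly_iff.1 hp d hd).trans h

theorem Poly_mul {m n : ℤ} {p q : MvPolynomial σ ℝ} (hp : p ∈ Poly σ m) (hq : q ∈ Poly σ n) :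
    p * q ∈ Poly σ (m + n) := by
  classical
  rw [mem_Poly_iff] at *
  intro d hd
  obtain ⟨a, ha, b, hb, rfl⟩ := Finset.mem_add.1 (MvPolynomial.support_mul p q hd)
  have := hp a ha
  have := hq b hb
  rw [map_add]
  push_cast
  omega

theorem C_mem_Poly {m : ℤ} (hm : 0 ≤ m) (c : ℝ) : MvPolynomial.C c ∈ Poly σ m := by
  rw [mem_Poly_iff]
  intro d hd
  have : d = 0 := by
    classical
    by_contra h
    rw [MvPolynomial.mem_support_iff, MvPolynomial.coeff_C, if_neg (Ne.symm h)] at hd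
    exact hd rfl
  simpa [this] using hm

theorem X_mem_Poly (i : σ) : (MvPolynomial.X i : MvPolynomial σ ℝ) ∈ Poly σ 1 := by
  classical
  rw [mem_Poly_iff]
  intro d hd
  rw [MvPolynomial.support_X, Finset.mem_singleton] at hd
  simp [hd]

theorem pd_mem_Poly {m : ℤ} {p : MvPolynomial σ ℝ} (i : σ) (hp : p ∈ Poly σ m) :
    pd i p ∈ Poly σ (m - 1) := by
  rw [mem_Poly_iff] at *
  intro d hd
  have h : d + Finsupp.single i 1 ∈ p.support := by
    rw [MvPolynomial.mem_support_iff] at *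
    intro h0
    apply hd
    change MvPolynomial.coeff d (MvPolynomial.pderiv i p) = 0
    rw [MvPolynomial.coeff_pderiv, h0, zero_mul]
  have := hp _ h
  rw [map_add, Finsupp.degree_single] at this
  push_cast at this
  omega

instance [Finite σ] (m : ℤ) : FiniteDimensional ℝ (Poly σ m) := by
  by_cases h : 0 ≤ m
  · rw [Poly, if_pos h]
    infer_instance
  · rw [Poly, if_neg h]
    infer_instance

theorem mem_VPoly_iff {m : ℤ} {v : ι → MvPolynomial σ ℝ} :
    v ∈ VPoly ι σ m ↔ ∀ i, v i ∈ Poly σ m := by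
  simp [VPoly, Submodule.mem_pi]

theorem VPoly_mono {m n : ℤ} (h : m ≤ n) : VPoly ι σ m ≤ VPoly ι σ n := fun _ hp =>
  mem_VPoly_iff.2 fun i => Poly_mono h (mem_VPoly_iff.1 hp i)

instance [Finite ι] [Finite σ] (m : ℤ) : FiniteDimensional ℝ (VPoly ι σ m) := by
  have e : VPoly ι σ m ≃ₗ[ℝ] (ι → Poly σ m) :=
    { toFun := fun v i => ⟨v.1 i, mem_VPoly_iff.1 v.2 i⟩
      invFun := fun w => ⟨fun i => (w i).1, mem_VPoly_iff.2 fun i => (w i).2⟩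
      map_add' := fun _ _ => rfl
      map_smul' := fun _ _ => rfl
      left_inv := fun _ => rfl
      right_inv := fun _ => rfl }
  exact LinearEquiv.finiteDimensional e.symm

/-- An algebra homomorphism that sends the variables to elements of degree at most one does not
increase the degree. The degree in the target algebra is given by the filtration `W`. -/
theorem aeval_mem_of_mem_Poly {A : Type*} [CommRing A] [Algebra ℝ A] (W : ℤ → Submodule ℝ A)
    (hone : 1 ∈ W 0) (hmono : ∀ m n, m ≤ n → W m ≤ W n)
    (hmul : ∀ m n, ∀ a ∈ W m, ∀ b ∈ W n, a * b ∈ W (m + n))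
    {f : σ → A} (hf : ∀ i, f i ∈ W 1) {m : ℤ} {p : MvPolynomial σ ℝ} (hp : p ∈ Poly σ m) :
    MvPolynomial.aeval f p ∈ W m := by
  rw [mem_Poly_iff] at hp
  rw [p.as_sum, map_sum]
  refine Submodule.sum_mem _ fun d hd => ?_
  rw [MvPolynomial.aeval_monomial, ← Algebra.smul_def]
  refine Submodule.smul_mem _ _ (hmono _ _ (hp d hd) ?_)
  have hpow : ∀ (a : A), a ∈ W 1 → ∀ n : ℕ, a ^ n ∈ W n := by
    intro a ha n
    induction n with
    | zero => simpa using hone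
    | succ n ih => rw [pow_succ]; push_cast; exact hmul _ _ _ ih _ ha
  rw [Finsupp.degree_apply, Finsupp.prod]
  classical
  induction d.support using Finset.induction_on with
  | empty => simpa using hone
  | insert a s ha ih =>
    rw [Finset.prod_insert ha, Finset.sum_insert ha]
    push_cast at ih ⊢
    exact hmul _ _ _ (hpow _ (hf _) _) _ ih

theorem aeval_mem_Poly {τ : Type*} {f : σ → MvPolynomial τ ℝ} (hf : ∀ i, f i ∈ Poly τ 1) {m : ℤ}
    {p : MvPolynomial σ ℝ} (hp : p ∈ Poly σ m) : MvPolynomial.aeval f p ∈ Poly τ m :=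
  aeval_mem_of_mem_Poly (Poly τ) (by simpa using C_mem_Poly (σ := τ) le_rfl 1)
    (fun _ _ h => Poly_mono h) (fun _ _ _ ha _ hb => Poly_mul ha hb) hf hp

theorem mem_PolyE_iff {m : ℤ} (hm : -1 ≤ m) {p : ℝ[X]} :
    p ∈ PolyE m ↔ ∀ d ∈ p.support, (d : ℤ) ≤ m := by
  rw [PolyE, Polynomial.mem_degreeLT, Polynomial.degree_lt_iff_coeff_zero]
  refine ⟨fun h d hd => ?_, fun h d hd => ?_⟩
  · by_contra hlt
    exact Polynomial.mem_support_iff.1 hd (h d (by omega))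
  · by_contra hne
    have := h d (Polynomial.mem_support_iff.2 hne)
    omega

theorem PolyE_mono {m n : ℤ} (h : m ≤ n) : PolyE m ≤ PolyE n :=
  Polynomial.degreeLT_mono (by omega)

theorem PolyE_mul {m n : ℤ} {p q : ℝ[X]} (hp : p ∈ PolyE m) (hq : q ∈ PolyE n) :
    p * q ∈ PolyE (m + n) := by
  by_cases hm : -1 ≤ m
  swap
  · have : p = 0 := by
      rw [PolyE, show (m + 1).toNat = 0 by omega, Polynomial.mem_degreeLT] at hp
      simpa using hp
    simp [this]
  by_cases hn : -1 ≤ n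
  swap
  · have : q = 0 := by
      rw [PolyE, show (n + 1).toNat = 0 by omega, Polynomial.mem_degreeLT] at hq
      simpa using hq
    simp [this]
  rw [mem_PolyE_iff hm] at hp
  rw [mem_PolyE_iff hn] at hq
  by_cases hp0 : p = 0
  · simp [hp0]
  by_cases hq0 : q = 0
  · simp [hq0]
  have h1 := hp _ (Polynomial.natDegree_mem_support_of_nonzero hp0)
  have h2 := hq _ (Polynomial.natDegree_mem_support_of_nonzero hq0)
  rw [mem_PolyE_iff (by omega)]
  intro d hd
  have h3 := Polynomial.le_natDegree_of_mem_supp d hd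
  rw [Polynomial.natDegree_mul hp0 hq0] at h3
  omega

theorem C_mem_PolyE {m : ℤ} (hm : 0 ≤ m) (c : ℝ) : Polynomial.C c ∈ PolyE m := by
  rw [mem_PolyE_iff (by omega)]
  intro d hd
  have := Polynomial.le_natDegree_of_mem_supp d hd
  rw [Polynomial.natDegree_C] at this
  omega

theorem X_mem_PolyE : (Polynomial.X : ℝ[X]) ∈ PolyE 1 := by
  rw [mem_PolyE_iff (by omega)]
  intro d hd
  have := Polynomial.le_natDegree_of_mem_supp d hd
  rw [Polynomial.natDegree_X] at this
  omega

theorem derivative_mem_PolyE {m : ℤ} (hm : 0 ≤ m) {p : ℝ[X]} (hp : p ∈ PolyE m) :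
    derivative p ∈ PolyE (m - 1) := by
  rw [mem_PolyE_iff (by omega)] at *
  intro d hd
  rw [Polynomial.mem_support_iff, Polynomial.coeff_derivative] at hd
  have := hp (d + 1) (Polynomial.mem_support_iff.2 (left_ne_zero_of_mul hd))
  push_cast at this
  omega

instance (m : ℤ) : FiniteDimensional ℝ (PolyE m) := by
  unfold PolyE
  exact LinearEquiv.finiteDimensional (Polynomial.degreeLTEquiv ℝ _).symm

theorem aeval_mem_PolyE {f : σ → ℝ[X]} (hf : ∀ i, f i ∈ PolyE 1) {m : ℤ}
    {p : MvPolynomial σ ℝ} (hp : p ∈ Poly σ m) : MvPolynomial.aeval f p ∈ PolyE m :=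
  aeval_mem_of_mem_Poly PolyE (by simpa using C_mem_PolyE le_rfl 1)
    (fun _ _ h => PolyE_mono h) (fun _ _ _ ha _ hb => PolyE_mul ha hb) hf hp

end Degree

/-! ### Differential operators and the Euler operator -/

section Differential

variable {σ : Type*}

theorem pd_apply (i : σ) (p : MvPolynomial σ ℝ) : pd i p = MvPolynomial.pderiv i p := rfl

theorem pd_mul (i : σ) (p q : MvPolynomial σ ℝ) : pd i (p * q) = pd i p * q + p * pd i q :=
  MvPolynomial.pderiv_mul

theorem pd_comm (i j : σ) (p : MvPolynomial σ ℝ) : pd i (pd j p) = pd j (pd i p) := by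
  ext d
  simp only [pd_apply, MvPolynomial.coeff_pderiv]
  classical
  by_cases h : i = j
  · subst h; rfl
  · simp only [Finsupp.add_apply, Finsupp.single_apply, h, Ne.symm h, if_false]
    rw [add_right_comm]
    push_cast
    ring

@[simp] theorem pd_C (i : σ) (c : ℝ) : pd i (MvPolynomial.C c) = 0 := MvPolynomial.pderiv_C

/-- The position vector relative to the point `a`. -/
def posV (a : σ → ℝ) : σ → MvPolynomial σ ℝ := fun i => MvPolynomial.X i - MvPolynomial.C (a i)

theorem posF_eq : posF = posV 0 := by
  funext i
  simp [posF, posV]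

theorem posV_mem (a : σ → ℝ) (i : σ) : posV a i ∈ Poly σ 1 :=
  Submodule.sub_mem _ (X_mem_Poly i) (C_mem_Poly zero_le_one _)

theorem pd_posV [DecidableEq σ] (a : σ → ℝ) (i j : σ) :
    pd i (posV a j) = if i = j then 1 else 0 := by
  rw [posV, map_sub, pd_C, sub_zero, pd_apply, MvPolynomial.pderiv_X, Pi.single_apply]
  simp [eq_comm]

/-- The chain rule: a derivation applied to a polynomial expression. -/
theorem derivation_aeval [Fintype σ] {A : Type*} [CommRing A] [Algebra ℝ A]
    (D : Derivation ℝ A A) (g : σ → A) (p : MvPolynomial σ ℝ) :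
    D (MvPolynomial.aeval g p) = ∑ j, D (g j) * MvPolynomial.aeval g (pd j p) := by
  classical
  induction p using MvPolynomial.induction_on with
  | C c => simp
  | add p q hp hq => simp only [map_add, hp, hq, mul_add, Finset.sum_add_distrib]
  | mul_X p j hp =>
    have h : ∀ i, MvPolynomial.aeval g (pd i (p * MvPolynomial.X j)) =
        MvPolynomial.aeval g (pd i p) * g j +
          if i = j then MvPolynomial.aeval g p else 0 := fun i => by
      rw [pd_mul, pd_apply i (MvPolynomial.X j), MvPolynomial.pderiv_X, Pi.single_apply, map_add,
        map_mul, map_mul, MvPolynomial.aeval_X]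
      by_cases hij : i = j
      · simp [hij]
      · simp [hij, Ne.symm hij]
    rw [map_mul, MvPolynomial.aeval_X, D.leibniz, hp]
    simp only [h, mul_add, Finset.sum_add_distrib, mul_ite, mul_zero, Finset.sum_ite_eq',
      Finset.mem_univ, if_true, smul_eq_mul]
    rw [Finset.mul_sum, add_comm]
    congr 1
    · exact Finset.sum_congr rfl fun i _ => by ring
    · ring

theorem derivative_aeval_line [Fintype σ] (a v : σ → ℝ) (p : MvPolynomial σ ℝ) :
    derivative (MvPolynomial.aeval (fun i => Polynomial.C (a i) + Polynomial.C (v i) * X) p) =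
      ∑ i, Polynomial.C (v i) *
        MvPolynomial.aeval (fun i => Polynomial.C (a i) + Polynomial.C (v i) * X) (pd i p) := by
  have := derivation_aeval Polynomial.derivative'
    (fun i => Polynomial.C (a i) + Polynomial.C (v i) * X) p
  simpa [Polynomial.derivative'] using this

theorem eval_aeval_line (a v : σ → ℝ) (s : ℝ) (p : MvPolynomial σ ℝ) :
    (MvPolynomial.aeval (fun i => Polynomial.C (a i) + Polynomial.C (v i) * X) p).eval s =
      MvPolynomial.eval (fun i => a i + v i * s) p := by
  induction p using MvPolynomial.induction_on with
  | C c => simp [Polynomial.algebraMap_eq]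
  | add p q hp hq => simp [hp, hq]
  | mul_X p j hp => simp [hp]

theorem grad_apply (p : MvPolynomial σ ℝ) (i : σ) : grad σ p i = pd i p := rfl

theorem smulVec_apply (y : σ → MvPolynomial σ ℝ) (p : MvPolynomial σ ℝ) (i : σ) :
    smulVec y p i = y i * p := rfl

theorem Rc_le (a : σ → ℝ) (m : ℤ) : Rc (posV a) m ≤ VPoly σ σ m := by
  rintro _ ⟨p, hp, rfl⟩
  refine mem_VPoly_iff.2 fun i => ?_
  have := Poly_mul (posV_mem a i) hp
  rwa [add_sub_cancel] at this

theorem Rc_mono (a : σ → ℝ) {m n : ℤ} (h : m ≤ n) : Rc (posV a) m ≤ Rc (posV a) n :=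
  Submodule.map_mono (Poly_mono (by omega))

variable [Fintype σ]

/-- The operator `c + (x - a) · ∇`. -/
def eul (a : σ → ℝ) (c : ℝ) : MvPolynomial σ ℝ →ₗ[ℝ] MvPolynomial σ ℝ :=
  c • LinearMap.id + ∑ i, (LinearMap.mulLeft ℝ (posV a i)).comp (pd i)

theorem eul_apply (a : σ → ℝ) (c : ℝ) (p : MvPolynomial σ ℝ) :
    eul a c p = c • p + ∑ i, posV a i * pd i p := by
  simp [eul]

theorem pd_eul (a : σ → ℝ) (c : ℝ) (i : σ) (p : MvPolynomial σ ℝ) :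
    pd i (eul a c p) = eul a (c + 1) (pd i p) := by
  classical
  simp only [eul_apply, map_add, map_smul, map_sum, pd_mul, pd_posV, ite_mul, one_mul, zero_mul,
    Finset.sum_add_distrib, Finset.sum_ite_eq, Finset.mem_univ, if_true, pd_comm i]
  rw [add_smul, one_smul, add_assoc]

theorem eul_mem (a : σ → ℝ) (c : ℝ) {m : ℤ} {p : MvPolynomial σ ℝ} (hp : p ∈ Poly σ m) :
    eul a c p ∈ Poly σ m := by
  rw [eul_apply]
  refine Submodule.add_mem _ (Submodule.smul_mem _ _ hp) (Submodule.sum_mem _ fun i _ => ?_)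
  have := Poly_mul (posV_mem a i) (pd_mem_Poly i hp)
  rwa [add_sub_cancel] at this

theorem aeval_line_eul (a v : σ → ℝ) (c : ℝ) (p : MvPolynomial σ ℝ) :
    MvPolynomial.aeval (fun i => Polynomial.C (a i) + Polynomial.C (v i) * X) (eul a c p) =
      c • MvPolynomial.aeval (fun i => Polynomial.C (a i) + Polynomial.C (v i) * X) p +
      X * derivative
        (MvPolynomial.aeval (fun i => Polynomial.C (a i) + Polynomial.C (v i) * X) p) := by
  rw [derivative_aeval_line, eul_apply, map_add, map_smul, map_sum, Finset.mul_sum]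
  congr 1
  refine Finset.sum_congr rfl fun i _ => ?_
  rw [map_mul, posV, map_sub, MvPolynomial.aeval_X, MvPolynomial.aeval_C, Polynomial.algebraMap_eq]
  ring

/-- On a ray, `c + (x - a) · ∇` multiplies the coefficient of `s ^ j` by `c + j`. -/
theorem coeff_aeval_line (a v : σ → ℝ) {c : ℝ} {p : MvPolynomial σ ℝ} (h : eul a c p = 0) (j : ℕ) :
    (c + j) * (MvPolynomial.aeval
      (fun i => Polynomial.C (a i) + Polynomial.C (v i) * X) p).coeff j = 0 := by
  have h1 := congrArg (Polynomial.coeff · j) (aeval_line_eul a v c p)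
  simp only [h, map_zero, Polynomial.coeff_zero, Polynomial.coeff_add, Polynomial.coeff_smul,
    smul_eq_mul] at h1
  cases j with
  | zero => simpa using h1.symm
  | succ j =>
    rw [Polynomial.coeff_X_mul, Polynomial.coeff_derivative] at h1
    push_cast
    linarith

theorem eul_injective (a : σ → ℝ) {c : ℝ} (hc : 0 < c) : Function.Injective (eul a c) := by
  rw [injective_iff_map_eq_zero]
  intro p hp
  refine MvPolynomial.funext fun x => ?_
  have h0 : MvPolynomial.aeval
      (fun i => Polynomial.C (a i) + Polynomial.C ((x - a) i) * X) p = 0 := by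
    ext j
    have := coeff_aeval_line a (x - a) hp j
    have hne : c + (j : ℝ) ≠ 0 := by positivity
    simpa [hne] using this
  have := eval_aeval_line a (x - a) 1 p
  rw [h0] at this
  simpa using this.symm

theorem eq_C_of_eul_zero (a : σ → ℝ) {p : MvPolynomial σ ℝ} (hp : eul a 0 p = 0) :
    p = MvPolynomial.C (MvPolynomial.eval a p) := by
  refine MvPolynomial.funext fun x => ?_
  set f := MvPolynomial.aeval (fun i => Polynomial.C (a i) + Polynomial.C ((x - a) i) * X) p
    with hf
  have h0 : f = Polynomial.C (f.coeff 0) := by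
    ext j
    rw [Polynomial.coeff_C]
    split_ifs with hj
    · rw [hj]
    · have := coeff_aeval_line a (x - a) hp j
      have hne : (j : ℝ) ≠ 0 := by exact_mod_cast hj
      exact (mul_eq_zero.1 ((zero_add (j : ℝ)) ▸ this)).resolve_left hne
  have h1 := eval_aeval_line a (x - a) 1 p
  have h2 := eval_aeval_line a (x - a) 0 p
  rw [← hf, h0, Polynomial.eval_C] at h1 h2
  simp only [Pi.sub_apply, mul_one, mul_zero, add_zero, add_sub_cancel] at h1 h2
  rw [MvPolynomial.eval_C]
  exact h1.symm.trans h2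

theorem exists_eul_eq (a : σ → ℝ) {c : ℝ} (hc : 0 < c) {m : ℤ} {p : MvPolynomial σ ℝ}
    (hp : p ∈ Poly σ m) : ∃ q ∈ Poly σ m, eul a c q = p := by
  let f : Poly σ m →ₗ[ℝ] Poly σ m := (eul a c).restrict fun _ h => eul_mem a c h
  have hf : Function.Injective f := fun x y h =>
    Subtype.ext (eul_injective a hc (congrArg Subtype.val h))
  obtain ⟨q, hq⟩ := (LinearMap.injective_iff_surjective.1 hf) ⟨p, hp⟩
  exact ⟨q, q.2, congrArg Subtype.val hq⟩

theorem div_apply (v : σ → MvPolynomial σ ℝ) : div v = ∑ i, pd i (v i) := by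
  simp [div]

theorem div_smulVec (a : σ → ℝ) (p : MvPolynomial σ ℝ) :
    div (smulVec (posV a) p) = eul a (Fintype.card σ) p := by
  classical
  simp only [div_apply, smulVec_apply, pd_mul, pd_posV, if_true, one_mul, Finset.sum_add_distrib,
    Finset.sum_const, Finset.card_univ, eul_apply]
  rw [Nat.cast_smul_eq_nsmul]

theorem div_mem {m : ℤ} {v : σ → MvPolynomial σ ℝ} (hv : ∀ i, v i ∈ Poly σ m) :
    div v ∈ Poly σ (m - 1) := by
  rw [div_apply]
  exact Submodule.sum_mem _ fun i _ => pd_mem_Poly i (hv i)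

/-- The divergence is injective on `ℛ^c`. -/
theorem eq_zero_of_div_eq_zero [Nonempty σ] (a : σ → ℝ) {m : ℤ} {w : σ → MvPolynomial σ ℝ}
    (hw : w ∈ Rc (posV a) m) (h : div w = 0) : w = 0 := by
  obtain ⟨p, hp, rfl⟩ := hw
  rw [div_smulVec] at h
  have hc : (0 : ℝ) < Fintype.card σ := by exact_mod_cast Fintype.card_pos
  rw [eul_injective a hc (h.trans (map_zero _).symm), map_zero]

/-- The divergence maps `ℛ^{c,m}` onto `𝒫^{m-1}`. -/
theorem exists_Rc_div_eq [Nonempty σ] (a : σ → ℝ) {m : ℤ} {p : MvPolynomial σ ℝ}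
    (hp : p ∈ Poly σ (m - 1)) : ∃ w ∈ Rc (posV a) m, div w = p := by
  have hc : (0 : ℝ) < Fintype.card σ := by exact_mod_cast Fintype.card_pos
  obtain ⟨q, hq, h⟩ := exists_eul_eq a hc hp
  exact ⟨_, ⟨q, hq, rfl⟩, by rw [div_smulVec, h]⟩

end Differential

/-! ### Exact sequences of polynomials in two and three variables -/

theorem vrot_zero (r : P2) : vrot r 0 = pd 1 r := rfl

theorem vrot_one (r : P2) : vrot r 1 = -pd 0 r := rfl

theorem curl_zero (r : Fin 3 → P3) : curl r 0 = pd 1 (r 2) - pd 2 (r 1) := rfl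

theorem curl_one (r : Fin 3 → P3) : curl r 1 = pd 2 (r 0) - pd 0 (r 2) := rfl

theorem curl_two (r : Fin 3 → P3) : curl r 2 = pd 0 (r 1) - pd 1 (r 0) := rfl

theorem div_vrot (r : P2) : div (vrot r) = 0 := by
  rw [div_apply, Fin.sum_univ_two, vrot_zero, vrot_one, map_neg, pd_comm 0 1, add_neg_cancel]

theorem div_curl (r : Fin 3 → P3) : div (curl r) = 0 := by
  rw [div_apply, Fin.sum_univ_three, curl_zero, curl_one, curl_two]
  simp only [map_sub]
  rw [pd_comm 1 0, pd_comm 2 0, pd_comm 2 1]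
  ring

theorem curl_grad (q : P3) : curl (grad (Fin 3) q) = 0 := by
  funext i
  fin_cases i
  · exact sub_eq_zero.2 (pd_comm 1 2 q)
  · exact sub_eq_zero.2 (pd_comm 2 0 q)
  · exact sub_eq_zero.2 (pd_comm 0 1 q)

/-- A divergence-free polynomial field in the plane is a rotational: it is that of
`u₀ y₁ - u₁ y₀`, where `u` is the preimage of the field under the Euler operator. -/
theorem exists_vrot_eq {m : ℤ} {v : Fin 2 → P2} (hv : v ∈ VPoly (Fin 2) (Fin 2) m)
    (h : div v = 0) : ∃ r ∈ Poly (Fin 2) (m + 1), vrot r = v := by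
  rw [mem_VPoly_iff] at hv
  choose u hu huv using fun i => exists_eul_eq (0 : Fin 2 → ℝ) one_pos (hv i)
  have hdiv : pd 0 (u 0) + pd 1 (u 1) = 0 := by
    refine eul_injective 0 (c := 1 + 1) (by norm_num) ?_
    rw [map_add, ← pd_eul, ← pd_eul, huv, huv, map_zero, ← h, div_apply, Fin.sum_univ_two]
  refine ⟨posV 0 1 * u 0 - posV 0 0 * u 1, ?_, ?_⟩
  · refine Submodule.sub_mem _ ?_ ?_ <;> rw [add_comm m 1]
    · exact Poly_mul (posV_mem 0 1) (hu 0)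
    · exact Poly_mul (posV_mem 0 0) (hu 1)
  · have h0 := huv 0
    have h1 := huv 1
    rw [eul_apply, Fin.sum_univ_two, one_smul] at h0 h1
    funext i
    fin_cases i
    · change pd 1 _ = v 0
      rw [← h0]
      simp only [map_sub, pd_mul, pd_posV, Fin.isValue, one_ne_zero, ↓reduceIte]
      linear_combination (-(posV 0 0)) * hdiv
    · change -pd 0 _ = v 1
      rw [← h1]
      simp only [map_sub, pd_mul, pd_posV, Fin.isValue, zero_ne_one, ↓reduceIte]
      linear_combination (-(posV 0 1)) * hdiv

/-- A divergence-free polynomial field in space is a curl: it is that of `u × y`, where `u` is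
the preimage of the field under the operator `2 + y · ∇`. -/
theorem exists_curl_eq {m : ℤ} {v : Fin 3 → P3} (hv : v ∈ VPoly (Fin 3) (Fin 3) m)
    (h : div v = 0) : ∃ r ∈ VPoly (Fin 3) (Fin 3) (m + 1), curl r = v := by
  rw [mem_VPoly_iff] at hv
  choose u hu huv using fun i => exists_eul_eq (0 : Fin 3 → ℝ) two_pos (hv i)
  have hdiv : pd 0 (u 0) + pd 1 (u 1) + pd 2 (u 2) = 0 := by
    refine eul_injective 0 (c := 2 + 1) (by norm_num) ?_
    rw [map_add, map_add, ← pd_eul, ← pd_eul, ← pd_eul, huv, huv, huv, map_zero, ← h, div_apply,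
      Fin.sum_univ_three]
  have hm : ∀ i j, u i * posV 0 j ∈ Poly (Fin 3) (m + 1) := fun i j =>
    Poly_mul (hu i) (posV_mem 0 j)
  refine ⟨![u 1 * posV 0 2 - u 2 * posV 0 1, u 2 * posV 0 0 - u 0 * posV 0 2,
    u 0 * posV 0 1 - u 1 * posV 0 0], ?_, ?_⟩
  · refine mem_VPoly_iff.2 fun i => ?_
    fin_cases i <;> exact Submodule.sub_mem _ (hm _ _) (hm _ _)
  · have h0 := huv 0
    have h1 := huv 1
    have h2 := huv 2
    rw [eul_apply, Fin.sum_univ_three, ofNat_smul_eq_nsmul, two_nsmul] at h0 h1 h2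
    funext i
    fin_cases i
    · change pd 1 (u 0 * posV 0 1 - u 1 * posV 0 0) - pd 2 (u 2 * posV 0 0 - u 0 * posV 0 2) = v 0
      rw [← h0]
      simp only [map_sub, pd_mul, pd_posV, Fin.isValue, Fin.reduceEq, ↓reduceIte]
      linear_combination (-(posV 0 0)) * hdiv
    · change pd 2 (u 1 * posV 0 2 - u 2 * posV 0 1) - pd 0 (u 0 * posV 0 1 - u 1 * posV 0 0) = v 1
      rw [← h1]
      simp only [map_sub, pd_mul, pd_posV, Fin.isValue, Fin.reduceEq, ↓reduceIte]
      linear_combination (-(posV 0 1)) * hdiv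
    · change pd 0 (u 2 * posV 0 0 - u 0 * posV 0 2) - pd 1 (u 1 * posV 0 2 - u 2 * posV 0 1) = v 2
      rw [← h2]
      simp only [map_sub, pd_mul, pd_posV, Fin.isValue, Fin.reduceEq, ↓reduceIte]
      linear_combination (-(posV 0 2)) * hdiv

/-- The decomposition `𝒫^m = ℛ^m + ℛ^{c,m}`: subtracting the element of `ℛ^{c,m}` with the same
divergence leaves a rotational. -/
theorem exists_vrot_add_Rc {m : ℤ} {v : Fin 2 → P2} (hv : v ∈ VPoly (Fin 2) (Fin 2) m) :
    ∃ r ∈ Poly (Fin 2) (m + 1), ∃ w ∈ Rc posF m, v = vrot r + w := by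
  rw [posF_eq]
  obtain ⟨w, hw, h⟩ := exists_Rc_div_eq 0 (div_mem (mem_VPoly_iff.1 hv))
  obtain ⟨r, hr, h'⟩ := exists_vrot_eq (v := v - w) (Submodule.sub_mem _ hv (Rc_le 0 m hw))
    (by rw [map_sub, h, sub_self])
  exact ⟨r, hr, w, hw, by rw [h', sub_add_cancel]⟩

theorem vrot_mem {m : ℤ} {r : P2} (hr : r ∈ Poly (Fin 2) (m + 1)) :
    vrot r ∈ VPoly (Fin 2) (Fin 2) m := by
  have h := fun i => pd_mem_Poly i hr
  simp only [add_sub_cancel_right] at h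
  refine mem_VPoly_iff.2 fun i => ?_
  fin_cases i
  · exact h 1
  · exact Submodule.neg_mem _ (h 0)

theorem curl_mem {m : ℤ} {r : Fin 3 → P3} (hr : r ∈ VPoly (Fin 3) (Fin 3) (m + 1)) :
    curl r ∈ VPoly (Fin 3) (Fin 3) m := by
  have h := fun i j => pd_mem_Poly i (mem_VPoly_iff.1 hr j)
  simp only [add_sub_cancel_right] at h
  refine mem_VPoly_iff.2 fun i => ?_
  fin_cases i <;> exact Submodule.sub_mem _ (h _ _) (h _ _)

theorem RolyF_le (m : ℤ) : RolyF m ≤ VPoly (Fin 2) (Fin 2) m := by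
  rintro _ ⟨r, hr, rfl⟩
  exact vrot_mem hr

theorem RolyT_le (m : ℤ) : RolyT m ≤ VPoly (Fin 3) (Fin 3) m := by
  rintro _ ⟨r, hr, rfl⟩
  exact curl_mem hr

theorem Goly_le {σ : Type*} (m : ℤ) : Goly σ m ≤ VPoly σ σ m := by
  rintro _ ⟨q, hq, rfl⟩
  refine mem_VPoly_iff.2 fun i => ?_
  have := pd_mem_Poly i hq
  rwa [add_sub_cancel_right] at this

theorem GcT_le (a : R3) (m : ℤ) : GcT a m ≤ VPoly (Fin 3) (Fin 3) m := by
  rintro _ ⟨q, hq, rfl⟩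
  refine mem_VPoly_iff.2 fun i => ?_
  have h : ∀ j l, posT a j * q l ∈ Poly (Fin 3) m := fun j l => by
    have := Poly_mul (posV_mem a j) (mem_VPoly_iff.1 hq l)
    rwa [add_sub_cancel] at this
  change crossProduct (posT a) q i ∈ _
  rw [cross_apply]
  fin_cases i <;> exact Submodule.sub_mem _ (h _ _) (h _ _)

/-- A polynomial whose gradient vanishes is constant. -/
theorem eq_C_of_pd_eq_zero {σ : Type*} [Fintype σ] {p : MvPolynomial σ ℝ}
    (h : ∀ i, pd i p = 0) : p = MvPolynomial.C (MvPolynomial.eval 0 p) :=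
  eq_C_of_eul_zero 0 (by simp [eul_apply, h])

/-! ### Variational problems -/

section Riesz

variable {X Y Z : Type*} [AddCommGroup X] [Module ℝ X] [AddCommGroup Y] [Module ℝ Y]
  [AddCommGroup Z] [Module ℝ Z]

/-- The Riesz representation theorem on the image of `S` under `d`: the functional `l` factors
through `d` by `hker`, and `B` is definite on the image. -/
theorem existsUnique_variational (B : Y →ₗ[ℝ] Y →ₗ[ℝ] ℝ) (S : Submodule ℝ X)
    [FiniteDimensional ℝ S] (d : X →ₗ[ℝ] Y)
    (hpos : ∀ x ∈ S, B (d x) (d x) = 0 → d x = 0) (l : X →ₗ[ℝ] ℝ)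
    (hker : ∀ x ∈ S, d x = 0 → l x = 0) :
    ∃! y, y ∈ S.map d ∧ ∀ x ∈ S, B y (d x) = l x := by
  let Φ : S →ₗ[ℝ] S.map d := (d.comp S.subtype).codRestrict _ fun x => ⟨x, x.2, rfl⟩
  have hΦ : Function.Surjective Φ := by
    rintro ⟨_, x, hx, rfl⟩
    exact ⟨⟨x, hx⟩, rfl⟩
  obtain ⟨g, hg⟩ := Φ.exists_rightInverse_of_surjective (LinearMap.range_eq_top.2 hΦ)
  have hl : ∀ x (hx : x ∈ S), l (g ⟨d x, x, hx, rfl⟩) = l x := by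
    intro x hx
    rw [← sub_eq_zero, ← map_sub]
    refine hker _ (S.sub_mem (g _).2 hx) ?_
    have := congrArg Subtype.val (LinearMap.congr_fun hg ⟨d x, x, hx, rfl⟩)
    rw [map_sub, sub_eq_zero]
    exact this
  let b : S.map d →ₗ[ℝ] Module.Dual ℝ (S.map d) :=
    (B.compr₂ LinearMap.id).domRestrict₁₂ (S.map d) (S.map d)
  have hb : Function.Injective b := by
    rw [injective_iff_map_eq_zero]
    rintro ⟨_, x, hx, rfl⟩ h
    exact Subtype.ext (hpos x hx (LinearMap.congr_fun h ⟨d x, x, hx, rfl⟩))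
  have hb' : Function.Surjective b :=
    (LinearMap.injective_iff_surjective_of_finrank_eq_finrank
      (Subspace.dual_finrank_eq (K := ℝ) (V := S.map d)).symm).1 hb
  obtain ⟨y, hy⟩ := hb' ((l.comp S.subtype).comp g)
  have hy' : ∀ x ∈ S, B y (d x) = l x := fun x hx =>
    (LinearMap.congr_fun hy ⟨d x, x, hx, rfl⟩).trans (hl x hx)
  refine ⟨y, ⟨y.2, hy'⟩, ?_⟩
  rintro z ⟨hz, hzx⟩
  refine congrArg Subtype.val (hb (a₁ := ⟨z, hz⟩) (a₂ := y) (LinearMap.ext ?_))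
  rintro ⟨_, x, hx, rfl⟩
  exact (hzx x hx).trans (hy' x hx).symm

/-- The solution of a variational problem depends linearly on the data: there is a linear operator
that maps the data to the only solution. -/
theorem exists_solution_operator (B : Y →ₗ[ℝ] Y →ₗ[ℝ] ℝ) (S : Submodule ℝ X)
    [FiniteDimensional ℝ S] (d : X →ₗ[ℝ] Y)
    (hpos : ∀ x ∈ S, B (d x) (d x) = 0 → d x = 0) (l : Z →ₗ[ℝ] X →ₗ[ℝ] ℝ)
    (hker : ∀ z, ∀ x ∈ S, d x = 0 → l z x = 0) :
    ∃ R : Z →ₗ[ℝ] Y, ∀ z y, (y ∈ S.map d ∧ ∀ x ∈ S, B y (d x) = l z x) ↔ y = R z := by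
  have h := fun z => existsUnique_variational B S d hpos (l z) (hker z)
  choose R hR hR' using h
  refine ⟨{ toFun := R, map_add' := fun z w => ?_, map_smul' := fun c z => ?_ },
    fun z y => ⟨hR' z y, fun h => ?_⟩⟩
  · refine (hR' _ _ ⟨Submodule.add_mem _ (hR z).1 (hR w).1, fun x hx => ?_⟩).symm
    rw [map_add, map_add, LinearMap.add_apply, LinearMap.add_apply, (hR z).2 x hx, (hR w).2 x hx]
  · refine (hR' _ _ ⟨Submodule.smul_mem _ _ (hR z).1, fun x hx => ?_⟩).symm
    rw [map_smul, map_smul, LinearMap.smul_apply, LinearMap.smul_apply, (hR z).2 x hx]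
    rfl
  · rw [h]
    exact hR z

end Riesz

theorem theUnique_eq {α : Type*} [Zero α] {p : α → Prop} {a : α} (h : ∀ x, p x ↔ x = a) :
    theUnique p = a := by
  have hex : ∃! x, p x := ⟨a, (h a).2 rfl, fun y hy => (h y).1 hy⟩
  rw [theUnique, dif_pos hex]
  exact (h _).1 hex.choose_spec.1

theorem existsUnique_of_iff {α : Type*} {p : α → Prop} {a : α} (h : ∀ x, p x ↔ x = a) :
    ∃! x, p x := ⟨a, (h a).2 rfl, fun y hy => (h y).1 hy⟩

/-! ### Integrals of polynomials -/

section Integral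

variable {σ : Type*}

/-- Polynomials approximate continuous functions uniformly on compact sets. -/
theorem exists_poly_near {K : Set (σ → ℝ)} (hK : IsCompact K) {f : (σ → ℝ) → ℝ}
    (hf : Continuous f) {ε : ℝ} (hε : 0 < ε) :
    ∃ p : MvPolynomial σ ℝ, ∀ x ∈ K, |MvPolynomial.eval x p - f x| < ε := by
  have := isCompact_iff_compactSpace.1 hK
  let coord : σ → C(K, ℝ) := fun i =>
    ⟨fun x => x.1 i, (continuous_apply i).comp continuous_subtype_val⟩
  let A : Subalgebra ℝ C(K, ℝ) := (MvPolynomial.aeval coord).range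
  have hA : A.SeparatesPoints := by
    intro x y hxy
    obtain ⟨i, hi⟩ := Function.ne_iff.1 (fun h => hxy (Subtype.ext h))
    exact ⟨_, ⟨coord i, ⟨MvPolynomial.X i, MvPolynomial.aeval_X _ _⟩, rfl⟩, hi⟩
  obtain ⟨⟨_, p, rfl⟩, hp⟩ := ContinuousMap.exists_mem_subalgebra_near_continuous_of_separatesPoints
    A hA (fun x : K => f x) (by fun_prop) ε hε
  refine ⟨p, fun x hx => ?_⟩
  have heval : ∀ q : MvPolynomial σ ℝ,
      (MvPolynomial.aeval coord q) ⟨x, hx⟩ = MvPolynomial.eval x q := by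
    intro q
    induction q using MvPolynomial.induction_on with
    | C c => simp
    | add p q hp hq => simp only [map_add, ContinuousMap.add_apply, hp, hq]
    | mul_X p i hp =>
      simp only [map_mul, ContinuousMap.mul_apply, hp, MvPolynomial.aeval_X, MvPolynomial.eval_X]
      rfl
  have h2 := hp ⟨x, hx⟩
  simp only [Real.norm_eq_abs] at h2
  rw [← heval p]
  exact h2

variable [Fintype σ]

theorem integrableOn_eval {U : Set (σ → ℝ)} (hb : Bornology.IsBounded U) (p : MvPolynomial σ ℝ) :
    IntegrableOn (fun x => MvPolynomial.eval x p) U :=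
  (((MvPolynomial.continuous_eval p).continuousOn).integrableOn_compact
    hb.isCompact_closure).mono_set subset_closure

theorem eq_zero_of_eqOn_zero {U : Set (σ → ℝ)} (ho : IsOpen U) (hn : U.Nonempty)
    {p : MvPolynomial σ ℝ} (h : ∀ x ∈ U, MvPolynomial.eval x p = 0) : p = 0 := by
  obtain ⟨x, hx⟩ := hn
  obtain ⟨ε, hε, hball⟩ := Metric.isOpen_iff.1 ho x hx
  refine MvPolynomial.funext_set (fun i => Metric.ball (x i) ε) (fun i => ?_) fun y hy => ?_
  · rw [Real.ball_eq_Ioo]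
    exact Set.Ioo_infinite (by linarith)
  · rw [map_zero]
    refine h y (hball ?_)
    rw [ball_pi _ hε]
    exact hy

theorem eq_zero_of_integral_sq_eq_zero {U : Set (σ → ℝ)} (ho : IsOpen U) (hn : U.Nonempty)
    (hb : Bornology.IsBounded U) {κ : Type*} [Fintype κ] {v : κ → MvPolynomial σ ℝ}
    (h : ∫ x in U, MvPolynomial.eval x (∑ i, v i * v i) = 0) : v = 0 := by
  have hnn : ∀ x, 0 ≤ MvPolynomial.eval x (∑ i, v i * v i) := fun x => by
    rw [map_sum]
    exact Finset.sum_nonneg fun i _ => by rw [map_mul]; exact mul_self_nonneg _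
  rw [setIntegral_eq_zero_iff_of_nonneg_ae (ae_of_all _ hnn) (integrableOn_eval hb _)] at h
  have h2 := Measure.eqOn_open_of_ae_eq h ho (MvPolynomial.continuous_eval _).continuousOn
    continuousOn_const
  funext i
  refine eq_zero_of_eqOn_zero ho hn fun x hx => ?_
  have h3 := h2 hx
  simp only [map_sum, map_mul, Pi.zero_apply] at h3
  have := (Finset.sum_eq_zero_iff_of_nonneg fun i _ => mul_self_nonneg _).1 h3 i (Finset.mem_univ i)
  exact mul_self_eq_zero.1 this

/-- Compactly supported finite measures that charge an open set which all the others neglect are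
linearly independent as functionals on the polynomials. -/
theorem coeff_eq_zero_of_forall_poly {J : Type*} [Fintype J] (μ : J → Measure (σ → ℝ))
    [∀ j, IsFiniteMeasure (μ j)] {K : Set (σ → ℝ)} (hK : IsCompact K) (hμ : ∀ j, μ j Kᶜ = 0)
    (a : J → ℝ) (h : ∀ p : MvPolynomial σ ℝ, ∑ j, a j * ∫ x, MvPolynomial.eval x p ∂μ j = 0)
    (l : J) {U : Set (σ → ℝ)} (hU : IsOpen U) (hl : μ l U ≠ 0) (h0 : ∀ j, j ≠ l → μ j U = 0) :
    a l = 0 := by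
  obtain ⟨f, hfU, hfs, hfr⟩ := hU.exists_contDiff_support_eq (n := 0)
  have hfc : Continuous f := hfs.continuous
  have hf0 : ∀ x, 0 ≤ f x := fun x => (hfr ⟨x, rfl⟩).1
  have hint : ∀ (j : J) (g : (σ → ℝ) → ℝ), Continuous g → Integrable g (μ j) := by
    intro j g hg
    have h1 : IntegrableOn g K (μ j) := hg.continuousOn.integrableOn_compact hK
    have h2 : (μ j).restrict K = μ j :=
      Measure.restrict_eq_self_of_ae_mem (ae_iff.2 (hμ j))
    rwa [IntegrableOn, h2] at h1
  have hsum : ∑ j, a j * ∫ x, f x ∂μ j = a l * ∫ x, f x ∂μ l := by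
    refine Finset.sum_eq_single l (fun j _ hj => ?_) (fun h => absurd (Finset.mem_univ l) h)
    rw [integral_eq_zero_of_ae, mul_zero]
    have : ∀ᵐ x ∂μ j, x ∉ U := measure_eq_zero_iff_ae_notMem.1 (h0 j hj)
    filter_upwards [this] with x hx
    rw [← hfU] at hx
    simpa using hx
  have hpos : 0 < ∫ x, f x ∂μ l := by
    rw [integral_pos_iff_support_of_nonneg hf0 (hint l f hfc), hfU]
    exact pos_iff_ne_zero.2 hl
  -- The functional is smaller than any multiple of `ε`, since it vanishes on the polynomials.
  set M : ℝ := ∑ j, |a j| * (μ j).real Set.univ with hM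
  have hbound : ∀ ε > 0, |a l * ∫ x, f x ∂μ l| ≤ ε * M := by
    intro ε hε
    obtain ⟨p, hp⟩ := exists_poly_near hK hfc hε
    rw [← hsum, ← sub_zero (∑ j, a j * ∫ x, f x ∂μ j), ← h p, ← Finset.sum_sub_distrib, hM,
      Finset.mul_sum]
    refine (Finset.abs_sum_le_sum_abs _ _).trans (Finset.sum_le_sum fun j _ => ?_)
    rw [← mul_sub, abs_mul, ← integral_sub (hint j f hfc)
      (hint j _ (MvPolynomial.continuous_eval p)), mul_left_comm]
    refine mul_le_mul_of_nonneg_left ?_ (abs_nonneg _)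
    rw [← Real.norm_eq_abs]
    refine norm_integral_le_of_norm_le_const (μ := μ j) ?_
    filter_upwards [ae_iff.2 (hμ j)] with x hx
    rw [Real.norm_eq_abs, abs_sub_comm]
    exact (hp x hx).le
  have hM0 : 0 ≤ M := Finset.sum_nonneg fun j _ => by positivity
  have hz : a l * ∫ x, f x ∂μ l = 0 := by
    by_contra hne
    have h1 := hbound (|a l * ∫ x, f x ∂μ l| / (2 * (M + 1))) (by positivity)
    have h2 : 0 < |a l * ∫ x, f x ∂μ l| := abs_pos.2 hne
    have h3 : |a l * ∫ x, f x ∂μ l| / (2 * (M + 1)) * M < |a l * ∫ x, f x ∂μ l| := by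
      rw [div_mul_eq_mul_div, div_lt_iff₀ (by positivity)]
      nlinarith
    linarith
  exact (mul_eq_zero.1 hz).resolve_right hpos.ne'

end Integral

/-! ### The divergence theorem on convex polytopes -/

section Divergence

variable {n : ℕ}

/-- The projection of `ℝ^{n+1}` along the `i`-th axis. -/
def dropCoord (i : Fin (n + 1)) : (Fin (n + 1) → ℝ) →ₗ[ℝ] (Fin n → ℝ) :=
  LinearMap.funLeft ℝ ℝ i.succAbove

theorem dropCoord_apply (i : Fin (n + 1)) (x : Fin (n + 1) → ℝ) :
    dropCoord i x = i.removeNth x := rfl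

theorem dropCoord_insertNth (i : Fin (n + 1)) (t : ℝ) (x' : Fin n → ℝ) :
    dropCoord i (i.insertNth (α := fun _ => ℝ) t x') = x' := by
  rw [dropCoord_apply]
  exact Fin.removeNth_insertNth (α := fun _ => ℝ) i t x'

theorem insertNth_dropCoord (i : Fin (n + 1)) (x : Fin (n + 1) → ℝ) :
    i.insertNth (α := fun _ => ℝ) (x i) (dropCoord i x) = x := by
  rw [dropCoord_apply]
  exact Fin.insertNth_self_removeNth i x

theorem continuous_dropCoord (i : Fin (n + 1)) : Continuous (dropCoord i) :=
  LinearMap.continuous_of_finiteDimensional _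

theorem continuous_insertNth_left (i : Fin (n + 1)) (x' : Fin n → ℝ) :
    Continuous fun t : ℝ => i.insertNth (α := fun _ => ℝ) t x' := by
  refine continuous_pi fun j => ?_
  refine Fin.succAboveCases i ?_ (fun j => ?_) j
  · simpa using continuous_id'
  · simpa using continuous_const

theorem insertNth_combo (i : Fin (n + 1)) (x' : Fin n → ℝ) (a b s t : ℝ) (hab : a + b = 1) :
    a • i.insertNth (α := fun _ => ℝ) s x' + b • i.insertNth (α := fun _ => ℝ) t x' =
      i.insertNth (α := fun _ => ℝ) (a * s + b * t) x' := by
  funext j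
  refine Fin.succAboveCases i ?_ (fun j => ?_) j
  · simp
  · simp [← add_mul, hab]

theorem integral_pd_line (i : Fin (n + 1)) (x' : Fin n → ℝ) (a b : ℝ)
    (p : MvPolynomial (Fin (n + 1)) ℝ) :
    ∫ t in a..b, MvPolynomial.eval (i.insertNth (α := fun _ => ℝ) t x') (pd i p) =
      MvPolynomial.eval (i.insertNth (α := fun _ => ℝ) b x') p -
      MvPolynomial.eval (i.insertNth (α := fun _ => ℝ) a x') p := by
  have hpt : ∀ t : ℝ, i.insertNth (α := fun _ => ℝ) t x' =
      fun j => i.insertNth (α := fun _ => ℝ) 0 x' j + (Pi.single i 1 : Fin (n + 1) → ℝ) j * t := by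
    intro t
    funext j
    refine Fin.succAboveCases i ?_ (fun j => ?_) j
    · simp
    · simp
  have hder := derivative_aeval_line (i.insertNth (α := fun _ => ℝ) 0 x') (Pi.single i 1) p
  rw [Finset.sum_eq_single i (fun j _ hj => by simp [hj]) (by simp), Pi.single_eq_same,
    Polynomial.C_1, one_mul] at hder
  set f := MvPolynomial.aeval (fun j => Polynomial.C (i.insertNth (α := fun _ => ℝ) 0 x' j) +
    Polynomial.C ((Pi.single i 1 : Fin (n + 1) → ℝ) j) * X) p with hf
  have h1 : ∀ t q, MvPolynomial.eval (i.insertNth (α := fun _ => ℝ) t x') q =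
      (MvPolynomial.aeval (fun j => Polynomial.C (i.insertNth (α := fun _ => ℝ) 0 x' j) +
        Polynomial.C ((Pi.single i 1 : Fin (n + 1) → ℝ) j) * X) q).eval t := by
    intro t q
    rw [eval_aeval_line, hpt]
  simp only [h1, ← hder, ← hf]
  refine intervalIntegral.integral_eq_sub_of_hasDerivAt (fun t _ => f.hasDerivAt t) ?_
  exact (Polynomial.continuous _).intervalIntegrable _ _

/-- The flux of a polynomial in direction `i` through a flat face is the integral over the
projection of the face along the `i`-th axis. -/
theorem exists_projected_flux (i : Fin (n + 1)) {U : Set (Fin n → ℝ)} (hU : IsOpen U)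
    (hUb : Bornology.IsBounded U) (o : Fin (n + 1) → ℝ)
    (A : (Fin n → ℝ) →ₗ[ℝ] (Fin (n + 1) → ℝ)) (N : ℝ)
    (hdet : |LinearMap.det ((dropCoord i).comp A)| = |N|) (p : MvPolynomial (Fin (n + 1)) ℝ) :
    ∃ f : (Fin n → ℝ) → ℝ, Integrable f ∧
      ∫ x', f x' = N * ∫ y in U, MvPolynomial.eval (o + A y) p ∧
      (∀ x', (∀ y ∈ U, dropCoord i (o + A y) ≠ x') → f x' = 0) ∧
      (∀ y ∈ U, 0 < N → f (dropCoord i (o + A y)) = MvPolynomial.eval (o + A y) p) ∧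
      (∀ y ∈ U, N < 0 → f (dropCoord i (o + A y)) = -MvPolynomial.eval (o + A y) p) := by
  rcases eq_or_ne N 0 with rfl | hN
  · exact ⟨0, integrable_zero _ _ _, by simp, fun _ _ => rfl, fun _ _ h => absurd h (lt_irrefl _),
      fun _ _ h => absurd h (lt_irrefl _)⟩
  have hd : LinearMap.det ((dropCoord i).comp A) ≠ 0 := by
    rw [← abs_pos, hdet]
    exact abs_pos.2 hN
  set e := LinearMap.equivOfDetNeZero ((dropCoord i).comp A) hd with he
  have hee : ∀ y, e y = dropCoord i (A y) := fun y => rfl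
  set c := dropCoord i o with hc
  set g : (Fin n → ℝ) → (Fin n → ℝ) := fun y => c + e y with hg
  have hgi : Function.Injective g := fun y z h => e.injective (add_left_cancel h)
  have hgA : ∀ y, g y = dropCoord i (o + A y) := fun y => by rw [hg, map_add, ← hee]
  have hgc : Continuous g :=
    continuous_const.add (e : (Fin n → ℝ) →ₗ[ℝ] (Fin n → ℝ)).continuous_of_finiteDimensional
  set r : (Fin n → ℝ) → (Fin n → ℝ) := fun x' => e.symm (x' - c) with hr
  have hrc : Continuous r :=
    (e.symm : (Fin n → ℝ) →ₗ[ℝ] (Fin n → ℝ)).continuous_of_finiteDimensional.comp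
      (continuous_id.sub continuous_const)
  have hrg : ∀ y, r (g y) = y := fun y => by simp [hr, hg]
  have hgr : ∀ x, g (r x) = x := fun y => by simp [hr, hg]
  have himage : g '' U = r ⁻¹' U := by
    ext x
    exact ⟨fun ⟨y, hy, h⟩ => by rw [← h, Set.mem_preimage, hrg]; exact hy,
      fun h => ⟨r x, h, hgr x⟩⟩
  have hAc : Continuous A := LinearMap.continuous_of_finiteDimensional A
  have hmeas : MeasurableSet (g '' U) := by
    rw [himage]
    exact (hU.preimage hrc).measurableSet
  set G : (Fin n → ℝ) → ℝ := fun x' => MvPolynomial.eval (o + A (r x')) p with hG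
  have hGc : Continuous G :=
    (MvPolynomial.continuous_eval p).comp (continuous_const.add (hAc.comp hrc))
  have hGint : IntegrableOn G (g '' U) :=
    (hGc.continuousOn.integrableOn_compact (hUb.isCompact_closure.image hgc)).mono_set
      (Set.image_mono subset_closure)
  set s : ℝ := ((SignType.sign N : SignType) : ℝ) with hs
  have hs' : s * |N| = N := sign_mul_abs N
  refine ⟨(g '' U).indicator fun x' => s * G x', ?_, ?_, ?_, ?_, ?_⟩
  · exact (integrable_indicator_iff hmeas).2 (hGint.const_mul s)
  · rw [integral_indicator hmeas, integral_const_mul,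
      integral_image_eq_integral_abs_det_fderiv_smul volume hU.measurableSet
        (f' := fun _ => LinearMap.toContinuousLinearMap (e : (Fin n → ℝ) →ₗ[ℝ] _)) (fun x _ => ?_)
        hgi.injOn]
    · have hdet' : |(LinearMap.toContinuousLinearMap (e : (Fin n → ℝ) →ₗ[ℝ] _)).det| = |N| := by
        rw [← hdet]
        rfl
      simp only [hdet', smul_eq_mul, hG, hrg]
      rw [integral_const_mul, ← mul_assoc, hs']
    · exact ((LinearMap.toContinuousLinearMap
        (e : (Fin n → ℝ) →ₗ[ℝ] _)).hasFDerivAt.const_add c).hasFDerivWithinAt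
  · intro x' hx'
    refine Set.indicator_of_notMem ?_ _
    rintro ⟨y, hy, h⟩
    exact hx' y hy ((hgA y).symm.trans h)
  · intro y hy hpos
    rw [← hgA, Set.indicator_of_mem (Set.mem_image_of_mem g hy)]
    simp only [hG]
    rw [hrg, hs, sign_pos hpos]
    simp
  · intro y hy hneg
    rw [← hgA, Set.indicator_of_mem (Set.mem_image_of_mem g hy)]
    simp only [hG]
    rw [hrg, hs, sign_neg hneg]
    simp

/-- Almost no line in direction `i` meets the relative boundary of a flat convex face, nor a face
that is parallel to the `i`-th axis. -/
theorem ae_not_mem_projected_frontier (i : Fin (n + 1)) {U : Set (Fin n → ℝ)} (hU : IsOpen U)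
    (hUc : Convex ℝ U) (o : Fin (n + 1) → ℝ) (A : (Fin n → ℝ) →ₗ[ℝ] (Fin (n + 1) → ℝ)) :
    ∀ᵐ x' : Fin n → ℝ, ∀ y ∈ closure U, dropCoord i (o + A y) = x' →
      y ∈ U ∧ LinearMap.det ((dropCoord i).comp A) ≠ 0 := by
  set L := (dropCoord i).comp A with hL
  set W : Set (Fin n → ℝ) := if LinearMap.det L = 0 then Set.univ else frontier U with hW
  have h0 : volume (L '' W) = 0 := by
    rw [Measure.addHaar_image_linearMap volume, hW]
    split_ifs with h
    · simp [h]
    · rw [hUc.addHaar_frontier volume, mul_zero]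
  have h1 : ∀ᵐ z, z ∉ L '' W := measure_eq_zero_iff_ae_notMem.1 h0
  have h2 := (measurePreserving_sub_right volume (dropCoord i o)).quasiMeasurePreserving.ae h1
  filter_upwards [h2] with x' hx' y hy h
  have hLy : L y = x' - dropCoord i o := by
    rw [← h, map_add, add_sub_cancel_left]
    rfl
  have hyW : y ∉ W := fun hyW => hx' ⟨y, hyW, hLy⟩
  rw [hW] at hyW
  split_ifs at hyW with hd
  · exact absurd (Set.mem_univ y) hyW
  · refine ⟨?_, hd⟩
    rw [frontier, hU.interior_eq] at hyW
    by_contra hyU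
    exact hyW ⟨hy, hyU⟩

theorem eq_Ioo_of_isOpen_of_ordConnected {I : Set ℝ} (ho : IsOpen I) (hc : I.OrdConnected)
    (hn : I.Nonempty) (hb : Bornology.IsBounded I) : ∃ a b, a < b ∧ I = Set.Ioo a b := by
  have hsub : I ⊆ Set.Ioo (sInf I) (sSup I) := by
    rw [← interior_Icc]
    exact ho.subset_interior_iff.2 (subset_Icc_csInf_csSup hb.bddBelow hb.bddAbove)
  have heq : I = Set.Ioo (sInf I) (sSup I) :=
    hsub.antisymm ((IsConnected.Ioo_csInf_csSup_subset ⟨hn, hc.isPreconnected⟩) hb.bddBelow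
      hb.bddAbove)
  obtain ⟨x, hx⟩ := hn
  exact ⟨_, _, (hsub hx).1.trans (hsub hx).2, heq⟩

/-- The divergence theorem in direction `i` on an open bounded convex set `D` whose boundary is
covered by the closures of finitely many disjoint flat convex faces; `N s` is the outer normal of
the face `s`. By Fubini's theorem the integral over `D` is the integral over the lines in
direction `i` of the difference of the values at the two end points, and almost every line leaves
`D` through exactly one face and enters it through exactly one face. -/
theorem integral_pd_eq_sum_flux {S : Type*} [Fintype S] (i : Fin (n + 1))
    {D : Set (Fin (n + 1) → ℝ)} (hDo : IsOpen D) (hDc : Convex ℝ D)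
    (hDb : Bornology.IsBounded D) (U : S → Set (Fin n → ℝ)) (hUo : ∀ s, IsOpen (U s))
    (hUc : ∀ s, Convex ℝ (U s)) (hUb : ∀ s, Bornology.IsBounded (U s))
    (o : S → Fin (n + 1) → ℝ) (A : S → (Fin n → ℝ) →ₗ[ℝ] (Fin (n + 1) → ℝ))
    (N : S → Fin (n + 1) → ℝ)
    (hfr : frontier D = ⋃ s, (fun y => o s + A s y) '' closure (U s))
    (hdisj : ∀ s t, s ≠ t → ∀ y ∈ U s, ∀ z ∈ U t, o s + A s y ≠ o t + A t z)
    (hN : ∀ s y, N s ⬝ᵥ A s y = 0)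
    (hdet : ∀ s, |LinearMap.det ((dropCoord i).comp (A s))| = |N s i|)
    (hout : ∀ s, ∀ x ∈ D, N s ⬝ᵥ (x - o s) < 0) (p : MvPolynomial (Fin (n + 1)) ℝ) :
    ∫ x in D, MvPolynomial.eval x (pd i p) =
      ∑ s, N s i * ∫ y in U s, MvPolynomial.eval (o s + A s y) p := by
  choose f hfint hfeq hf0 hfpos hfneg using fun s =>
    exists_projected_flux i (hUo s) (hUb s) (o s) (A s) (N s i) (hdet s) p
  simp only [← hfeq]
  rw [← integral_finsetSum _ fun s _ => hfint s, ← integral_indicator hDo.measurableSet]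
  set g : (Fin (n + 1) → ℝ) → ℝ := D.indicator fun x => MvPolynomial.eval x (pd i p) with hg
  have hgint : Integrable g :=
    (integrable_indicator_iff hDo.measurableSet).2 (integrableOn_eval hDb _)
  have hmp := (volume_preserving_piFinSuccAbove (fun _ : Fin (n + 1) => ℝ) i).symm
  rw [← hmp.integral_comp', Measure.volume_eq_prod,
    integral_prod_symm (fun x => g ((MeasurableEquiv.piFinSuccAbove (fun _ => ℝ) i).symm x))
      (hmp.integrable_comp_emb (MeasurableEquiv.measurableEmbedding _) |>.2
      hgint)]
  have hDint : interior D = D := hDo.interior_eq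
  have hdropc := continuous_dropCoord i
  have hP : Convex ℝ (dropCoord i '' D) := hDc.linear_image _
  have hPfr : ∀ᵐ x' : Fin n → ℝ, x' ∉ frontier (dropCoord i '' D) :=
    measure_eq_zero_iff_ae_notMem.1 (hP.addHaar_frontier volume)
  refine integral_congr_ae ?_
  filter_upwards [hPfr, ae_all_iff.2 fun s =>
    ae_not_mem_projected_frontier i (hUo s) (hUc s) (o s) (A s)] with x' hx' hgood
  change ∫ t, g (i.insertNth (α := fun _ => ℝ) t x') = ∑ s, f s x'
  have hface : ∀ s, ∀ y ∈ U s, o s + A s y ∈ frontier D := fun s y hy => by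
    rw [hfr]
    exact Set.mem_iUnion.2 ⟨s, y, subset_closure hy, rfl⟩
  by_cases hxP : x' ∈ dropCoord i '' D
  swap
  · -- The line misses `D`, and also its closure.
    have hxc : x' ∉ closure (dropCoord i '' D) := fun h =>
      hx' ⟨h, fun h' => hxP (interior_subset h')⟩
    rw [Finset.sum_eq_zero fun s _ => hf0 s x' fun y hy h => hxc ?_, integral_eq_zero_of_ae]
    · refine ae_of_all _ fun t => ?_
      rw [hg]
      refine Set.indicator_of_notMem (fun h => hxP ⟨_, h, dropCoord_insertNth i t x'⟩) _
    · rw [← h]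
      exact image_closure_subset_closure_image hdropc
        ⟨_, frontier_subset_closure (hface s y hy), rfl⟩
  -- The line meets `D` in an open interval.
  have hins := continuous_insertNth_left i x'
  set I : Set ℝ := (fun t : ℝ => i.insertNth (α := fun _ => ℝ) t x') ⁻¹' D with hI
  have hIc : I.OrdConnected := by
    have : Convex ℝ I := by
      intro s hs t ht a b ha hb hab
      have := hDc hs ht ha hb hab
      rwa [insertNth_combo i x' a b s t hab] at this
    exact this.ordConnected
  have hIn : I.Nonempty := by
    obtain ⟨x, hx, rfl⟩ := hxP
    refine ⟨x i, ?_⟩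
    rw [hI, Set.mem_preimage, insertNth_dropCoord]
    exact hx
  have hIb : Bornology.IsBounded I := by
    obtain ⟨R, hR⟩ := hDb.subset_closedBall 0
    refine (Metric.isBounded_closedBall (x := (0 : ℝ)) (r := R)).subset fun t ht => ?_
    have h1 := hR ht
    rw [mem_closedBall_zero_iff] at h1 ⊢
    have h2 := norm_le_pi_norm (i.insertNth (α := fun _ => ℝ) t x') i
    rw [Fin.insertNth_apply_same] at h2
    exact h2.trans h1
  obtain ⟨a, b, hab, hIab⟩ := eq_Ioo_of_isOpen_of_ordConnected (hDo.preimage hins) hIc hIn hIb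
  have hmem : ∀ t, i.insertNth (α := fun _ => ℝ) t x' ∈ D ↔ t ∈ Set.Ioo a b := fun t => by
    rw [← hIab]
    rfl
  have hLHS : ∫ t, g (i.insertNth (α := fun _ => ℝ) t x') =
      MvPolynomial.eval (i.insertNth (α := fun _ => ℝ) b x') p -
      MvPolynomial.eval (i.insertNth (α := fun _ => ℝ) a x') p := by
    rw [← integral_pd_line, intervalIntegral.integral_of_le hab.le,
      ← integral_Ioc_eq_integral_Ioo.symm, ← integral_indicator measurableSet_Ioo]
    refine integral_congr_ae (ae_of_all _ fun t => ?_)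
    by_cases ht : t ∈ Set.Ioo a b
    · simp only [hg]
      rw [Set.indicator_of_mem ((hmem t).2 ht), Set.indicator_of_mem ht]
    · simp only [hg]
      rw [Set.indicator_of_notMem (fun h => ht ((hmem t).1 h)), Set.indicator_of_notMem ht]
  have hclos : ∀ t ∈ Set.Icc a b, i.insertNth (α := fun _ => ℝ) t x' ∈ closure D := by
    intro t ht
    rw [← closure_Ioo hab.ne] at ht
    have h1 : Set.MapsTo (fun t : ℝ => i.insertNth (α := fun _ => ℝ) t x') (Set.Ioo a b) D :=
      fun t ht => (hmem t).2 ht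
    exact h1.closure hins ht
  have hend : ∀ t ∈ Set.Icc a b, t ∉ Set.Ioo a b → ∃ s, ∃ y ∈ U s,
      o s + A s y = i.insertNth (α := fun _ => ℝ) t x' := by
    intro t ht ht'
    have h1 : i.insertNth (α := fun _ => ℝ) t x' ∈ frontier D :=
      ⟨hclos t ht, by rw [hDint, hmem]; exact ht'⟩
    rw [hfr] at h1
    obtain ⟨s, y, hy, h⟩ := Set.mem_iUnion.1 h1
    exact ⟨s, y,
      (hgood s y hy ((congrArg (dropCoord i) h).trans (dropCoord_insertNth i t x'))).1, h⟩
  obtain ⟨sa, ya, hya, hsa⟩ := hend a ⟨le_rfl, hab.le⟩ fun h => lt_irrefl _ h.1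
  obtain ⟨sb, yb, hyb, hsb⟩ := hend b ⟨hab.le, le_rfl⟩ fun h => lt_irrefl _ h.2
  set m := (a + b) / 2 with hm
  have hmI : m ∈ Set.Ioo a b := ⟨by linarith, by linarith⟩
  have hsign : ∀ s, ∀ y ∈ U s, ∀ t, o s + A s y = i.insertNth (α := fun _ => ℝ) t x' →
      N s i * (m - t) < 0 := by
    intro s y hy t h
    have h1 := hout s _ ((hmem m).2 hmI)
    have h2 : i.insertNth (α := fun _ => ℝ) m x' - o s = A s y + Pi.single i (m - t) := by
      rw [← sub_eq_zero]
      have h3 : o s = i.insertNth (α := fun _ => ℝ) t x' - A s y := by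
        rw [← h, add_sub_cancel_right]
      rw [h3]
      funext j
      refine Fin.succAboveCases i ?_ (fun j => ?_) j
      · simp only [Pi.sub_apply, Pi.add_apply, Fin.insertNth_apply_same, Pi.single_eq_same,
          Pi.zero_apply]
        ring
      · simp
    rw [h2, dotProduct_add, hN, zero_add, dotProduct_single] at h1
    exact h1
  have hNa : N sa i < 0 := by
    have := hsign sa ya hya a hsa
    nlinarith [hmI.1]
  have hNb : 0 < N sb i := by
    have := hsign sb yb hyb b hsb
    nlinarith [hmI.2]
  have hne : sa ≠ sb := fun h => by
    rw [h] at hNa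
    exact lt_asymm hNa hNb
  rw [Fintype.sum_eq_add sa sb hne, hLHS]
  · have h1 := hfneg sa ya hya hNa
    have h2 := hfpos sb yb hyb hNb
    rw [hsa, dropCoord_insertNth] at h1
    rw [hsb, dropCoord_insertNth] at h2
    rw [h1, h2]
    ring
  · rintro s ⟨hs1, hs2⟩
    refine hf0 s x' fun y hy h => ?_
    set t := (o s + A s y) i with ht
    have hz : o s + A s y = i.insertNth (α := fun _ => ℝ) t x' := by
      rw [← h, ht, insertNth_dropCoord]
    have hzfr := hface s y hy
    rw [hz] at hzfr
    have htI : t ∉ Set.Ioo a b := fun h' => hzfr.2 (by rw [hDint]; exact (hmem t).2 h')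
    have hseg : ∀ u, ∀ c d : ℝ, 0 < c → 0 < d → c + d = 1 → u = c * m + d * t →
        u ∈ Set.Ioo a b := by
      intro u c d hc hd hcd hu
      rw [← hmem, ← hDint]
      refine hDc.openSegment_interior_closure_subset_interior (by rw [hDint]; exact (hmem m).2 hmI)
        hzfr.1 ⟨c, d, hc, hd, hcd, ?_⟩
      rw [insertNth_combo i x' c d m t hcd, hu]
    rcases lt_trichotomy t a with hta | hta | hta
    · have := hseg a ((a - t) / (m - t)) ((m - a) / (m - t))
        (div_pos (by linarith) (by linarith [hmI.1])) (div_pos (by linarith [hmI.1])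
          (by linarith [hmI.1])) (by rw [← add_div, div_eq_one_iff_eq (by linarith [hmI.1])]; ring)
        (by have : m - t ≠ 0 := by linarith [hmI.1]
            field_simp
            ring)
      exact lt_irrefl _ this.1
    · exact hdisj s sa hs1 y hy ya hya (by rw [hsa, hz, hta])
    rcases lt_trichotomy t b with htb | htb | htb
    · exact htI ⟨hta, htb⟩
    · exact hdisj s sb hs2 y hy yb hyb (by rw [hsb, hz, htb])
    · have := hseg b ((t - b) / (t - m)) ((b - m) / (t - m))
        (div_pos (by linarith) (by linarith [hmI.2])) (div_pos (by linarith [hmI.2])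
          (by linarith [hmI.2])) (by rw [← add_div, div_eq_one_iff_eq (by linarith [hmI.2])]; ring)
        (by have : t - m ≠ 0 := by linarith [hmI.2]
            field_simp
            ring)
      exact lt_irrefl _ this.2

end Divergence

/-! ### Geometry of cells and faces -/

/-- An open convex set lies strictly on one side of the plane of a flat piece of its boundary. -/
theorem forall_neg_or_forall_pos_of_flat {m n : ℕ} {D : Set (Fin m → ℝ)} (hDo : IsOpen D)
    (hDc : Convex ℝ D) {U : Set (Fin n → ℝ)} (hU : IsOpen U) (hUn : U.Nonempty)
    (o : Fin m → ℝ) (A : (Fin n → ℝ) →ₗ[ℝ] (Fin m → ℝ)) (N : Fin m → ℝ)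
    (hface : ∀ y ∈ U, o + A y ∈ frontier D) (hplane : ∀ x, N ⬝ᵥ (x - o) = 0 → ∃ y, x = o + A y) :
    (∀ x ∈ D, N ⬝ᵥ (x - o) < 0) ∨ ∀ x ∈ D, 0 < N ⬝ᵥ (x - o) := by
  have hne : ∀ x ∈ D, N ⬝ᵥ (x - o) ≠ 0 := by
    intro x hx h
    obtain ⟨y, rfl⟩ := hplane x h
    obtain ⟨z, hz⟩ := hUn
    -- A point of the flat piece would be interior to a segment from `x` to another such point.
    have hc : Continuous fun ε : ℝ => z - ε • (y - z) := by fun_prop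
    have h0 : (fun ε : ℝ => z - ε • (y - z)) ⁻¹' U ∈ nhds (0 : ℝ) :=
      (hU.preimage hc).mem_nhds (by simpa using hz)
    obtain ⟨ε, hε, hball⟩ := Metric.mem_nhds_iff.1 h0
    have hmem : z - (ε / 2) • (y - z) ∈ U := hball (by
      rw [Metric.mem_ball, Real.dist_eq, sub_zero, abs_of_pos (by linarith)]
      linarith)
    refine (hface z hz).2 (hDc.openSegment_interior_closure_subset_interior
      (hDo.interior_eq.symm ▸ hx) (hface _ hmem).1 ?_)
    have hpos : 0 < 1 + ε / 2 := by linarith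
    refine ⟨ε / 2 / (1 + ε / 2), 1 / (1 + ε / 2), by positivity, by positivity, ?_, ?_⟩
    · field_simp
      ring
    · simp only [map_sub, map_smul]
      funext j
      simp only [Pi.add_apply, Pi.smul_apply, Pi.sub_apply, smul_eq_mul]
      field_simp
      ring
  by_contra hcon
  push Not at hcon
  obtain ⟨⟨x, hx, hx'⟩, y, hy, hy'⟩ := hcon
  have hx1 : 0 < N ⬝ᵥ (x - o) := lt_of_le_of_ne hx' (hne x hx).symm
  have hy1 : N ⬝ᵥ (y - o) < 0 := lt_of_le_of_ne hy' (hne y hy)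
  set a := N ⬝ᵥ (x - o)
  set b := N ⬝ᵥ (y - o)
  have hab : 0 < a - b := by linarith
  refine hne _ (hDc hx hy (a := -b / (a - b)) (b := a / (a - b))
    (div_nonneg (by linarith) hab.le) (div_nonneg hx' hab.le) ?_) ?_
  · rw [← add_div, div_eq_one_iff_eq hab.ne']
    ring
  · have : (-b / (a - b)) • x + (a / (a - b)) • y - o =
        (-b / (a - b)) • (x - o) + (a / (a - b)) • (y - o) := by
      funext j
      simp only [Pi.add_apply, Pi.smul_apply, Pi.sub_apply, smul_eq_mul]
      field_simp
      ring
    rw [this, dotProduct_add, dotProduct_smul, dotProduct_smul, smul_eq_mul, smul_eq_mul]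
    change -b / (a - b) * a + a / (a - b) * b = 0
    ring

theorem det_fin_one (L : (Fin 1 → ℝ) →ₗ[ℝ] (Fin 1 → ℝ)) :
    LinearMap.det L = L (Pi.single 0 1) 0 := by
  rw [← LinearMap.det_toMatrix', Matrix.det_fin_one, LinearMap.toMatrix'_apply]

theorem det_fin_two (L : (Fin 2 → ℝ) →ₗ[ℝ] (Fin 2 → ℝ)) :
    LinearMap.det L = L (Pi.single 0 1) 0 * L (Pi.single 1 1) 1 -
      L (Pi.single 1 1) 0 * L (Pi.single 0 1) 1 := by
  rw [← LinearMap.det_toMatrix', Matrix.det_fin_two]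
  simp only [LinearMap.toMatrix'_apply]

theorem eval_aeval_mvPolynomial {σ τ : Type*} (g : σ → MvPolynomial τ ℝ) (y : τ → ℝ)
    (p : MvPolynomial σ ℝ) :
    MvPolynomial.eval y (MvPolynomial.aeval g p) =
      MvPolynomial.eval (fun j => MvPolynomial.eval y (g j)) p := by
  induction p using MvPolynomial.induction_on with
  | C c => simp
  | add p q hp hq => simp only [map_add, hp, hq]
  | mul_X p j hp => simp only [map_mul, hp, MvPolynomial.aeval_X, MvPolynomial.eval_X]

theorem eval_aeval_polynomial {σ : Type*} (g : σ → ℝ[X]) (s : ℝ) (p : MvPolynomial σ ℝ) :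
    (MvPolynomial.aeval g p).eval s = MvPolynomial.eval (fun j => (g j).eval s) p := by
  induction p using MvPolynomial.induction_on with
  | C c => simp
  | add p q hp hq => simp only [map_add, Polynomial.eval_add, hp, hq]
  | mul_X p j hp =>
    simp only [map_mul, hp, MvPolynomial.aeval_X, MvPolynomial.eval_X, Polynomial.eval_mul]

namespace MeshData

variable {𝒯 ℱ ℰ 𝒱 : Type*} [Fintype 𝒯] [Fintype ℱ] [Fintype ℰ] [Fintype 𝒱]
  {M : MeshData 𝒯 ℱ ℰ 𝒱} {Ω : Set R3}

theorem mem_facesOf {T : 𝒯} {F : ℱ} : F ∈ M.facesOf T ↔ M.face F ⊆ frontier (M.cell T) := by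
  classical
  simp [facesOf]

theorem mem_edgesOf {F : ℱ} {E : ℰ} : E ∈ M.edgesOf F ↔ M.edge E ⊆ M.faceBdry F := by
  classical
  simp [edgesOf]

/-- The linear part of the parametrization of a face. -/
def faceLin (M : MeshData 𝒯 ℱ ℰ 𝒱) (F : ℱ) : R2 →ₗ[ℝ] R3 where
  toFun y := ∑ i, y i • M.frame F i
  map_add' y z := by simp only [Pi.add_apply, add_smul, Finset.sum_add_distrib]
  map_smul' c y := by
    simp only [Pi.smul_apply, smul_eq_mul, mul_smul, Finset.smul_sum, RingHom.id_apply]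

theorem faceMap_eq (F : ℱ) (y : R2) : M.faceMap F y = M.origin F + M.faceLin F y := rfl

theorem faceLin_apply (F : ℱ) (y : R2) :
    M.faceLin F y = y 0 • M.frame F 0 + y 1 • M.frame F 1 :=
  Fin.sum_univ_two fun i => y i • M.frame F i

theorem continuous_faceMap (F : ℱ) : Continuous (M.faceMap F) :=
  continuous_const.add (M.faceLin F).continuous_of_finiteDimensional

theorem normal_dot_frame (F : ℱ) (i : Fin 2) : M.normal F ⬝ᵥ M.frame F i = 0 := by
  fin_cases i
  · exact (dotProduct_comm _ _).trans (dot_self_cross _ _)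
  · exact (dotProduct_comm _ _).trans (dot_cross_self _ _)

theorem normal_dot_faceLin (F : ℱ) (y : R2) : M.normal F ⬝ᵥ M.faceLin F y = 0 := by
  rw [faceLin_apply, dotProduct_add, dotProduct_smul, dotProduct_smul, normal_dot_frame,
    normal_dot_frame]
  simp

theorem abs_det_faceLin (F : ℱ) (i : Fin 3) :
    |LinearMap.det ((dropCoord i).comp (M.faceLin F))| = |M.normal F i| := by
  have h : ∀ j l, ((dropCoord i).comp (M.faceLin F)) (Pi.single j 1) l =
      M.frame F j (i.succAbove l) := by
    intro j l
    change M.faceLin F (Pi.single j 1) (i.succAbove l) = _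
    rw [faceLin_apply]
    fin_cases j <;> simp
  rw [det_fin_two, h, h, h, h, normal, cross_apply]
  fin_cases i
  · simp [Fin.succAbove]; ring_nf
  · rw [← abs_neg]
    simp [Fin.succAbove]; ring_nf
  · simp [Fin.succAbove]; ring_nf

theorem edgePt_zero (E : ℰ) : M.edgePt E 0 = M.pt (M.src E) := by simp [edgePt]

theorem continuous_edgePt (E : ℰ) : Continuous (M.edgePt E) := by
  unfold edgePt
  fun_prop

theorem eval_resF (F : ℱ) (y : R2) (p : P3) :
    MvPolynomial.eval y (M.resF F p) = MvPolynomial.eval (M.faceMap F y) p := by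
  rw [resF, eval_aeval_mvPolynomial]
  congr 2
  funext j
  simp [faceMap, mul_comm]

/-- The restriction of polynomials from space to an edge. -/
def lineE (M : MeshData 𝒯 ℱ ℰ 𝒱) (E : ℰ) : P3 →ₐ[ℝ] ℝ[X] :=
  MvPolynomial.aeval (fun j => Polynomial.C (M.pt (M.src E) j) + Polynomial.C (M.tangent E j) * X)

theorem eval_lineE (E : ℰ) (s : ℝ) (p : P3) :
    (M.lineE E p).eval s = MvPolynomial.eval (M.edgePt E s) p := by
  rw [lineE, eval_aeval_polynomial]
  congr 2
  funext j
  simp only [edgePt, Polynomial.eval_add, Polynomial.eval_mul, Polynomial.eval_C, Polynomial.eval_X,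
    Pi.add_apply, Pi.smul_apply, smul_eq_mul]
  rw [mul_comm]

theorem resF_mem {F : ℱ} {m : ℤ} {p : P3} (hp : p ∈ Poly (Fin 3) m) :
    M.resF F p ∈ Poly (Fin 2) m := by
  refine aeval_mem_Poly (fun j => Submodule.add_mem _ (C_mem_Poly zero_le_one _)
    (Submodule.sum_mem _ fun i _ => ?_)) hp
  have := Poly_mul (C_mem_Poly (σ := Fin 2) le_rfl (M.frame F i j)) (X_mem_Poly i)
  rwa [zero_add] at this

theorem resE_mem {F : ℱ} {E : ℰ} {m : ℤ} {p : P2} (hp : p ∈ Poly (Fin 2) m) :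
    M.resE F E p ∈ PolyE m := by
  refine aeval_mem_PolyE (fun j => Submodule.add_mem _ (C_mem_PolyE zero_le_one _) ?_) hp
  have := PolyE_mul (C_mem_PolyE le_rfl (M.tang F (M.tangent E) j)) X_mem_PolyE
  rwa [zero_add] at this

namespace IsPolyhedralMesh

variable (hM : M.IsPolyhedralMesh Ω)
include hM

theorem frame_dot (F : ℱ) (i j : Fin 2) :
    M.frame F i ⬝ᵥ M.frame F j = if i = j then 1 else 0 := by
  split_ifs with h
  · rw [h, hM.frame_unit]
  · fin_cases i <;> fin_cases j
    · exact absurd rfl h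
    · exact hM.frame_orth F
    · exact (dotProduct_comm _ _).trans (hM.frame_orth F)
    · exact absurd rfl h

theorem normal_dot_self (F : ℱ) : M.normal F ⬝ᵥ M.normal F = 1 := by
  rw [normal, cross_dot_cross, hM.frame_unit, hM.frame_unit, hM.frame_orth, dotProduct_comm,
    hM.frame_orth]
  ring

theorem frame3_mul_transpose (F : ℱ) :
    (Matrix.of (M.frame3 F)) * (Matrix.of (M.frame3 F))ᵀ = 1 := by
  ext i j
  rw [Matrix.mul_apply]
  change M.frame3 F i ⬝ᵥ M.frame3 F j = _
  have h0 := normal_dot_frame (M := M) F 0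
  have h1 := normal_dot_frame (M := M) F 1
  have h0' := (dotProduct_comm _ _).trans h0
  have h1' := (dotProduct_comm _ _).trans h1
  have e := hM.frame_dot F
  fin_cases i <;> fin_cases j <;> simp [frame3, h0, h1, h0', h1', e, hM.normal_dot_self]

theorem sum_frame3 (F : ℱ) (i j : Fin 3) :
    ∑ a, M.frame3 F a i * M.frame3 F a j = if i = j then 1 else 0 := by
  have h := mul_eq_one_comm.1 (hM.frame3_mul_transpose F)
  have := congrFun (congrFun h i) j
  rw [Matrix.mul_apply, Matrix.one_apply] at this
  exact this

/-- The expansion of a vector in the orthonormal basis attached to a face. -/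
theorem eq_faceLin_add (F : ℱ) (x : R3) :
    x = M.faceLin F (M.tang F x) + (M.normal F ⬝ᵥ x) • M.normal F := by
  funext i
  have h : ∑ j, (∑ a, M.frame3 F a i * M.frame3 F a j) * x j = x i := by
    simp [hM.sum_frame3]
  rw [← h, faceLin_apply]
  simp only [Fin.sum_univ_three, frame3, Matrix.cons_val_zero, Matrix.cons_val_one, Matrix.cons_val,
    Pi.add_apply, Pi.smul_apply, smul_eq_mul, tang, dotProduct]
  ring

theorem tang_faceLin (F : ℱ) (y : R2) : M.tang F (M.faceLin F y) = y := by
  have e := hM.frame_dot F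
  funext i
  rw [tang, faceLin_apply, dotProduct_add, dotProduct_smul, dotProduct_smul, e, e]
  fin_cases i <;> simp

theorem faceMap_injective (F : ℱ) : Function.Injective (M.faceMap F) := by
  intro y z h
  rw [faceMap_eq, faceMap_eq, add_right_inj] at h
  rw [← hM.tang_faceLin F y, h, hM.tang_faceLin]

theorem zero_mem_faceDom (F : ℱ) : (0 : R2) ∈ M.faceDom F := by
  obtain ⟨y, hy, h⟩ := hM.origin_mem F
  have : y = 0 := hM.faceMap_injective F (by rw [h, faceMap_eq, map_zero, add_zero])
  exact this ▸ hy

theorem closure_face (F : ℱ) : closure (M.face F) = M.faceMap F '' closure (M.faceDom F) :=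
  (image_closure_of_isCompact (hM.face_bounded F).isCompact_closure
    (continuous_faceMap F).continuousOn).symm

theorem ωT_sign {T : 𝒯} {F : ℱ} (hF : F ∈ M.facesOf T) :
    ∀ x ∈ M.cell T, (M.ωT T F • M.normal F) ⬝ᵥ (x - M.origin F) < 0 := by
  have h := forall_neg_or_forall_pos_of_flat (hM.cell_open T) (hM.cell_convex T) (hM.face_open F)
    ⟨0, hM.zero_mem_faceDom F⟩ (M.origin F) (M.faceLin F) (M.normal F)
    (fun y hy => mem_facesOf.1 hF ⟨y, hy, rfl⟩)
    (fun x hx => ⟨M.tang F (x - M.origin F), by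
      have := hM.eq_faceLin_add F (x - M.origin F)
      rw [hx, zero_smul, add_zero] at this
      rw [← this, add_sub_cancel]⟩)
  intro x hx
  rw [smul_dotProduct, smul_eq_mul, ωT]
  split_ifs with h'
  · rw [one_mul, dotProduct_comm]
    exact h' x hx
  · rcases h with h | h
    · refine absurd (fun x hx => ?_) h'
      rw [dotProduct_comm]
      exact h x hx
    · linarith [h x hx]

theorem intT_add (T : 𝒯) (p q : P3) : M.intT T (p + q) = M.intT T p + M.intT T q := by
  simp only [intT, map_add]
  exact integral_add (integrableOn_eval (hM.cell_bounded T) p)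
    (integrableOn_eval (hM.cell_bounded T) q)

omit hM in
theorem intT_smul (T : 𝒯) (c : ℝ) (p : P3) : M.intT T (c • p) = c * M.intT T p := by
  simp only [intT, MvPolynomial.smul_eval]
  exact integral_const_mul c _

theorem intF_add (F : ℱ) (p q : P2) : M.intF F (p + q) = M.intF F p + M.intF F q := by
  simp only [intF, map_add]
  exact integral_add (integrableOn_eval (hM.face_bounded F) p)
    (integrableOn_eval (hM.face_bounded F) q)

omit hM in
theorem intF_smul (F : ℱ) (c : ℝ) (p : P2) : M.intF F (c • p) = c * M.intF F p := by
  simp only [intF, MvPolynomial.smul_eval]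
  exact integral_const_mul c _

omit hM in
theorem intE_add (E : ℰ) (p q : ℝ[X]) : M.intE E (p + q) = M.intE E p + M.intE E q := by
  simp only [intE, Polynomial.eval_add]
  exact intervalIntegral.integral_add (p.continuous.intervalIntegrable _ _)
    (q.continuous.intervalIntegrable _ _)

omit hM in
theorem intE_smul (E : ℰ) (c : ℝ) (p : ℝ[X]) : M.intE E (c • p) = c * M.intE E p := by
  simp only [intE, Polynomial.eval_smul, smul_eq_mul]
  exact intervalIntegral.integral_const_mul c _

/-- The integral over a cell as a linear functional. -/
def intTₗ (T : 𝒯) : P3 →ₗ[ℝ] ℝ where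
  toFun := M.intT T
  map_add' := hM.intT_add T
  map_smul' := intT_smul T

/-- The integral over a face as a linear functional. -/
def intFₗ (F : ℱ) : P2 →ₗ[ℝ] ℝ where
  toFun := M.intF F
  map_add' := hM.intF_add F
  map_smul' := intF_smul F

omit hM in
/-- The integral over an edge as a linear functional. -/
def _root_.StokesComplex.MeshData.intEₗ (M : MeshData 𝒯 ℱ ℰ 𝒱) (E : ℰ) : ℝ[X] →ₗ[ℝ] ℝ where
  toFun := M.intE E
  map_add' := intE_add E
  map_smul' := intE_smul E

theorem intTₗ_apply (T : 𝒯) (p : P3) : hM.intTₗ T p = M.intT T p := rfl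

theorem intFₗ_apply (F : ℱ) (p : P2) : hM.intFₗ F p = M.intF F p := rfl

omit hM in
theorem _root_.StokesComplex.MeshData.intEₗ_apply (E : ℰ) (p : ℝ[X]) :
    M.intEₗ E p = M.intE E p := rfl

/-- The divergence theorem on a cell. -/
theorem intT_div (T : 𝒯) (w : Fin 3 → P3) :
    M.intT T (div w) = ∑ F ∈ M.facesOf T, M.ωT T F * M.intF F (M.dotNF F w) := by
  have key : ∀ i, M.intT T (pd i (w i)) = ∑ F : {F // F ∈ M.facesOf T},
      (M.ωT T F.1 • M.normal F.1) i * M.intF F.1 (M.resF F.1 (w i)) := by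
    intro i
    have := integral_pd_eq_sum_flux (S := {F // F ∈ M.facesOf T}) i (hM.cell_open T)
      (hM.cell_convex T) (hM.cell_bounded T) (fun F => M.faceDom F.1) (fun F => hM.face_open F.1)
      (fun F => hM.face_convex F.1) (fun F => hM.face_bounded F.1) (fun F => M.origin F.1)
      (fun F => M.faceLin F.1) (fun F => M.ωT T F.1 • M.normal F.1) ?_ ?_ ?_ ?_
      (fun F => hM.ωT_sign F.2) (w i)
    · rw [intT, this]
      refine Finset.sum_congr rfl fun F _ => ?_
      simp only [intF, eval_resF]
      rfl
    · rw [hM.cell_bdry T, ← Set.iUnion_subtype (fun F => F ∈ M.facesOf T)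
        (fun F => closure (M.face F.1))]
      exact Set.iUnion_congr fun F => hM.closure_face F.1
    · intro F G hFG y hy z hz h
      have := hM.disjoint (i := Sum.inr (Sum.inl F.1)) (j := Sum.inr (Sum.inl G.1))
        (fun h' => hFG (Subtype.ext (Sum.inl_injective (Sum.inr_injective h'))))
      exact Set.disjoint_left.1 this ⟨y, hy, rfl⟩ ⟨z, hz, h.symm⟩
    · intro F y
      rw [smul_dotProduct, normal_dot_faceLin, smul_zero]
    · intro F
      have hω : |M.ωT T F.1| = 1 := by
        rw [ωT]
        split_ifs <;> simp
      rw [abs_det_faceLin, Pi.smul_apply, smul_eq_mul, abs_mul, hω, one_mul]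
  have h1 : M.intT T (div w) = ∑ i, M.intT T (pd i (w i)) := by
    simp only [← hM.intTₗ_apply, div_apply, map_sum]
  rw [h1, Finset.sum_congr rfl fun i _ => key i, Finset.sum_comm,
    ← Finset.sum_coe_sort (M.facesOf T) fun F => M.ωT T F * M.intF F (M.dotNF F w)]
  refine Finset.sum_congr rfl fun F _ => ?_
  have h2 : M.intF F.1 (M.dotNF F.1 w) = ∑ i, M.normal F.1 i * M.intF F.1 (M.resF F.1 (w i)) := by
    simp only [← hM.intFₗ_apply, dotNF, dotc, map_sum, map_smul, smul_eq_mul]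
  rw [h2, Finset.mul_sum]
  exact Finset.sum_congr rfl fun i _ => by rw [Pi.smul_apply, smul_eq_mul, mul_assoc]

end IsPolyhedralMesh

end MeshData

theorem exists_mem_Poly {σ : Type*} (p : MvPolynomial σ ℝ) : ∃ m : ℤ, p ∈ Poly σ m := by
  refine ⟨p.totalDegree, mem_Poly_iff.2 fun d hd => ?_⟩
  have := MvPolynomial.le_totalDegree hd
  rw [Finsupp.degree_apply]
  exact_mod_cast this

theorem dotc_three {A : Type*} [AddCommMonoid A] [Module ℝ A] (a : R3) (v : Fin 3 → A) :
    dotc a v = a 0 • v 0 + a 1 • v 1 + a 2 • v 2 := Fin.sum_univ_three _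

theorem dotc_two {A : Type*} [AddCommMonoid A] [Module ℝ A] (a : R2) (v : Fin 2 → A) :
    dotc a v = a 0 • v 0 + a 1 • v 1 := Fin.sum_univ_two _

theorem dotc_cross_C (a b : R3) (r : Fin 3 → P3) :
    dotc a (crossProduct r fun j => MvPolynomial.C (b j)) = dotc (crossProduct b a) r := by
  simp only [dotc_three, cross_apply, Matrix.cons_val_zero, Matrix.cons_val_one, Matrix.cons_val,
    MvPolynomial.smul_eq_C_mul, map_sub, map_mul]
  ring

theorem dotc_neg_left {ι A : Type*} [Fintype ι] [AddCommGroup A] [Module ℝ A] (a : ι → ℝ)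
    (v : ι → A) : dotc (-a) v = -dotc a v := by
  simp [dotc]

theorem dotc_mem {ι σ : Type*} [Fintype ι] {m : ℤ} (a : ι → ℝ) {v : ι → MvPolynomial σ ℝ}
    (hv : v ∈ VPoly ι σ m) : dotc a v ∈ Poly σ m :=
  Submodule.sum_mem _ fun i _ => Submodule.smul_mem _ _ (mem_VPoly_iff.1 hv i)

namespace MeshData

variable {𝒯 ℱ ℰ 𝒱 : Type*} [Fintype 𝒯] [Fintype ℱ] [Fintype ℰ] [Fintype 𝒱]
  {M : MeshData 𝒯 ℱ ℰ 𝒱} {Ω : Set R3}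

theorem normalFE_eq (F : ℱ) (E : ℰ) :
    M.normalFE F E =
      M.faceLin F ![-M.tang F (M.tangent E) 1, M.tang F (M.tangent E) 0] := by
  rw [normalFE, normal, cross_cross_eq_smul_sub_smul, faceLin_apply]
  simp only [tang, Matrix.cons_val_zero, Matrix.cons_val_one]
  rw [neg_smul]
  abel

theorem pd_resF (F : ℱ) (i : Fin 2) (p : P3) :
    pd i (M.resF F p) = M.resF F (dotc (M.frame F i) (grad (Fin 3) p)) := by
  have h := derivation_aeval (MvPolynomial.pderiv i) (fun j => MvPolynomial.C (M.origin F j) +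
    ∑ i, MvPolynomial.C (M.frame F i j) * MvPolynomial.X i) p
  rw [pd_apply, resF, h, dotc, map_sum]
  refine Finset.sum_congr rfl fun j _ => ?_
  rw [map_smul, grad_apply, MvPolynomial.smul_eq_C_mul]
  congr 1
  simp only [map_add, map_sum, MvPolynomial.pderiv_C, zero_add, MvPolynomial.pderiv_C_mul,
    MvPolynomial.pderiv_X]
  rw [Finset.sum_eq_single i (fun l _ hl => by simp [hl]) (by simp), Pi.single_eq_same, mul_one]

theorem derivative_resE (F : ℱ) (E : ℰ) (r : P2) :
    derivative (M.resE F E r) = M.dotTE F E (grad (Fin 2) r) := by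
  have := derivative_aeval_line (M.tang F (M.pt (M.src E) - M.origin F))
    (M.tang F (M.tangent E)) r
  rw [resE, this, dotTE, dotc, map_sum]
  refine Finset.sum_congr rfl fun i _ => ?_
  rw [map_smul, Polynomial.smul_eq_C_mul]
  rfl

namespace IsPolyhedralMesh

variable (hM : M.IsPolyhedralMesh Ω)
include hM

/-! ### Edges of a mesh -/

theorem pt_injective : Function.Injective M.pt := by
  intro V W h
  by_contra hne
  have := hM.disjoint (i := Sum.inr (Sum.inr (Sum.inr V))) (j := Sum.inr (Sum.inr (Sum.inr W)))
    (fun h' => hne (Sum.inr_injective (Sum.inr_injective (Sum.inr_injective h'))))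
  exact Set.disjoint_left.1 this (Set.mem_singleton (M.pt V)) h

theorem pt_notMem_edge (V : 𝒱) (E : ℰ) : M.pt V ∉ M.edge E := by
  have := hM.disjoint (i := Sum.inr (Sum.inr (Sum.inr V))) (j := Sum.inr (Sum.inr (Sum.inl E)))
    (by simp)
  exact fun h => Set.disjoint_left.1 this (Set.mem_singleton (M.pt V)) h

theorem edge_disjoint {E E' : ℰ} (h : E ≠ E') : Disjoint (M.edge E) (M.edge E') :=
  hM.disjoint (i := Sum.inr (Sum.inr (Sum.inl E))) (j := Sum.inr (Sum.inr (Sum.inl E')))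
    (by simpa using h)

theorem len_pos (E : ℰ) : 0 < M.len E := by
  refine Real.sqrt_pos.2 (lt_of_le_of_ne ?_ (Ne.symm fun h => ?_))
  · exact Finset.sum_nonneg fun i _ => mul_self_nonneg _
  · rw [dotProduct_self_eq_zero, sub_eq_zero] at h
    exact hM.edge_ne E (hM.pt_injective h.symm)

theorem len_smul_tangent (E : ℰ) :
    M.len E • M.tangent E = M.pt (M.tgt E) - M.pt (M.src E) := by
  rw [tangent, smul_smul, mul_inv_cancel₀ (hM.len_pos E).ne', one_smul]

theorem edgePt_len (E : ℰ) : M.edgePt E (M.len E) = M.pt (M.tgt E) := by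
  rw [edgePt, hM.len_smul_tangent, add_sub_cancel]

theorem tangent_dot_self (E : ℰ) : M.tangent E ⬝ᵥ M.tangent E = 1 := by
  have h : M.len E * M.len E =
      (M.pt (M.tgt E) - M.pt (M.src E)) ⬝ᵥ (M.pt (M.tgt E) - M.pt (M.src E)) :=
    Real.mul_self_sqrt (Finset.sum_nonneg fun i _ => mul_self_nonneg _)
  have hl := (hM.len_pos E).ne'
  rw [tangent, smul_dotProduct, dotProduct_smul, ← h, smul_eq_mul, smul_eq_mul]
  field_simp

theorem edge_eq (E : ℰ) : M.edge E = M.edgePt E '' Set.Ioo 0 (M.len E) := by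
  have hl := hM.len_pos E
  rw [edge, openSegment_eq_image', ← hM.len_smul_tangent]
  ext x
  constructor
  · rintro ⟨θ, hθ, rfl⟩
    refine ⟨θ * M.len E, ⟨mul_pos hθ.1 hl, ?_⟩, by simp only [edgePt, smul_smul]⟩
    nlinarith [hθ.2]
  · rintro ⟨s, hs, rfl⟩
    refine ⟨s / M.len E, ⟨div_pos hs.1 hl, (div_lt_one hl).2 hs.2⟩, ?_⟩
    dsimp only
    rw [edgePt, smul_smul, div_mul_cancel₀ _ hl.ne']

theorem segment_eq (E : ℰ) :
    segment ℝ (M.pt (M.src E)) (M.pt (M.tgt E)) = M.edgePt E '' Set.Icc 0 (M.len E) := by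
  have hl := hM.len_pos E
  rw [segment_eq_image', ← hM.len_smul_tangent]
  ext x
  constructor
  · rintro ⟨θ, hθ, rfl⟩
    refine ⟨θ * M.len E, ⟨mul_nonneg hθ.1 hl.le, ?_⟩, by simp only [edgePt, smul_smul]⟩
    nlinarith [hθ.2]
  · rintro ⟨s, hs, rfl⟩
    refine ⟨s / M.len E, ⟨div_nonneg hs.1 hl.le, (div_le_one hl).2 hs.2⟩, ?_⟩
    dsimp only
    rw [edgePt, smul_smul, div_mul_cancel₀ _ hl.ne']

section FaceEdge

variable {F : ℱ} {E : ℰ} (hE : E ∈ M.edgesOf F)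
include hE

theorem segment_subset_faceBdry :
    segment ℝ (M.pt (M.src E)) (M.pt (M.tgt E)) ⊆ M.faceBdry F := by
  rw [hM.face_bdry F]
  exact Set.subset_biUnion_of_mem (u := fun E =>
    segment ℝ (M.pt (M.src E)) (M.pt (M.tgt E))) hE

theorem faceLin_src : M.faceLin F (M.tang F (M.pt (M.src E) - M.origin F)) =
    M.pt (M.src E) - M.origin F := by
  obtain ⟨y, -, h⟩ := hM.segment_subset_faceBdry hE (left_mem_segment ℝ _ _)
  rw [← h, faceMap_eq, add_sub_cancel_left, hM.tang_faceLin]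

theorem faceLin_tangent : M.faceLin F (M.tang F (M.tangent E)) = M.tangent E := by
  obtain ⟨y, -, h⟩ := hM.segment_subset_faceBdry hE (left_mem_segment ℝ _ _)
  obtain ⟨z, -, h'⟩ := hM.segment_subset_faceBdry hE (right_mem_segment ℝ _ _)
  have : M.tangent E = M.faceLin F ((M.len E)⁻¹ • (z - y)) := by
    rw [tangent, ← h, ← h', faceMap_eq, faceMap_eq, map_smul, map_sub, add_sub_add_left_eq_sub]
  rw [this, hM.tang_faceLin]

theorem normal_dot_tangent : M.normal F ⬝ᵥ M.tangent E = 0 := by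
  rw [← hM.faceLin_tangent hE, normal_dot_faceLin]

theorem faceMap_edge (s : ℝ) :
    M.faceMap F (M.tang F (M.pt (M.src E) - M.origin F) + s • M.tang F (M.tangent E)) =
      M.edgePt E s := by
  rw [faceMap_eq, map_add, map_smul, hM.faceLin_src hE, hM.faceLin_tangent hE, edgePt]
  abel

theorem resE_resF (p : P3) : M.resE F E (M.resF F p) = M.lineE E p := by
  refine Polynomial.funext fun s => ?_
  rw [eval_lineE, resE, eval_aeval_polynomial, eval_resF, ← hM.faceMap_edge hE]
  congr 3
  funext i
  simp only [Polynomial.eval_add, Polynomial.eval_mul, Polynomial.eval_C, Polynomial.eval_X,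
    Pi.add_apply, Pi.smul_apply, smul_eq_mul]
  ring

end FaceEdge

theorem tang_normalFE (F : ℱ) (E : ℰ) :
    M.tang F (M.normalFE F E) = ![-M.tang F (M.tangent E) 1, M.tang F (M.tangent E) 0] := by
  rw [normalFE_eq, hM.tang_faceLin]

/-- The parametrization of an edge in the coordinates of a face. -/
def edgeLin (M : MeshData 𝒯 ℱ ℰ 𝒱) (F : ℱ) (E : ℰ) : (Fin 1 → ℝ) →ₗ[ℝ] R2 :=
  (LinearMap.toSpanSingleton ℝ R2 (M.tang F (M.tangent E))).comp (LinearMap.proj 0)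

omit hM in
theorem edgeLin_apply (F : ℱ) (E : ℰ) (y : Fin 1 → ℝ) :
    edgeLin M F E y = y 0 • M.tang F (M.tangent E) := rfl

/-- The interval of arc lengths of an edge, as a set of vectors with one component. -/
def edgeDom (M : MeshData 𝒯 ℱ ℰ 𝒱) (E : ℰ) : Set (Fin 1 → ℝ) :=
  (Homeomorph.funUnique (Fin 1) ℝ) ⁻¹' Set.Ioo 0 (M.len E)

omit hM in
theorem mem_edgeDom {E : ℰ} {y : Fin 1 → ℝ} : y ∈ edgeDom M E ↔ y 0 ∈ Set.Ioo 0 (M.len E) :=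
  Iff.rfl

theorem mem_closure_edgeDom {E : ℰ} {y : Fin 1 → ℝ} :
    y ∈ closure (edgeDom M E) ↔ y 0 ∈ Set.Icc 0 (M.len E) := by
  rw [edgeDom, ← Homeomorph.preimage_closure, closure_Ioo (hM.len_pos E).ne]
  exact Iff.rfl

theorem mem_edge_of_edgeDom {F : ℱ} {E : ℰ} (hE : E ∈ M.edgesOf F) {y : Fin 1 → ℝ}
    (hy : y ∈ edgeDom M E) :
    M.faceMap F (M.tang F (M.pt (M.src E) - M.origin F) + edgeLin M F E y) ∈ M.edge E := by
  rw [edgeLin_apply, hM.faceMap_edge hE, hM.edge_eq]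
  exact ⟨_, hy, rfl⟩

theorem ωF_sign {F : ℱ} {E : ℰ} (hE : E ∈ M.edgesOf F) :
    ∀ y ∈ M.faceDom F, (M.ωF F E • M.tang F (M.normalFE F E)) ⬝ᵥ
      (y - M.tang F (M.pt (M.src E) - M.origin F)) < 0 := by
  set o := M.tang F (M.pt (M.src E) - M.origin F) with ho
  set τ := M.tang F (M.tangent E) with hτ
  have hττ : τ 0 * τ 0 + τ 1 * τ 1 = 1 := by
    have h := hM.tangent_dot_self E
    rw [← hM.faceLin_tangent hE, faceLin_apply] at h
    simp only [dotProduct_add, add_dotProduct, smul_dotProduct, dotProduct_smul, hM.frame_dot,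
      smul_eq_mul] at h
    simpa using h
  have h := forall_neg_or_forall_pos_of_flat (hM.face_open F) (hM.face_convex F)
    (U := edgeDom M E) (isOpen_Ioo.preimage (Homeomorph.funUnique (Fin 1) ℝ).continuous)
    ⟨fun _ => M.len E / 2, mem_edgeDom.2 ⟨by linarith [hM.len_pos E], by linarith [hM.len_pos E]⟩⟩
    o (edgeLin M F E) (M.tang F (M.normalFE F E)) (fun y hy => ?_) (fun x hx => ?_)
  · have hdot : ∀ y : R2, M.tang F (M.normalFE F E) ⬝ᵥ (y - o) =
        (M.faceMap F y - M.pt (M.src E)) ⬝ᵥ M.normalFE F E := by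
      intro y
      have h1 : M.faceMap F y - M.pt (M.src E) = M.faceLin F (y - o) := by
        rw [map_sub, ho, hM.faceLin_src hE, faceMap_eq]
        abel
      rw [h1, faceLin_apply, add_dotProduct, smul_dotProduct, smul_dotProduct, dotProduct,
        Fin.sum_univ_two]
      simp only [tang, smul_eq_mul]
      ring
    intro y hy
    rw [smul_dotProduct, smul_eq_mul, ωF]
    split_ifs with h'
    · rw [one_mul, hdot]
      exact h' _ ⟨y, hy, rfl⟩
    · rcases h with h | h
      · refine absurd ?_ h'
        rintro _ ⟨z, hz, rfl⟩
        rw [← hdot]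
        exact h z hz
      · linarith [h y hy]
  · obtain ⟨z, hz, h⟩ := mem_edgesOf.1 hE (hM.mem_edge_of_edgeDom hE hy)
    rwa [← hM.faceMap_injective F h]
  · rw [hM.tang_normalFE, dotProduct, Fin.sum_univ_two] at hx
    simp only [Matrix.cons_val_zero, Matrix.cons_val_one, Pi.sub_apply, ← hτ] at hx
    refine ⟨fun _ => τ 0 * (x 0 - o 0) + τ 1 * (x 1 - o 1), ?_⟩
    rw [edgeLin_apply, ← hτ]
    funext i
    fin_cases i
    · simp only [Pi.add_apply, Pi.smul_apply, smul_eq_mul, Fin.zero_eta]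
      linear_combination (-(τ 1)) * hx - (x 0 - o 0) * hττ
    · simp only [Pi.add_apply, Pi.smul_apply, smul_eq_mul, Fin.mk_one]
      linear_combination τ 0 * hx - (x 1 - o 1) * hττ

/-- The divergence theorem on a face. -/
theorem intF_div (F : ℱ) (w : Fin 2 → P2) :
    M.intF F (div w) = ∑ E ∈ M.edgesOf F, M.ωF F E * M.intE E (M.dotNFE F E w) := by
  have key : ∀ i, M.intF F (pd i (w i)) = ∑ E : {E // E ∈ M.edgesOf F},
      (M.ωF F E.1 • M.tang F (M.normalFE F E.1)) i * M.intE E.1 (M.resE F E.1 (w i)) := by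
    intro i
    have := integral_pd_eq_sum_flux (S := {E // E ∈ M.edgesOf F}) i (hM.face_open F)
      (hM.face_convex F) (hM.face_bounded F) (fun E => edgeDom M E.1)
      (fun E => isOpen_Ioo.preimage (Homeomorph.funUnique (Fin 1) ℝ).continuous)
      (fun E => (convex_Ioo 0 (M.len E.1)).linear_preimage (LinearMap.proj (R := ℝ)
        (φ := fun _ : Fin 1 => ℝ) 0))
      (fun E => ?_) (fun E => M.tang F (M.pt (M.src E.1) - M.origin F))
      (fun E => edgeLin M F E.1) (fun E => M.ωF F E.1 • M.tang F (M.normalFE F E.1)) ?_ ?_ ?_ ?_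
      (fun E => hM.ωF_sign E.2) (w i)
    · rw [intF, this]
      refine Finset.sum_congr rfl fun E _ => ?_
      congr 1
      rw [intE, intervalIntegral.integral_of_le (hM.len_pos E.1).le,
        integral_Ioc_eq_integral_Ioo]
      rw [← (volume_preserving_funUnique (Fin 1) ℝ).setIntegral_preimage_emb
        (MeasurableEquiv.measurableEmbedding _)]
      refine setIntegral_congr_fun₀ ?_ fun y hy => ?_
      · exact (measurableSet_Ioo.preimage
          (Homeomorph.funUnique (Fin 1) ℝ).continuous.measurable).nullMeasurableSet
      · rw [resE, eval_aeval_polynomial]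
        congr 2
        funext j
        rw [edgeLin_apply]
        simp only [Pi.add_apply, Pi.smul_apply, smul_eq_mul, Polynomial.eval_add,
          Polynomial.eval_mul, Polynomial.eval_C, Polynomial.eval_X]
        rw [mul_comm]
        rfl
    · refine isBounded_iff_forall_norm_le.2 ⟨M.len E.1, fun y hy => ?_⟩
      rw [mem_edgeDom] at hy
      refine (pi_norm_le_iff_of_nonneg (hM.len_pos E.1).le).2 fun i => ?_
      rw [Subsingleton.elim i 0, Real.norm_eq_abs, abs_of_pos hy.1]
      exact hy.2.le
    · ext y
      have h1 : y ∈ frontier (M.faceDom F) ↔ M.faceMap F y ∈ M.faceBdry F :=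
        ((hM.faceMap_injective F).mem_set_image).symm
      rw [h1, hM.face_bdry F]
      simp only [Set.mem_iUnion, Set.mem_image, Subtype.exists, exists_prop]
      refine exists_congr fun E => ⟨fun ⟨hE, h⟩ => ⟨hE, ?_⟩, fun ⟨hE, h⟩ => ⟨hE, ?_⟩⟩
      · rw [hM.segment_eq] at h
        obtain ⟨s, hs, h⟩ := h
        refine ⟨fun _ => s, hM.mem_closure_edgeDom.2 hs, hM.faceMap_injective F ?_⟩
        rw [edgeLin_apply, hM.faceMap_edge hE, h]
      · obtain ⟨z, hz, rfl⟩ := h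
        rw [hM.segment_eq, edgeLin_apply, hM.faceMap_edge hE]
        exact ⟨_, hM.mem_closure_edgeDom.1 hz, rfl⟩
    · intro E E' hne y hy z hz h
      have h1 := hM.mem_edge_of_edgeDom E.2 hy
      have h2 := hM.mem_edge_of_edgeDom E'.2 hz
      rw [h] at h1
      exact Set.disjoint_left.1 (hM.edge_disjoint fun h' => hne (Subtype.ext h')) h1 h2
    · intro E y
      rw [smul_dotProduct, edgeLin_apply, dotProduct_smul, hM.tang_normalFE, dotProduct,
        Fin.sum_univ_two]
      simp only [Matrix.cons_val_zero, Matrix.cons_val_one, smul_eq_mul]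
      ring
    · intro E
      have hω : |M.ωF F E.1| = 1 := by
        rw [ωF]
        split_ifs <;> simp
      rw [det_fin_one, Pi.smul_apply, smul_eq_mul, abs_mul, hω, one_mul, hM.tang_normalFE]
      change |edgeLin M F E.1 (Pi.single 0 1) (i.succAbove 0)| = _
      rw [edgeLin_apply]
      fin_cases i <;> simp
  have h1 : M.intF F (div w) = ∑ i, M.intF F (pd i (w i)) := by
    simp only [← hM.intFₗ_apply, div_apply, map_sum]
  rw [h1, Finset.sum_congr rfl fun i _ => key i, Finset.sum_comm,
    ← Finset.sum_coe_sort (M.edgesOf F) fun E => M.ωF F E * M.intE E (M.dotNFE F E w)]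
  refine Finset.sum_congr rfl fun E _ => ?_
  have h2 : M.intE E.1 (M.dotNFE F E.1 w) =
      ∑ i, M.tang F (M.normalFE F E.1) i * M.intE E.1 (M.resE F E.1 (w i)) := by
    simp only [← intEₗ_apply, dotNFE, dotc, map_sum, map_smul, smul_eq_mul]
  rw [h2, Finset.mul_sum]
  exact Finset.sum_congr rfl fun i _ => by rw [Pi.smul_apply, smul_eq_mul, mul_assoc]

/-! ### Restrictions of differential operators -/

theorem dotNFE_vrot (F : ℱ) (E : ℰ) (r : P2) :
    M.dotNFE F E (vrot r) = -derivative (M.resE F E r) := by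
  rw [derivative_resE, dotNFE, dotTE, hM.tang_normalFE, dotc_two, dotc_two, vrot_zero, vrot_one,
    grad_apply, grad_apply, ← map_neg (M.resE F E)]
  congr 1
  simp only [Matrix.cons_val_zero, Matrix.cons_val_one, MvPolynomial.smul_eq_C_mul, map_neg]
  ring

theorem crossNF_zero (F : ℱ) (r : Fin 3 → P3) :
    M.crossNF F r 0 = M.resF F (dotc (M.frame F 1) r) := by
  rw [crossNF, dotc_cross_C, normal, cross_cross_eq_smul_sub_smul, hM.frame_dot, hM.frame_dot]
  simp

theorem crossNF_one (F : ℱ) (r : Fin 3 → P3) :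
    M.crossNF F r 1 = -M.resF F (dotc (M.frame F 0) r) := by
  rw [crossNF, dotc_cross_C, normal, cross_cross_eq_smul_sub_smul, hM.frame_dot, hM.frame_dot,
    ← map_neg, ← dotc_neg_left]
  simp

theorem dotNFE_crossNF {F : ℱ} {E : ℰ} (hE : E ∈ M.edgesOf F) (r : Fin 3 → P3) :
    M.dotNFE F E (M.crossNF F r) = -M.lineE E (dotc (M.tangent E) r) := by
  have h := hM.faceLin_tangent hE
  rw [faceLin_apply] at h
  rw [dotNFE, hM.tang_normalFE, dotc_two, hM.crossNF_zero, hM.crossNF_one]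
  simp only [Matrix.cons_val_zero, Matrix.cons_val_one]
  rw [← hM.resE_resF hE, smul_neg, ← map_smul, ← map_smul, ← map_neg, ← map_add, ← map_neg,
    ← map_neg]
  congr 2
  conv_rhs => rw [← h]
  simp only [dotc_three, Pi.add_apply, Pi.smul_apply, smul_eq_mul, MvPolynomial.smul_eq_C_mul,
    map_neg, map_add, map_mul]
  ring

theorem div_crossNF (F : ℱ) (r : Fin 3 → P3) :
    div (M.crossNF F r) = M.dotNF F (curl r) := by
  rw [div_apply, Fin.sum_univ_two, hM.crossNF_zero, hM.crossNF_one, map_neg, pd_resF, pd_resF,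
    dotNF, ← map_neg, ← map_add]
  congr 1
  simp only [dotc_three, grad_apply, curl_zero, curl_one, curl_two, normal, cross_apply,
    Matrix.cons_val_zero, Matrix.cons_val_one, Matrix.cons_val, map_add, map_smul, Pi.add_apply,
    Pi.smul_apply]
  simp only [MvPolynomial.smul_eq_C_mul, map_sub, map_mul]
  ring

theorem crossNF_grad (F : ℱ) (q : P3) :
    M.crossNF F (grad (Fin 3) q) = vrot (M.resF F q) := by
  funext i
  fin_cases i
  · exact (hM.crossNF_zero F _).trans (pd_resF F 1 q).symm
  · exact (hM.crossNF_one F _).trans (congrArg Neg.neg (pd_resF F 0 q).symm)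

/-! ### Incidence relations -/

theorem intE_derivative (E : ℰ) (p : ℝ[X]) :
    M.intE E (derivative p) = p.eval (M.len E) - p.eval 0 :=
  intervalIntegral.integral_eq_sub_of_hasDerivAt (fun s _ => p.hasDerivAt s)
    ((Polynomial.continuous _).intervalIntegrable _ _)

/-- The oriented edges of a face form a cycle. This follows from the divergence theorem for
rotationals of polynomials, which separate the vertices. -/
theorem sum_edgesOf_vertex (F : ℱ) (u : 𝒱 → ℝ) :
    ∑ E ∈ M.edgesOf F, M.ωF F E * (u (M.tgt E) - u (M.src E)) = 0 := by
  classical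
  set c : 𝒱 → ℝ := fun V => ∑ E ∈ M.edgesOf F, M.ωF F E *
    ((if M.tgt E = V then 1 else 0) - (if M.src E = V then 1 else 0)) with hc
  have hsum : ∀ u : 𝒱 → ℝ, ∑ E ∈ M.edgesOf F, M.ωF F E * (u (M.tgt E) - u (M.src E)) =
      ∑ V, c V * u V := by
    intro u
    simp only [hc, Finset.sum_mul]
    rw [Finset.sum_comm]
    refine Finset.sum_congr rfl fun E _ => ?_
    simp only [mul_assoc, ← Finset.mul_sum, sub_mul, Finset.sum_sub_distrib, ite_mul, one_mul,
      zero_mul, Finset.sum_ite_eq, Finset.mem_univ, if_true]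
  have hpoly : ∀ p : P3, ∑ V, c V * MvPolynomial.eval (M.pt V) p = 0 := by
    intro p
    rw [← hsum fun V => MvPolynomial.eval (M.pt V) p]
    have h := hM.intF_div F (vrot (M.resF F p))
    rw [div_vrot, ← hM.intFₗ_apply, map_zero] at h
    rw [← neg_eq_zero, h, ← Finset.sum_neg_distrib]
    refine Finset.sum_congr rfl fun E hE => ?_
    rw [hM.dotNFE_vrot, hM.resE_resF hE, ← map_neg, hM.intE_derivative]
    simp only [Polynomial.eval_neg, eval_lineE, edgePt_zero, hM.edgePt_len]
    ring
  have hc0 : ∀ V, c V = 0 := by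
    intro V
    refine coeff_eq_zero_of_forall_poly (fun V => Measure.dirac (M.pt V))
      (Set.finite_range M.pt).isCompact (fun W => ?_) c (fun p => ?_) V
      (U := (M.pt '' {V}ᶜ)ᶜ) (Set.toFinite _).isClosed.isOpen_compl ?_ fun W hW => ?_
    · rw [Measure.dirac_apply' _ (Set.finite_range M.pt).measurableSet.compl]
      simp
    · simp only [integral_dirac]
      exact hpoly p
    · rw [Measure.dirac_apply' _ (Set.toFinite _).measurableSet.compl]
      have : M.pt V ∉ M.pt '' {V}ᶜ := by
        rintro ⟨W, hW, h⟩
        exact hW (hM.pt_injective h)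
      simp [this]
    · rw [Measure.dirac_apply' _ (Set.toFinite _).measurableSet.compl]
      have : M.pt W ∈ M.pt '' {V}ᶜ := ⟨W, hW, rfl⟩
      simp [this]
  rw [hsum]
  simp [hc0]

theorem isCompact_segment (E : ℰ) : IsCompact (segment ℝ (M.pt (M.src E)) (M.pt (M.tgt E))) := by
  rw [hM.segment_eq]
  exact isCompact_Icc.image (continuous_edgePt E)

theorem edge_disjoint_segment {E E' : ℰ} (h : E ≠ E') :
    Disjoint (M.edge E) (segment ℝ (M.pt (M.src E')) (M.pt (M.tgt E'))) := by
  rw [← insert_endpoints_openSegment, Set.disjoint_insert_right, Set.disjoint_insert_right]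
  exact ⟨hM.pt_notMem_edge _ _, hM.pt_notMem_edge _ _, hM.edge_disjoint h⟩

/-- The length measure of an edge. -/
def edgeMeasure (M : MeshData 𝒯 ℱ ℰ 𝒱) (E : ℰ) : Measure R3 :=
  (volume.restrict (Set.Ioc 0 (M.len E))).map (M.edgePt E)

omit hM in
instance (E : ℰ) : IsFiniteMeasure (edgeMeasure M E) := by
  unfold edgeMeasure
  infer_instance

theorem integral_edgeMeasure (E : ℰ) (p : P3) :
    ∫ x, MvPolynomial.eval x p ∂edgeMeasure M E = M.intE E (M.lineE E p) := by
  rw [edgeMeasure, integral_map (continuous_edgePt E).aemeasurable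
    (MvPolynomial.continuous_eval p).aestronglyMeasurable, intE,
    intervalIntegral.integral_of_le (hM.len_pos E).le]
  simp only [eval_lineE]

/-- The boundary of the boundary of a cell vanishes. This follows from the divergence theorem for
curls of polynomials, since polynomials separate the edges. -/
theorem sum_facesOf_edgesOf (T : 𝒯) (g : ℰ → ℝ) :
    ∑ F ∈ M.facesOf T, M.ωT T F * ∑ E ∈ M.edgesOf F, M.ωF F E * g E = 0 := by
  classical
  set c : ℰ → ℝ := fun E => ∑ F ∈ M.facesOf T, M.ωT T F *
    if E ∈ M.edgesOf F then M.ωF F E else 0 with hc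
  have hsum : ∀ g : ℰ → ℝ, ∑ F ∈ M.facesOf T, M.ωT T F * ∑ E ∈ M.edgesOf F, M.ωF F E * g E =
      ∑ E, c E * g E := by
    intro g
    simp only [hc, Finset.sum_mul]
    rw [Finset.sum_comm]
    refine Finset.sum_congr rfl fun F _ => ?_
    simp only [mul_assoc, ← Finset.mul_sum, ite_mul, zero_mul]
    rw [Finset.sum_ite_mem, Finset.univ_inter]
  have hpoly : ∀ r : Fin 3 → P3, ∑ E, c E * M.intE E (M.lineE E (dotc (M.tangent E) r)) = 0 := by
    intro r
    rw [← hsum fun E => M.intE E (M.lineE E (dotc (M.tangent E) r))]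
    have h := hM.intT_div T (curl r)
    rw [div_curl, ← hM.intTₗ_apply, map_zero] at h
    rw [← neg_eq_zero, h, ← Finset.sum_neg_distrib]
    refine Finset.sum_congr rfl fun F _ => ?_
    rw [← hM.div_crossNF, hM.intF_div, ← mul_neg, ← Finset.sum_neg_distrib]
    congr 1
    refine Finset.sum_congr rfl fun E hE => ?_
    rw [hM.dotNFE_crossNF hE, ← intEₗ_apply, ← intEₗ_apply, map_neg, mul_neg]
  have hc0 : ∀ E, c E = 0 := by
    intro E
    -- Testing with the fields `p t_E` weights the edge `E'` by `c E' (t_E' · t_E)`.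
    have hE : c E * (M.tangent E ⬝ᵥ M.tangent E) = 0 := by
      refine coeff_eq_zero_of_forall_poly (edgeMeasure M)
        (isCompact_iUnion fun E => hM.isCompact_segment E) (fun E' => ?_)
        (fun E' => c E' * (M.tangent E' ⬝ᵥ M.tangent E)) (fun p => ?_) E
        (U := (⋃ E' ∈ {E' | E' ≠ E}, segment ℝ (M.pt (M.src E')) (M.pt (M.tgt E')))ᶜ)
        ((Set.toFinite _).isClosed_biUnion fun E' _ =>
          (hM.isCompact_segment E').isClosed).isOpen_compl ?_ fun E' hE' => ?_
      · rw [edgeMeasure, Measure.map_apply (continuous_edgePt E').measurable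
          (isCompact_iUnion fun E => hM.isCompact_segment E).isClosed.measurableSet.compl,
          Measure.restrict_apply' measurableSet_Ioc]
        convert measure_empty (μ := (volume : Measure ℝ))
        rw [Set.eq_empty_iff_forall_notMem]
        rintro s ⟨hs, hs'⟩
        refine hs (Set.mem_iUnion.2 ⟨E', ?_⟩)
        rw [hM.segment_eq]
        exact ⟨s, Set.Ioc_subset_Icc_self hs', rfl⟩
      · rw [← hpoly fun i => M.tangent E i • p]
        refine Finset.sum_congr rfl fun E' _ => ?_
        have : dotc (M.tangent E') (fun i => M.tangent E i • p) =
            (M.tangent E' ⬝ᵥ M.tangent E) • p := by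
          simp only [dotc, dotProduct, Finset.sum_smul, smul_smul]
        rw [this, hM.integral_edgeMeasure, map_smul, ← intEₗ_apply, ← intEₗ_apply, map_smul,
          smul_eq_mul, mul_assoc]
      · rw [edgeMeasure, Measure.map_apply (continuous_edgePt E).measurable
          ((Set.toFinite _).isClosed_biUnion fun E' _ =>
          (hM.isCompact_segment E').isClosed).measurableSet.compl,
          Measure.restrict_apply' measurableSet_Ioc]
        have hsub : Set.Ioo 0 (M.len E) ⊆ M.edgePt E ⁻¹'
            (⋃ E' ∈ {E' | E' ≠ E}, segment ℝ (M.pt (M.src E')) (M.pt (M.tgt E')))ᶜ ∩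
              Set.Ioc 0 (M.len E) := by
          intro s hs
          refine ⟨?_, Set.Ioo_subset_Ioc_self hs⟩
          rw [Set.mem_preimage, Set.mem_compl_iff, Set.mem_iUnion₂]
          rintro ⟨E', hE', h⟩
          refine Set.disjoint_left.1 (hM.edge_disjoint_segment (Ne.symm hE')) ?_ h
          rw [hM.edge_eq]
          exact ⟨s, hs, rfl⟩
        refine (lt_of_lt_of_le ?_ (measure_mono hsub)).ne'
        rw [Real.volume_Ioo, sub_zero]
        exact ENNReal.ofReal_pos.2 (hM.len_pos E)
      · rw [edgeMeasure, Measure.map_apply (continuous_edgePt E').measurable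
          ((Set.toFinite _).isClosed_biUnion fun E' _ =>
          (hM.isCompact_segment E').isClosed).measurableSet.compl,
          Measure.restrict_apply' measurableSet_Ioc]
        convert measure_empty (μ := (volume : Measure ℝ))
        rw [Set.eq_empty_iff_forall_notMem]
        rintro s ⟨hs, hs'⟩
        refine hs (Set.mem_iUnion₂.2 ⟨E', hE', ?_⟩)
        rw [hM.segment_eq]
        exact ⟨s, Set.Ioc_subset_Icc_self hs', rfl⟩
    rwa [hM.tangent_dot_self, mul_one] at hE
  rw [hsum]
  simp [hc0]

open Classical in
/-- No combination of cells has a vanishing boundary: otherwise, by the divergence theorem, a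
non-zero function that is constant on the cells would be orthogonal to all the polynomials. -/
theorem eq_zero_of_sum_cells (a : 𝒯 → ℝ)
    (h : ∀ F, ∑ T, (if F ∈ M.facesOf T then a T * M.ωT T F else 0) = 0) : a = 0 := by
  have hpoly : ∀ p : P3, ∑ T, a T * M.intT T p = 0 := by
    intro p
    obtain ⟨m, hm⟩ := exists_mem_Poly p
    obtain ⟨w, -, rfl⟩ := exists_Rc_div_eq (0 : R3) (m := m + 1) (by rwa [add_sub_cancel_right])
    have h1 : ∀ T, a T * M.intT T (div w) = ∑ F,
        (if F ∈ M.facesOf T then a T * M.ωT T F else 0) * M.intF F (M.dotNF F w) := by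
      intro T
      simp only [ite_mul, zero_mul]
      rw [hM.intT_div, Finset.mul_sum, Finset.sum_ite_mem, Finset.univ_inter]
      exact Finset.sum_congr rfl fun F _ => by ring
    rw [Finset.sum_congr rfl fun T _ => h1 T, Finset.sum_comm]
    refine Finset.sum_eq_zero fun F _ => ?_
    rw [← Finset.sum_mul, h, zero_mul]
  have hfin : ∀ T, IsFiniteMeasure (volume.restrict (M.cell T)) := fun T =>
    isFiniteMeasure_restrict.2 (hM.cell_bounded T).measure_lt_top.ne
  funext T
  refine coeff_eq_zero_of_forall_poly (fun T => volume.restrict (M.cell T))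
    (isCompact_iUnion fun T => (hM.cell_bounded T).isCompact_closure) (fun T => ?_) a hpoly T
    (hM.cell_open T) ?_ fun T' hT' => ?_
  · rw [Measure.restrict_apply' (hM.cell_open T).measurableSet]
    convert measure_empty (μ := (volume : Measure R3))
    rw [Set.eq_empty_iff_forall_notMem]
    rintro x ⟨hx, hx'⟩
    exact hx (Set.mem_iUnion.2 ⟨T, subset_closure hx'⟩)
  · rw [Measure.restrict_apply_self]
    exact ((hM.cell_open T).measure_pos volume ⟨_, hM.center_mem T⟩).ne'
  · rw [Measure.restrict_apply' (hM.cell_open T').measurableSet]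
    have := hM.disjoint (i := Sum.inl T) (j := Sum.inl T') (by simpa using hT'.symm)
    change Disjoint (M.cell T) (M.cell T') at this
    rw [this.inter_eq, measure_empty]

/-! ### Connectedness of the edge skeleton -/

omit hM in
/-- If a connected set is a finite union of non-empty closed sets, a labelling of these sets for
which two sets that meet have the same label is constant. -/
theorem _root_.StokesComplex.eq_of_isPreconnected_iUnion {X J L : Type*}
    [TopologicalSpace X] [Finite J]
    {Z : J → Set X} (hZ : ∀ j, IsClosed (Z j)) (hZn : ∀ j, (Z j).Nonempty)
    (hc : IsPreconnected (⋃ j, Z j)) {f : J → L}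
    (hf : ∀ i j, (Z i ∩ Z j).Nonempty → f i = f j) (i j : J) : f i = f j := by
  by_contra hne
  have hA : IsClosed (⋃ l ∈ {l | f l = f i}, Z l) :=
    (Set.toFinite _).isClosed_biUnion fun l _ => hZ l
  have hB : IsClosed (⋃ l ∈ {l | f l ≠ f i}, Z l) :=
    (Set.toFinite _).isClosed_biUnion fun l _ => hZ l
  obtain ⟨xi, hxi⟩ := hZn i
  obtain ⟨xj, hxj⟩ := hZn j
  obtain ⟨x, -, hxA, hxB⟩ := isPreconnected_closed_iff.1 hc _ _ hA hB
    (by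
      intro x hx
      obtain ⟨l, hl⟩ := Set.mem_iUnion.1 hx
      by_cases h : f l = f i
      · exact Or.inl (Set.mem_iUnion₂.2 ⟨l, h, hl⟩)
      · exact Or.inr (Set.mem_iUnion₂.2 ⟨l, h, hl⟩))
    ⟨xi, Set.mem_iUnion.2 ⟨i, hxi⟩, Set.mem_iUnion₂.2 ⟨i, rfl, hxi⟩⟩
    ⟨xj, Set.mem_iUnion.2 ⟨j, hxj⟩, Set.mem_iUnion₂.2 ⟨j, Ne.symm hne, hxj⟩⟩
  obtain ⟨a, ha, hxa⟩ := Set.mem_iUnion₂.1 hxA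
  obtain ⟨b, hb, hxb⟩ := Set.mem_iUnion₂.1 hxB
  exact hb ((hf b a ⟨x, hxb, hxa⟩).trans ha)

omit hM in
/-- The boundary of a bounded open convex set is homeomorphic to a sphere. -/
theorem _root_.StokesComplex.isPreconnected_frontier_of_convex {n : ℕ}
    {D : Set (Fin (n + 2) → ℝ)} (hc : Convex ℝ D)
    (ho : IsOpen D) (hn : D.Nonempty) (hb : Bornology.IsBounded D) :
    IsPreconnected (frontier D) := by
  obtain ⟨h, -, -, hfr⟩ := exists_homeomorph_image_interior_closure_frontier_eq_unitBall
    hc (by rwa [ho.interior_eq]) hb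
  rw [← h.isPreconnected_image, hfr]
  refine isPreconnected_sphere ?_ _ _
  rw [rank_fin_fun]
  exact_mod_cast (by omega : 1 < n + 2)

/-- A labelling of the vertices that is constant along the edges is constant along the edges of
each face. -/
theorem label_face {L : Type*} {u : 𝒱 → L} (hu : ∀ E, u (M.src E) = u (M.tgt E)) (F : ℱ)
    {E E' : ℰ} (hE : E ∈ M.edgesOf F) (hE' : E' ∈ M.edgesOf F) :
    u (M.src E) = u (M.src E') := by
  have hc : IsPreconnected (⋃ E : {E // E ∈ M.edgesOf F},
      segment ℝ (M.pt (M.src E.1)) (M.pt (M.tgt E.1))) := by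
    rw [Set.iUnion_subtype (fun E => E ∈ M.edgesOf F)
      (fun E => segment ℝ (M.pt (M.src E.1)) (M.pt (M.tgt E.1))), ← hM.face_bdry F]
    exact (isPreconnected_frontier_of_convex (hM.face_convex F) (hM.face_open F)
      ⟨0, hM.zero_mem_faceDom F⟩ (hM.face_bounded F)).image _ (continuous_faceMap F).continuousOn
  refine eq_of_isPreconnected_iUnion (J := {E // E ∈ M.edgesOf F})
    (fun E => (hM.isCompact_segment E.1).isClosed) (fun E => ⟨_, left_mem_segment ℝ _ _⟩) hc
    (f := fun E => u (M.src E.1)) ?_ ⟨E, hE⟩ ⟨E', hE'⟩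
  rintro ⟨E, hEF⟩ ⟨E', hEF'⟩ ⟨x, hx, hx'⟩
  by_cases hEE : E = E'
  · subst hEE
    rfl
  have hend : ∀ {A B : ℰ}, A ≠ B → x ∈ segment ℝ (M.pt (M.src A)) (M.pt (M.tgt A)) →
      x ∈ segment ℝ (M.pt (M.src B)) (M.pt (M.tgt B)) → ∃ V, x = M.pt V ∧ u V = u (M.src A) := by
    intro A B hAB hA hB
    rw [← insert_endpoints_openSegment] at hA
    rcases hA with hA | hA | hA
    · exact ⟨_, hA, rfl⟩
    · exact ⟨_, hA, (hu A).symm⟩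
    · exact absurd hB (Set.disjoint_left.1 (hM.edge_disjoint_segment hAB) hA)
  obtain ⟨V, hV, hV'⟩ := hend hEE hx hx'
  obtain ⟨W, hW, hW'⟩ := hend (Ne.symm hEE) hx' hx
  have : V = W := hM.pt_injective (hV.symm.trans hW)
  dsimp only
  rw [← hV', ← hW', this]

omit hM in
theorem _root_.StokesComplex.frontier_nonempty_of_isBounded {n : ℕ} {D : Set (Fin (n + 1) → ℝ)}
    (hn : D.Nonempty) (hb : Bornology.IsBounded D) : (frontier D).Nonempty := by
  refine nonempty_frontier_iff.2 ⟨hn, fun h => ?_⟩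
  rw [h] at hb
  exact NormedSpace.unbounded_univ ℝ (Fin (n + 1) → ℝ) hb

theorem exists_mem_edgesOf (F : ℱ) : ∃ E, E ∈ M.edgesOf F := by
  obtain ⟨x, hx⟩ := frontier_nonempty_of_isBounded ⟨0, hM.zero_mem_faceDom F⟩ (hM.face_bounded F)
  have : M.faceMap F x ∈ M.faceBdry F := ⟨x, hx, rfl⟩
  rw [hM.face_bdry F] at this
  obtain ⟨E, hE, -⟩ := Set.mem_iUnion₂.1 this
  exact ⟨E, hE⟩

theorem exists_mem_facesOf (T : 𝒯) : ∃ F, F ∈ M.facesOf T := by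
  obtain ⟨x, hx⟩ := frontier_nonempty_of_isBounded ⟨_, hM.center_mem T⟩ (hM.cell_bounded T)
  rw [hM.cell_bdry T] at hx
  obtain ⟨F, hF, -⟩ := Set.mem_iUnion₂.1 hx
  exact ⟨F, hF⟩

theorem closure_face_eq (F : ℱ) : closure (M.face F) = M.face F ∪ M.faceBdry F := by
  rw [hM.closure_face, closure_eq_self_union_frontier, Set.image_union]
  rfl

/-- A point of the relative boundary of a face lies on an open edge or is a vertex. -/
theorem mem_faceBdry {F : ℱ} {x : R3} (hx : x ∈ M.faceBdry F) :
    ∃ E ∈ M.edgesOf F, x ∈ M.edge E ∨ x = M.pt (M.src E) ∨ x = M.pt (M.tgt E) := by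
  rw [hM.face_bdry F] at hx
  obtain ⟨E, hE, hx⟩ := Set.mem_iUnion₂.1 hx
  rw [← insert_endpoints_openSegment] at hx
  rcases hx with hx | hx | hx
  · exact ⟨E, hE, Or.inr (Or.inl hx)⟩
  · exact ⟨E, hE, Or.inr (Or.inr hx)⟩
  · exact ⟨E, hE, Or.inl hx⟩

/-- Two faces that touch have the same label. -/
theorem label_closure_face {L : Type*} {u : 𝒱 → L} (hu : ∀ E, u (M.src E) = u (M.tgt E))
    {l : ℱ → L} (hl : ∀ F, ∀ E ∈ M.edgesOf F, u (M.src E) = l F) {F G : ℱ}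
    (h : (closure (M.face F) ∩ closure (M.face G)).Nonempty) : l F = l G := by
  obtain ⟨x, hxF, hxG⟩ := h
  have hdisj : ∀ {F G : ℱ}, x ∈ M.face F → x ∈ closure (M.face G) → F = G := by
    intro F G hF hG
    by_contra hne
    rw [hM.closure_face_eq] at hG
    rcases hG with hG | hG
    · exact Set.disjoint_left.1 (hM.disjoint (i := Sum.inr (Sum.inl F)) (j := Sum.inr (Sum.inl G))
        (by simpa using hne)) hF hG
    obtain ⟨E, -, hE | hE | hE⟩ := hM.mem_faceBdry hG
    · exact Set.disjoint_left.1 (hM.disjoint (i := Sum.inr (Sum.inl F))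
        (j := Sum.inr (Sum.inr (Sum.inl E))) (by simp)) hF hE
    · exact Set.disjoint_left.1 (hM.disjoint (i := Sum.inr (Sum.inl F))
        (j := Sum.inr (Sum.inr (Sum.inr _))) (by simp)) hF hE
    · exact Set.disjoint_left.1 (hM.disjoint (i := Sum.inr (Sum.inl F))
        (j := Sum.inr (Sum.inr (Sum.inr _))) (by simp)) hF hE
  by_cases hF : x ∈ M.face F
  · rw [hdisj hF hxG]
  by_cases hG : x ∈ M.face G
  · rw [hdisj hG hxF]
  rw [hM.closure_face_eq] at hxF hxG
  obtain ⟨E, hE, hxE⟩ := hM.mem_faceBdry (hxF.resolve_left hF)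
  obtain ⟨E', hE', hxE'⟩ := hM.mem_faceBdry (hxG.resolve_left hG)
  rw [← hl F E hE, ← hl G E' hE']
  have hvert : ∀ {A : ℰ} {V : 𝒱}, x ∈ M.edge A → x ≠ M.pt V := fun hA hV =>
    hM.pt_notMem_edge _ _ (hV ▸ hA)
  have hpt : ∀ {V W : 𝒱}, x = M.pt V → x = M.pt W → V = W := fun hV hW =>
    hM.pt_injective (hV.symm.trans hW)
  rcases hxE with h1 | h1 | h1 <;> rcases hxE' with h2 | h2 | h2
  · by_contra hne
    exact Set.disjoint_left.1 (hM.edge_disjoint fun h => hne (by rw [h])) h1 h2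
  · exact absurd h2 (hvert h1)
  · exact absurd h2 (hvert h1)
  · exact absurd h1 (hvert h2)
  · rw [hpt h1 h2]
  · rw [hpt h1 h2, hu]
  · exact absurd h1 (hvert h2)
  · rw [hu, hpt h1 h2]
  · rw [hu, hpt h1 h2, hu]

/-- The edge skeleton of a connected mesh is connected: a labelling of the vertices that is constant
along the edges is constant. The label is propagated along the boundary of each face, along the
boundary of each cell, and from cell to cell. -/
theorem label_const {L : Type*} (hΩ : IsConnected Ω) {u : 𝒱 → L}
    (hu : ∀ E, u (M.src E) = u (M.tgt E)) (V W : 𝒱) : u V = u W := by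
  choose eF heF using hM.exists_mem_edgesOf
  choose fT hfT using hM.exists_mem_facesOf
  set l : ℱ → L := fun F => u (M.src (eF F)) with hldef
  have hl : ∀ F, ∀ E ∈ M.edgesOf F, u (M.src E) = l F := fun F E hE =>
    hM.label_face hu F hE (heF F)
  have htouch := fun {F G : ℱ} => hM.label_closure_face hu hl (F := F) (G := G)
  have hcell : ∀ T, ∀ F ∈ M.facesOf T, l F = l (fT T) := by
    intro T F hF
    have hc : IsPreconnected (⋃ F : {F // F ∈ M.facesOf T}, closure (M.face F.1)) := by
      rw [Set.iUnion_subtype (fun F => F ∈ M.facesOf T) (fun F => closure (M.face F.1)),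
        ← hM.cell_bdry T]
      exact isPreconnected_frontier_of_convex (hM.cell_convex T) (hM.cell_open T)
        ⟨_, hM.center_mem T⟩ (hM.cell_bounded T)
    refine eq_of_isPreconnected_iUnion (J := {F // F ∈ M.facesOf T}) (fun F => isClosed_closure)
      (fun F => ⟨M.origin F.1, subset_closure (hM.origin_mem F.1)⟩) hc (f := fun F => l F.1)
      (fun F G h => htouch h) ⟨F, hF⟩ ⟨fT T, hfT T⟩
  have hcells : ∀ T T', l (fT T) = l (fT T') := by
    refine eq_of_isPreconnected_iUnion (Z := fun T => closure (M.cell T))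
      (fun T => isClosed_closure) (fun T => ⟨_, subset_closure (hM.center_mem T)⟩)
      (by rw [← hM.cover]; exact hΩ.isPreconnected.closure) (f := fun T => l (fT T)) ?_
    rintro T T' ⟨x, hx, hx'⟩
    by_cases hTT : T = T'
    · rw [hTT]
    have hdisj : Disjoint (M.cell T) (M.cell T') :=
      hM.disjoint (i := Sum.inl T) (j := Sum.inl T') (by simpa using hTT)
    have hfr : x ∈ frontier (M.cell T) := by
      refine ⟨hx, fun h => ?_⟩
      rw [(hM.cell_open T).interior_eq] at h
      exact Set.disjoint_left.1 (hdisj.closure_right (hM.cell_open T)) h hx'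
    have hfr' : x ∈ frontier (M.cell T') := by
      refine ⟨hx', fun h => ?_⟩
      rw [(hM.cell_open T').interior_eq] at h
      exact Set.disjoint_left.1 (hdisj.closure_left (hM.cell_open T')) hx h
    rw [hM.cell_bdry] at hfr hfr'
    obtain ⟨F, hF, hxF⟩ := Set.mem_iUnion₂.1 hfr
    obtain ⟨F', hF', hxF'⟩ := Set.mem_iUnion₂.1 hfr'
    rw [← hcell T F hF, ← hcell T' F' hF', htouch ⟨x, hxF, hxF'⟩]
  have hall : ∀ V, ∃ T, u V = l (fT T) := by
    intro V
    obtain ⟨E, hE⟩ := hM.vertex_used V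
    obtain ⟨F, hF⟩ := hM.edge_used E
    obtain ⟨T, hT⟩ := hM.face_used F
    refine ⟨T, ?_⟩
    rw [← hcell T F hT, ← hl F E hF]
    rcases hE with rfl | rfl
    · rfl
    · exact (hu E).symm
  obtain ⟨T, hT⟩ := hall V
  obtain ⟨T', hT'⟩ := hall W
  rw [hT, hT', hcells T T']

end IsPolyhedralMesh

end MeshData

/-! ### Bilinear forms and linear versions of the operators -/

section Forms

variable {A X Y Z : Type*} [CommRing A] [Algebra ℝ A] [AddCommGroup X] [Module ℝ X]
  [AddCommGroup Y] [Module ℝ Y] [AddCommGroup Z] [Module ℝ Z]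

/-- The bilinear form `(z, x) ↦ I (f z * g x)`. -/
def mulForm (I : A →ₗ[ℝ] ℝ) (f : Z →ₗ[ℝ] A) (g : X →ₗ[ℝ] A) : Z →ₗ[ℝ] X →ₗ[ℝ] ℝ :=
  ((LinearMap.mul ℝ A).compl₁₂ f g).compr₂ I

@[simp] theorem mulForm_apply (I : A →ₗ[ℝ] ℝ) (f : Z →ₗ[ℝ] A) (g : X →ₗ[ℝ] A) (z : Z) (x : X) :
    mulForm I f g z x = I (f z * g x) := rfl

/-- The bilinear form `(z, x) ↦ I (f z ⬝ᵥ g x)`. -/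
def dotForm {κ : Type*} [Fintype κ] (I : A →ₗ[ℝ] ℝ) (f : Z →ₗ[ℝ] κ → A) (g : X →ₗ[ℝ] κ → A) :
    Z →ₗ[ℝ] X →ₗ[ℝ] ℝ :=
  ∑ i, mulForm I ((LinearMap.proj i).comp f) ((LinearMap.proj i).comp g)

@[simp] theorem dotForm_apply {κ : Type*} [Fintype κ] (I : A →ₗ[ℝ] ℝ) (f : Z →ₗ[ℝ] κ → A)
    (g : X →ₗ[ℝ] κ → A) (z : Z) (x : X) : dotForm I f g z x = I (f z ⬝ᵥ g x) := by
  simp [dotForm, dotProduct]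

/-- The bilinear form `(z, x) ↦ I (f z : g x)`. -/
def tdotForm {ι κ : Type*} [Fintype ι] [Fintype κ] (I : A →ₗ[ℝ] ℝ) (f : Z →ₗ[ℝ] ι → κ → A)
    (g : X →ₗ[ℝ] ι → κ → A) : Z →ₗ[ℝ] X →ₗ[ℝ] ℝ :=
  ∑ i, dotForm I ((LinearMap.proj i).comp f) ((LinearMap.proj i).comp g)

@[simp] theorem tdotForm_apply {ι κ : Type*} [Fintype ι] [Fintype κ] (I : A →ₗ[ℝ] ℝ)
    (f : Z →ₗ[ℝ] ι → κ → A) (g : X →ₗ[ℝ] ι → κ → A) (z : Z) (x : X) :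
    tdotForm I f g z x = I (tdot (f z) (g x)) := by
  simp [tdotForm, tdot, dotProduct]

/-- The variant of `exists_solution_operator` in which the solution is sought in `S` itself. -/
theorem exists_riesz_operator (B : Y →ₗ[ℝ] Y →ₗ[ℝ] ℝ) (S : Submodule ℝ Y)
    [FiniteDimensional ℝ S] (hpos : ∀ y ∈ S, B y y = 0 → y = 0) (l : Z →ₗ[ℝ] Y →ₗ[ℝ] ℝ) :
    ∃ R : Z →ₗ[ℝ] Y, ∀ z y, (y ∈ S ∧ ∀ x ∈ S, B y x = l z x) ↔ y = R z := by
  have h := exists_solution_operator B S LinearMap.id hpos l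
    (fun z x _ h => by rw [show x = 0 from h, map_zero])
  rwa [Submodule.map_id] at h

/-- `dotc a` as a linear map. -/
def dotcₗ {ι A : Type*} [Fintype ι] [AddCommGroup A] [Module ℝ A] (a : ι → ℝ) :
    (ι → A) →ₗ[ℝ] A := ∑ i, a i • LinearMap.proj i

@[simp] theorem dotcₗ_apply {ι A : Type*} [Fintype ι] [AddCommGroup A] [Module ℝ A] (a : ι → ℝ)
    (v : ι → A) : dotcₗ a v = dotc a v := by
  simp [dotcₗ, dotc]

/-- `rot` as a linear map. -/
def rotₗ : (Fin 2 → P2) →ₗ[ℝ] P2 :=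
  (pd 0).comp (LinearMap.proj 1) - (pd 1).comp (LinearMap.proj 0)

@[simp] theorem rotₗ_apply (w : Fin 2 → P2) : rotₗ w = rot w := rfl

/-- `tdiv` as a linear map. -/
def tdivₗ {σ ι : Type*} [Fintype σ] :
    (ι → σ → MvPolynomial σ ℝ) →ₗ[ℝ] (ι → MvPolynomial σ ℝ) :=
  LinearMap.pi fun i => div.comp (LinearMap.proj i)

@[simp] theorem tdivₗ_apply {σ ι : Type*} [Fintype σ] (W : ι → σ → MvPolynomial σ ℝ) :
    tdivₗ W = tdiv W := rfl

/-- The trace of a matrix of polynomials as a linear map. -/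
def traceₗ {σ : Type*} [Fintype σ] : (σ → σ → MvPolynomial σ ℝ) →ₗ[ℝ] MvPolynomial σ ℝ :=
  ∑ i, (LinearMap.proj (R := ℝ) (φ := fun _ : σ => MvPolynomial σ ℝ) i).comp (LinearMap.proj i)

@[simp] theorem traceₗ_apply {σ : Type*} [Fintype σ] (W : σ → σ → MvPolynomial σ ℝ) :
    traceₗ W = ∑ i, W i i := by
  simp [traceₗ]

instance {σ : Type*} [Finite σ] (y : σ → MvPolynomial σ ℝ) (m : ℤ) :
    FiniteDimensional ℝ (Rc y m) := by
  unfold Rc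
  infer_instance

instance (m : ℤ) : FiniteDimensional ℝ (RolyF m) := by
  unfold RolyF
  infer_instance

instance (m : ℤ) : FiniteDimensional ℝ (RolyT m) := by
  unfold RolyT
  infer_instance

instance {κ W : Type*} [Finite κ] [AddCommGroup W] [Module ℝ W] (S : Submodule ℝ W)
    [FiniteDimensional ℝ S] :
    FiniteDimensional ℝ (Submodule.pi (Set.univ : Set κ) fun _ => S) := by
  have := Fintype.ofFinite κ
  have h : Submodule.pi (Set.univ : Set κ) (fun _ => S) =
      LinearMap.range (LinearMap.pi fun i => S.subtype.comp (LinearMap.proj (R := ℝ)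
        (φ := fun _ : κ => S) i)) := by
    ext v
    rw [Submodule.mem_pi, LinearMap.mem_range]
    exact ⟨fun hv => ⟨fun i => ⟨v i, hv i trivial⟩, rfl⟩, by rintro ⟨u, rfl⟩ i -; exact (u i).2⟩
  rw [h]
  infer_instance

instance {X₁ X₂ : Type*} [AddCommGroup X₁] [Module ℝ X₁] [AddCommGroup X₂] [Module ℝ X₂]
    (S₁ : Submodule ℝ X₁) (S₂ : Submodule ℝ X₂) [FiniteDimensional ℝ S₁]
    [FiniteDimensional ℝ S₂] : FiniteDimensional ℝ (S₁.prod S₂) :=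
  Module.Finite.iff_fg.2 ((Module.Finite.iff_fg.1 ‹_›).prod (Module.Finite.iff_fg.1 ‹_›))

end Forms

theorem map_div_Rc {σ : Type*} [Fintype σ] [Nonempty σ] (a : σ → ℝ) (m : ℤ) :
    (Rc (posV a) m).map div = Poly σ (m - 1) := by
  refine le_antisymm ?_ fun p hp => ?_
  · rintro _ ⟨w, hw, rfl⟩
    exact div_mem (mem_VPoly_iff.1 (Rc_le a m hw))
  · obtain ⟨w, hw, rfl⟩ := exists_Rc_div_eq a hp
    exact ⟨w, hw, rfl⟩

/-! ### Edge polynomials -/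

/-- A polynomial that vanishes at the two end points of `[0, L]` is divisible by `X (L - X)`. -/
theorem exists_eq_mul_of_eval_eq_zero {L : ℝ} (hL : 0 < L) {m : ℤ} (hm : -1 ≤ m) {p : ℝ[X]}
    (hp : p ∈ PolyE (m + 2)) (h0 : p.eval 0 = 0) (h1 : p.eval L = 0) :
    ∃ r ∈ PolyE m, p = X * (C L - X) * r := by
  obtain ⟨q, rfl⟩ := (Polynomial.X_dvd_iff (f := p)).2 (by rwa [Polynomial.coeff_zero_eq_eval_zero])
  have hq : q.IsRoot L := by
    rw [eval_mul, eval_X] at h1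
    exact (mul_eq_zero.1 h1).resolve_left hL.ne'
  obtain ⟨r, rfl⟩ := Polynomial.dvd_iff_isRoot.2 hq
  refine ⟨-r, ?_, by ring⟩
  by_cases hr : r = 0
  · simp [hr]
  refine Submodule.neg_mem _ ?_
  rw [mem_PolyE_iff hm]
  intro d hd
  have h2 := Polynomial.le_natDegree_of_mem_supp d hd
  have hne : X * ((X - C L) * r) ≠ 0 :=
    mul_ne_zero X_ne_zero (mul_ne_zero (X_sub_C_ne_zero L) hr)
  have h3 := (mem_PolyE_iff (by omega)).1 hp _ (Polynomial.natDegree_mem_support_of_nonzero hne)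
  rw [natDegree_mul X_ne_zero (mul_ne_zero (X_sub_C_ne_zero L) hr), natDegree_X,
    natDegree_mul (X_sub_C_ne_zero L) hr, natDegree_X_sub_C] at h3
  push_cast at h3
  omega

/-- The affine polynomial with the values `z.2.1` at `0` and `z.2.2` at `L`. The component `z.1` is
not used: it makes the data of an edge polynomial the source of the map. -/
def affineInterp (L : ℝ) : ℝ[X] × ℝ × ℝ →ₗ[ℝ] ℝ[X] where
  toFun z := C z.2.1 + C ((z.2.2 - z.2.1) / L) * X
  map_add' z w := by
    simp only [Prod.snd_add, Prod.fst_add, C_add, add_sub_add_comm, add_div]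
    ring
  map_smul' c z := by
    simp only [Prod.smul_snd, Prod.smul_fst, smul_eq_mul, ← mul_sub, mul_div_assoc, C_mul,
      RingHom.id_apply, Polynomial.smul_eq_C_mul]
    ring

theorem affineInterp_apply (L : ℝ) (z : ℝ[X] × ℝ × ℝ) :
    affineInterp L z = C z.2.1 + C ((z.2.2 - z.2.1) / L) * X := rfl

theorem affineInterp_mem (L : ℝ) (z : ℝ[X] × ℝ × ℝ) : affineInterp L z ∈ PolyE 1 := by
  rw [affineInterp_apply]
  exact Submodule.add_mem _ (C_mem_PolyE zero_le_one _)
    (by simpa using PolyE_mul (C_mem_PolyE le_rfl _) X_mem_PolyE)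

theorem eval_zero_affineInterp (L : ℝ) (z : ℝ[X] × ℝ × ℝ) :
    (affineInterp L z).eval 0 = z.2.1 := by
  simp [affineInterp_apply]

theorem eval_affineInterp {L : ℝ} (hL : L ≠ 0) (z : ℝ[X] × ℝ × ℝ) :
    (affineInterp L z).eval L = z.2.2 := by
  rw [affineInterp_apply, eval_add, eval_mul, eval_C, eval_C, eval_X, div_mul_cancel₀ _ hL]
  ring

namespace MeshData

variable {𝒯 ℱ ℰ 𝒱 : Type*} [Fintype 𝒯] [Fintype ℱ] [Fintype ℰ] [Fintype 𝒱]
  {M : MeshData 𝒯 ℱ ℰ 𝒱} {Ω : Set R3}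

/-- `dotNFE` as a linear map. -/
def dotNFEₗ (M : MeshData 𝒯 ℱ ℰ 𝒱) (F : ℱ) (E : ℰ) : (Fin 2 → P2) →ₗ[ℝ] ℝ[X] :=
  (M.resE F E).toLinearMap.comp (dotcₗ (M.tang F (M.normalFE F E)))

@[simp] theorem dotNFEₗ_apply (F : ℱ) (E : ℰ) (w : Fin 2 → P2) :
    M.dotNFEₗ F E w = M.dotNFE F E w := by
  simp [dotNFEₗ, dotNFE]

/-- `dotTE` as a linear map. -/
def dotTEₗ (M : MeshData 𝒯 ℱ ℰ 𝒱) (F : ℱ) (E : ℰ) : (Fin 2 → P2) →ₗ[ℝ] ℝ[X] :=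
  (M.resE F E).toLinearMap.comp (dotcₗ (M.tang F (M.tangent E)))

@[simp] theorem dotTEₗ_apply (F : ℱ) (E : ℰ) (w : Fin 2 → P2) :
    M.dotTEₗ F E w = M.dotTE F E w := by
  simp [dotTEₗ, dotTE]

/-- `dotNF` as a linear map. -/
def dotNFₗ (M : MeshData 𝒯 ℱ ℰ 𝒱) (F : ℱ) : (Fin 3 → P3) →ₗ[ℝ] P2 :=
  (M.resF F).toLinearMap.comp (dotcₗ (M.normal F))

@[simp] theorem dotNFₗ_apply (F : ℱ) (w : Fin 3 → P3) : M.dotNFₗ F w = M.dotNF F w := by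
  simp [dotNFₗ, dotNF]

/-- `crossNF` as a linear map. -/
def crossNFₗ (M : MeshData 𝒯 ℱ ℰ 𝒱) (F : ℱ) : (Fin 3 → P3) →ₗ[ℝ] (Fin 2 → P2) :=
  LinearMap.pi fun i => (M.resF F).toLinearMap.comp ((dotcₗ (M.frame F i)).comp
    ((crossProduct.flip fun j => MvPolynomial.C (M.normal F j)).restrictScalars ℝ))

@[simp] theorem crossNFₗ_apply (F : ℱ) (r : Fin 3 → P3) : M.crossNFₗ F r = M.crossNF F r := by
  funext i
  simp [crossNFₗ, crossNF]

/-- `crossTE` as a linear map. -/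
def crossTEₗ (M : MeshData 𝒯 ℱ ℰ 𝒱) (E : ℰ) : (Fin 3 → ℝ[X]) →ₗ[ℝ] (Fin 3 → ℝ[X]) :=
  (crossProduct.flip fun j => Polynomial.C (M.tangent E j)).restrictScalars ℝ

@[simp] theorem crossTEₗ_apply (E : ℰ) (v : Fin 3 → ℝ[X]) :
    M.crossTEₗ E v = M.crossTE E v := by
  simp [crossTEₗ, crossTE]

namespace IsPolyhedralMesh

variable (hM : M.IsPolyhedralMesh Ω)
include hM

theorem eq_zero_of_intF_sq (F : ℱ) {κ : Type*} [Fintype κ] {v : κ → P2}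
    (h : M.intF F (∑ i, v i * v i) = 0) : v = 0 :=
  eq_zero_of_integral_sq_eq_zero (hM.face_open F) ⟨_, hM.zero_mem_faceDom F⟩ (hM.face_bounded F) h

theorem eq_zero_of_intT_sq (T : 𝒯) {κ : Type*} [Fintype κ] {v : κ → P3}
    (h : M.intT T (∑ i, v i * v i) = 0) : v = 0 :=
  eq_zero_of_integral_sq_eq_zero (hM.cell_open T) ⟨_, hM.center_mem T⟩ (hM.cell_bounded T) h

theorem eq_zero_of_intF_mul_self (F : ℱ) {p : P2} (h : M.intF F (p * p) = 0) : p = 0 :=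
  congrFun (hM.eq_zero_of_intF_sq F (κ := Fin 1) (v := fun _ => p) (by simpa using h)) 0

theorem eq_zero_of_intF_tdot_self (F : ℱ) {ι κ : Type*} [Fintype ι] [Fintype κ]
    {J : ι → κ → P2} (h : M.intF F (tdot J J) = 0) : J = 0 := by
  have := hM.eq_zero_of_intF_sq F (v := fun i : ι × κ => J i.1 i.2)
    (by rwa [Fintype.sum_prod_type])
  funext i j
  exact congrFun this (i, j)

theorem eq_zero_of_intT_tdot_self (T : 𝒯) {ι κ : Type*} [Fintype ι] [Fintype κ]
    {J : ι → κ → P3} (h : M.intT T (tdot J J) = 0) : J = 0 := by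
  have := hM.eq_zero_of_intT_sq T (v := fun i : ι × κ => J i.1 i.2)
    (by rwa [Fintype.sum_prod_type])
  funext i j
  exact congrFun this (i, j)

theorem eq_zero_of_intE_weighted (E : ℰ) {p : ℝ[X]}
    (h : M.intE E (X * (C (M.len E) - X) * p * p) = 0) : p = 0 := by
  by_contra hp
  refine absurd h (ne_of_gt ?_)
  have hne : X * (C (M.len E) - X) * p * p ≠ 0 := by
    refine mul_ne_zero (mul_ne_zero (mul_ne_zero X_ne_zero ?_) hp) hp
    rw [← neg_sub, neg_ne_zero]
    exact X_sub_C_ne_zero _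
  have hnn : ∀ s ∈ Set.Ioc 0 (M.len E), 0 ≤ (X * (C (M.len E) - X) * p * p).eval s := by
    intro s hs
    simp only [eval_mul, eval_X, eval_sub, eval_C, mul_assoc]
    exact mul_nonneg hs.1.le (mul_nonneg (sub_nonneg.2 hs.2) (mul_self_nonneg _))
  -- Finitely many roots cannot fill the edge.
  obtain ⟨s, hs, hs'⟩ := (Set.Ioo_infinite (hM.len_pos E)).exists_notMem_finset
    (X * (C (M.len E) - X) * p * p).roots.toFinset
  refine intervalIntegral.integral_pos (hM.len_pos E) (Polynomial.continuous _).continuousOn hnn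
    ⟨s, Set.Ioo_subset_Icc_self hs, lt_of_le_of_ne (hnn s (Set.Ioo_subset_Ioc_self hs)) ?_⟩
  intro h0
  exact hs' (by rw [Multiset.mem_toFinset, mem_roots hne]; exact h0.symm)

theorem eq_zero_of_intE_mul_self (E : ℰ) {p : ℝ[X]} (h : M.intE E (p * p) = 0) : p = 0 := by
  by_contra hp
  refine absurd h (ne_of_gt ?_)
  obtain ⟨s, hs, hs'⟩ := (Set.Ioo_infinite (hM.len_pos E)).exists_notMem_finset p.roots.toFinset
  refine intervalIntegral.integral_pos (hM.len_pos E) (Polynomial.continuous _).continuousOn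
    (fun s _ => by rw [eval_mul]; exact mul_self_nonneg _)
    ⟨s, Set.Ioo_subset_Icc_self hs, ?_⟩
  rw [eval_mul]
  refine mul_self_pos.2 fun h0 => hs' ?_
  rw [Multiset.mem_toFinset, mem_roots hp]
  exact h0

/-! ### Well-posedness of the local problems -/

theorem exists_projF (F : ℱ) (S : Submodule ℝ (Fin 2 → P2)) [FiniteDimensional ℝ S] :
    ∃ R : (Fin 2 → P2) →ₗ[ℝ] (Fin 2 → P2), ∀ x y, M.IsProjF F S x y ↔ y = R x := by
  obtain ⟨R, hR⟩ := exists_riesz_operator (dotForm (hM.intFₗ F) LinearMap.id LinearMap.id) S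
    (fun y _ h => hM.eq_zero_of_intF_sq F ((dotForm_apply _ _ _ _ _).symm.trans h))
    (dotForm (hM.intFₗ F) LinearMap.id LinearMap.id)
  refine ⟨R, fun x y => ?_⟩
  rw [← hR]
  simp [IsProjF, intFₗ_apply]

theorem exists_projT (T : 𝒯) (S : Submodule ℝ (Fin 3 → P3)) [FiniteDimensional ℝ S] :
    ∃ R : (Fin 3 → P3) →ₗ[ℝ] (Fin 3 → P3), ∀ x y, M.IsProjT T S x y ↔ y = R x := by
  obtain ⟨R, hR⟩ := exists_riesz_operator (dotForm (hM.intTₗ T) LinearMap.id LinearMap.id) S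
    (fun y _ h => hM.eq_zero_of_intT_sq T ((dotForm_apply _ _ _ _ _).symm.trans h))
    (dotForm (hM.intTₗ T) LinearMap.id LinearMap.id)
  refine ⟨R, fun x y => ?_⟩
  rw [← hR]
  simp [IsProjT, intTₗ_apply]

/-- The polynomial `p` is the affine interpolant of the end point values plus a multiple
`s (L - s) r` of the bubble, and `r` solves a weighted projection problem. -/
theorem exists_edgePoly (E : ℰ) {m : ℤ} (hm : -1 ≤ m) :
    ∃ R : ℝ[X] × ℝ × ℝ →ₗ[ℝ] ℝ[X], ∀ f a b p,
      M.IsEdgePoly E m (fun s => f.eval s) a b p ↔ p = R (f, a, b) := by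
  have hL := hM.len_pos E
  obtain ⟨β, hβ⟩ : ∃ β, β = X * (C (M.len E) - X) := ⟨_, rfl⟩
  have hβm : β ∈ PolyE 2 := hβ ▸ PolyE_mul (m := 1) (n := 1) X_mem_PolyE
    (Submodule.sub_mem _ (PolyE_mono (by norm_num) (C_mem_PolyE le_rfl _)) X_mem_PolyE)
  have hβ0 : β.eval 0 = 0 := by simp [hβ]
  have hβL : β.eval (M.len E) = 0 := by simp [hβ]
  obtain ⟨R, hR⟩ := exists_riesz_operator
    (mulForm (M.intEₗ E) (LinearMap.mulLeft ℝ β) LinearMap.id) (PolyE m)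
    (fun y _ h => hM.eq_zero_of_intE_weighted E (by rw [← hβ]; exact h))
    (mulForm (M.intEₗ E) (LinearMap.fst ℝ _ _ - affineInterp (M.len E)) LinearMap.id)
  have hmul : ∀ p r : ℝ[X], (∫ s in (0 : ℝ)..(M.len E), p.eval s * r.eval s) = M.intE E (p * r) :=
    fun p r => by simp only [intE, eval_mul]
  refine ⟨affineInterp (M.len E) + (LinearMap.mulLeft ℝ β).comp R, fun f a b p => ?_⟩
  simp only [IsEdgePoly, hmul]
  have hform : ∀ r s, (mulForm (M.intEₗ E) (LinearMap.mulLeft ℝ β) LinearMap.id r s =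
        mulForm (M.intEₗ E) (LinearMap.fst ℝ _ _ - affineInterp (M.len E)) LinearMap.id
          (f, a, b) s) ↔
      M.intE E ((affineInterp (M.len E) (f, a, b) + β * r) * s) = M.intE E (f * s) := by
    intro r s
    simp only [mulForm_apply, LinearMap.mulLeft_apply, LinearMap.id_apply, LinearMap.sub_apply,
      LinearMap.fst_apply, ← intEₗ_apply, add_mul, sub_mul, map_add, map_sub]
    constructor <;> intro h <;> linarith
  have hm' : affineInterp (M.len E) (f, a, b) ∈ PolyE (m + 2) :=
    PolyE_mono (by omega) (affineInterp_mem _ _)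
  constructor
  · rintro ⟨hp, hint, h0, h1⟩
    obtain ⟨r, hr, hpr⟩ := exists_eq_mul_of_eval_eq_zero hL hm (Submodule.sub_mem _ hp hm')
      (by rw [eval_sub, eval_zero_affineInterp, h0, sub_self])
      (by rw [eval_sub, eval_affineInterp hL.ne', h1, sub_self])
    rw [← hβ] at hpr
    have hp' : p = affineInterp (M.len E) (f, a, b) + β * r := by rw [← hpr]; ring
    have := (hR (f, a, b) r).1 ⟨hr, fun s hs => (hform r s).2 (by rw [← hp']; exact hint s hs)⟩
    rw [hp', this]
    rfl
  · rintro rfl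
    obtain ⟨hr, hint⟩ := (hR (f, a, b) _).2 rfl
    refine ⟨Submodule.add_mem _ hm' ?_, fun s hs => (hform _ s).1 (hint s hs), ?_, ?_⟩
    · have := PolyE_mul hβm hr
      rwa [add_comm] at this
    · rw [LinearMap.add_apply, eval_add, eval_zero_affineInterp]
      simp [hβ0]
    · rw [LinearMap.add_apply, eval_add, eval_affineInterp hL.ne']
      simp [hβL]

/-- Here and in the following lemmas, the solution operator of a local problem is the Riesz operator
of its right-hand side, a bilinear form in the data and the test function. -/
theorem exists_gradF (k : ℤ) (F : ℱ) :
    ∃ R : GradDofs 𝒯 ℱ ℰ 𝒱 →ₗ[ℝ] (Fin 2 → P2), ∀ q g, M.IsGradF k F q g ↔ g = R q := by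
  obtain ⟨R, hR⟩ := exists_riesz_operator (dotForm (hM.intFₗ F) LinearMap.id LinearMap.id)
    (VPoly (Fin 2) (Fin 2) k)
    (fun y _ h => hM.eq_zero_of_intF_sq F ((dotForm_apply _ _ _ _ _).symm.trans h))
    (Z := GradDofs 𝒯 ℱ ℰ 𝒱)
    (-mulForm (hM.intFₗ F)
        (IsLinearMap.mk' (fun q : GradDofs 𝒯 ℱ ℰ 𝒱 => q.qF F) ⟨fun _ _ => rfl, fun _ _ => rfl⟩)
        div +
      ∑ E ∈ M.edgesOf F, M.ωF F E • mulForm (M.intEₗ E)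
        (IsLinearMap.mk' (fun q : GradDofs 𝒯 ℱ ℰ 𝒱 => q.qE E) ⟨fun _ _ => rfl, fun _ _ => rfl⟩)
        (M.dotNFEₗ F E))
  refine ⟨R, fun q g => ?_⟩
  rw [← hR]
  simp [IsGradF, intFₗ_apply, intEₗ_apply]

theorem exists_gradPerpF (k : ℤ) (F : ℱ) :
    ∃ R : GradDofs 𝒯 ℱ ℰ 𝒱 →ₗ[ℝ] (Fin 2 → P2), ∀ q g, M.IsGradPerpF k F q g ↔ g = R q := by
  obtain ⟨R, hR⟩ := exists_riesz_operator (dotForm (hM.intFₗ F) LinearMap.id LinearMap.id)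
    (VPoly (Fin 2) (Fin 2) k)
    (fun y _ h => hM.eq_zero_of_intF_sq F ((dotForm_apply _ _ _ _ _).symm.trans h))
    (Z := GradDofs 𝒯 ℱ ℰ 𝒱)
    (-mulForm (hM.intFₗ F)
        (IsLinearMap.mk' (fun q : GradDofs 𝒯 ℱ ℰ 𝒱 => q.GF F) ⟨fun _ _ => rfl, fun _ _ => rfl⟩)
        rotₗ -
      ∑ E ∈ M.edgesOf F, M.ωF F E • mulForm (M.intEₗ E)
        ((dotcₗ (M.normal F)).comp
          (IsLinearMap.mk' (fun q : GradDofs 𝒯 ℱ ℰ 𝒱 => q.GE E) ⟨fun _ _ => rfl, fun _ _ => rfl⟩))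
        (M.dotTEₗ F E))
  refine ⟨R, fun q g => ?_⟩
  rw [← hR]
  simp [IsGradPerpF, intFₗ_apply, intEₗ_apply]

theorem exists_traceGradF (k : ℤ) (F : ℱ) :
    ∃ R : GradDofs 𝒯 ℱ ℰ 𝒱 →ₗ[ℝ] P2, ∀ q p, M.IsTraceGradF k F q p ↔ p = R q := by
  obtain ⟨G, hG⟩ := hM.exists_gradF k F
  obtain ⟨R, hR⟩ := exists_solution_operator (mulForm (hM.intFₗ F) LinearMap.id LinearMap.id)
    (Rc posF (k + 2)) div (fun y _ h => hM.eq_zero_of_intF_mul_self F h)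
    (Z := GradDofs 𝒯 ℱ ℰ 𝒱)
    (-dotForm (hM.intFₗ F) G LinearMap.id +
      ∑ E ∈ M.edgesOf F, M.ωF F E • mulForm (M.intEₗ E)
        (IsLinearMap.mk' (fun q : GradDofs 𝒯 ℱ ℰ 𝒱 => q.qE E) ⟨fun _ _ => rfl, fun _ _ => rfl⟩)
        (M.dotNFEₗ F E))
    (fun z x hx h => by rw [posF_eq] at hx; rw [eq_zero_of_div_eq_zero 0 hx h, map_zero])
  refine ⟨R, fun q p => ?_⟩
  rw [← hR, posF_eq, map_div_Rc, IsTraceGradF, show M.gradF k F q = G q from theUnique_eq (hG q)]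
  simp [intFₗ_apply, intEₗ_apply, posF_eq, show k + 2 - 1 = k + 1 by ring]

theorem exists_gradT (k : ℤ) (T : 𝒯) :
    ∃ R : GradDofs 𝒯 ℱ ℰ 𝒱 →ₗ[ℝ] (Fin 3 → P3), ∀ q g, M.IsGradT k T q g ↔ g = R q := by
  choose G hG using hM.exists_traceGradF k
  obtain ⟨R, hR⟩ := exists_riesz_operator (dotForm (hM.intTₗ T) LinearMap.id LinearMap.id)
    (VPoly (Fin 3) (Fin 3) k)
    (fun y _ h => hM.eq_zero_of_intT_sq T ((dotForm_apply _ _ _ _ _).symm.trans h))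
    (Z := GradDofs 𝒯 ℱ ℰ 𝒱)
    (-mulForm (hM.intTₗ T)
        (IsLinearMap.mk' (fun q : GradDofs 𝒯 ℱ ℰ 𝒱 => q.qT T) ⟨fun _ _ => rfl, fun _ _ => rfl⟩)
        div +
      ∑ F ∈ M.facesOf T, M.ωT T F • mulForm (hM.intFₗ F) (G F) (M.dotNFₗ F))
  refine ⟨R, fun q g => ?_⟩
  have hG' : ∀ F, M.traceGradF k F q = G F q := fun F => theUnique_eq (hG F q)
  rw [← hR]
  simp [IsGradT, intFₗ_apply, intTₗ_apply, hG']

theorem exists_curlF (k : ℤ) (F : ℱ) :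
    ∃ R : CurlDofs 𝒯 ℱ ℰ 𝒱 →ₗ[ℝ] P2, ∀ v p, M.IsCurlF k F v p ↔ p = R v := by
  obtain ⟨R, hR⟩ := exists_riesz_operator (mulForm (hM.intFₗ F) LinearMap.id LinearMap.id)
    (Poly (Fin 2) k) (fun y _ h => hM.eq_zero_of_intF_mul_self F h)
    (Z := CurlDofs 𝒯 ℱ ℰ 𝒱)
    (dotForm (hM.intFₗ F)
        (IsLinearMap.mk' (fun v : CurlDofs 𝒯 ℱ ℰ 𝒱 => v.rF F) ⟨fun _ _ => rfl, fun _ _ => rfl⟩)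
        vrot -
      ∑ E ∈ M.edgesOf F, M.ωF F E • mulForm (M.intEₗ E)
        ((dotcₗ (M.tangent E)).comp
          (IsLinearMap.mk' (fun v : CurlDofs 𝒯 ℱ ℰ 𝒱 => v.vE E) ⟨fun _ _ => rfl, fun _ _ => rfl⟩))
        (M.resE F E).toLinearMap)
  refine ⟨R, fun v p => ?_⟩
  rw [← hR]
  simp [IsCurlF, intFₗ_apply, intEₗ_apply]

theorem exists_vcurlF (k : ℤ) (F : ℱ) :
    ∃ R : CurlDofs 𝒯 ℱ ℰ 𝒱 →ₗ[ℝ] (Fin 2 → P2), ∀ v g, M.IsVCurlF k F v g ↔ g = R v := by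
  obtain ⟨R, hR⟩ := exists_riesz_operator (dotForm (hM.intFₗ F) LinearMap.id LinearMap.id)
    (VPoly (Fin 2) (Fin 2) k)
    (fun y _ h => hM.eq_zero_of_intF_sq F ((dotForm_apply _ _ _ _ _).symm.trans h))
    (Z := CurlDofs 𝒯 ℱ ℰ 𝒱)
    (mulForm (hM.intFₗ F)
        (IsLinearMap.mk' (fun v : CurlDofs 𝒯 ℱ ℰ 𝒱 => v.vF F) ⟨fun _ _ => rfl, fun _ _ => rfl⟩)
        rotₗ +
      ∑ E ∈ M.edgesOf F, M.ωF F E • mulForm (M.intEₗ E)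
        ((dotcₗ (M.normal F)).comp
          (IsLinearMap.mk' (fun v : CurlDofs 𝒯 ℱ ℰ 𝒱 => v.vE E) ⟨fun _ _ => rfl, fun _ _ => rfl⟩))
        (M.dotTEₗ F E))
  refine ⟨R, fun v g => ?_⟩
  rw [← hR]
  simp [IsVCurlF, intFₗ_apply, intEₗ_apply]

/-- The polynomials of degree at most `m` on a face, of zero integral. -/
def zeroMeanF (F : ℱ) (m : ℤ) : Submodule ℝ P2 := Poly (Fin 2) m ⊓ LinearMap.ker (hM.intFₗ F)

theorem intF_C_ne_zero (F : ℱ) {c : ℝ} (hc : c ≠ 0) : M.intF F (MvPolynomial.C c) ≠ 0 := by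
  intro h
  have h2 : M.intF F (MvPolynomial.C c * MvPolynomial.C c) = 0 := by
    rw [← MvPolynomial.smul_eq_C_mul, intF_smul, h, mul_zero]
  exact hc (by simpa using hM.eq_zero_of_intF_mul_self F h2)

/-- The test fields of the tangential trace are all the vector polynomials. -/
theorem map_vrot_add (k : ℤ) (hk : 0 ≤ k) (F : ℱ) :
    ((hM.zeroMeanF F (k + 1)).prod (Rc posF k)).map
      (vrot.comp (LinearMap.fst ℝ _ _) + LinearMap.snd ℝ _ _) = VPoly (Fin 2) (Fin 2) k := by
  refine le_antisymm ?_ fun v hv => ?_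
  · rintro _ ⟨⟨r, w⟩, ⟨hr, hw⟩, rfl⟩
    rw [SetLike.mem_coe, posF_eq] at hw
    exact Submodule.add_mem _ (vrot_mem hr.1) (Rc_le 0 k hw)
  · obtain ⟨r, hr, w, hw, rfl⟩ := exists_vrot_add_Rc hv
    set c := M.intF F r / M.intF F (MvPolynomial.C 1) with hc
    refine ⟨(r - c • MvPolynomial.C 1, w), ⟨⟨Submodule.sub_mem _ hr (Submodule.smul_mem _ _
      (C_mem_Poly (by omega) _)), ?_⟩, hw⟩, ?_⟩
    · rw [SetLike.mem_coe, LinearMap.mem_ker, map_sub, map_smul, intFₗ_apply, intFₗ_apply,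
        smul_eq_mul, hc, div_mul_cancel₀ _ (hM.intF_C_ne_zero F one_ne_zero), sub_self]
    · have : vrot (MvPolynomial.C 1) = 0 := by
        funext i
        fin_cases i
        · exact pd_C 1 1
        · exact neg_eq_zero.2 (pd_C 0 1)
      simp only [LinearMap.add_apply, LinearMap.comp_apply, LinearMap.fst_apply,
        LinearMap.snd_apply, map_sub, map_smul, this, smul_zero, sub_zero]

/-- A test field of the tangential trace determines its two components, thanks to the condition of
zero integral. -/
theorem vrot_add_eq_zero {k : ℤ} {F : ℱ} {r : P2} {w : Fin 2 → P2} (hr : M.intF F r = 0)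
    (hw : w ∈ Rc posF k) (h : vrot r + w = 0) : r = 0 ∧ w = 0 := by
  rw [posF_eq] at hw
  have hw0 : w = 0 := by
    refine eq_zero_of_div_eq_zero 0 hw ?_
    have := congrArg div h
    rwa [map_add, div_vrot, zero_add, map_zero] at this
  rw [hw0, add_zero] at h
  have hC : r = MvPolynomial.C (MvPolynomial.eval 0 r) := by
    refine eq_C_of_pd_eq_zero fun i => ?_
    fin_cases i
    · exact neg_eq_zero.1 (congrFun h 1)
    · exact congrFun h 0
  refine ⟨?_, hw0⟩
  by_contra hne
  rw [hC] at hr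
  refine hM.intF_C_ne_zero F (fun h0 => hne ?_) hr
  rw [hC, h0, map_zero]

/-- The right-hand side is defined by the components `r`, `w` of the test field `vrot r + w`; it
depends on the test field only, since these are unique. -/
theorem exists_traceTF (k : ℤ) (hk : 0 ≤ k) (F : ℱ) :
    ∃ R : CurlDofs 𝒯 ℱ ℰ 𝒱 →ₗ[ℝ] (Fin 2 → P2), ∀ v g, M.IsTraceTF k F v g ↔ g = R v := by
  obtain ⟨G, hG⟩ := hM.exists_curlF k F
  have : FiniteDimensional ℝ (hM.zeroMeanF F (k + 1)) :=
    Submodule.finiteDimensional_of_le (inf_le_left : _ ≤ Poly (Fin 2) (k + 1))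
  obtain ⟨R, hR⟩ := exists_solution_operator (dotForm (hM.intFₗ F) LinearMap.id LinearMap.id)
    ((hM.zeroMeanF F (k + 1)).prod (Rc posF k))
    (vrot.comp (LinearMap.fst ℝ _ _) + LinearMap.snd ℝ _ _)
    (fun y _ h => hM.eq_zero_of_intF_sq F ((dotForm_apply _ _ _ _ _).symm.trans h))
    (Z := CurlDofs 𝒯 ℱ ℰ 𝒱)
    (mulForm (hM.intFₗ F) G (LinearMap.fst ℝ _ _) +
      ∑ E ∈ M.edgesOf F, M.ωF F E • mulForm (M.intEₗ E)
        ((dotcₗ (M.tangent E)).comp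
          (IsLinearMap.mk' (fun v : CurlDofs 𝒯 ℱ ℰ 𝒱 => v.vE E) ⟨fun _ _ => rfl, fun _ _ => rfl⟩))
        ((M.resE F E).toLinearMap.comp (LinearMap.fst ℝ _ _)) +
      dotForm (hM.intFₗ F)
          (IsLinearMap.mk' (fun v : CurlDofs 𝒯 ℱ ℰ 𝒱 => v.rcF F) ⟨fun _ _ => rfl, fun _ _ => rfl⟩)
        (LinearMap.snd ℝ _ _))
    (by
      rintro z ⟨r, w⟩ ⟨hr, hw⟩ h
      obtain ⟨rfl, rfl⟩ := hM.vrot_add_eq_zero hr.2 hw h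
      exact map_zero _)
  refine ⟨R, fun v g => ?_⟩
  rw [← hR, hM.map_vrot_add k hk, IsTraceTF, show M.curlF k F v = G v from theUnique_eq (hG v)]
  refine and_congr_right fun _ => ⟨?_, ?_⟩
  · rintro h ⟨r, w⟩ ⟨hr, hw⟩
    have := h r hr.1 hr.2 w hw
    simpa [intFₗ_apply, intEₗ_apply] using this
  · intro h r hr hr0 w hw
    have := h (r, w) ⟨⟨hr, hr0⟩, hw⟩
    simpa [intFₗ_apply, intEₗ_apply] using this

theorem exists_curlT (k : ℤ) (hk : 0 ≤ k) (T : 𝒯) :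
    ∃ R : CurlDofs 𝒯 ℱ ℰ 𝒱 →ₗ[ℝ] (Fin 3 → P3), ∀ v g, M.IsCurlT k T v g ↔ g = R v := by
  choose G hG using hM.exists_traceTF k hk
  obtain ⟨R, hR⟩ := exists_riesz_operator (dotForm (hM.intTₗ T) LinearMap.id LinearMap.id)
    (VPoly (Fin 3) (Fin 3) k)
    (fun y _ h => hM.eq_zero_of_intT_sq T ((dotForm_apply _ _ _ _ _).symm.trans h))
    (Z := CurlDofs 𝒯 ℱ ℰ 𝒱)
    (dotForm (hM.intTₗ T)
        (IsLinearMap.mk' (fun v : CurlDofs 𝒯 ℱ ℰ 𝒱 => v.rT T) ⟨fun _ _ => rfl, fun _ _ => rfl⟩)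
        curl +
      ∑ F ∈ M.facesOf T, M.ωT T F • dotForm (hM.intFₗ F) (G F) (M.crossNFₗ F))
  refine ⟨R, fun v g => ?_⟩
  have hG' : ∀ F, M.traceTF k F v = G F v := fun F => theUnique_eq (hG F v)
  rw [← hR]
  simp [IsCurlT, intFₗ_apply, intTₗ_apply, hG']

end IsPolyhedralMesh

end MeshData

/-! ### Well-posedness of the Jacobians -/

/-- `Rbc` as a submodule. -/
def RbcSub {σ : Type*} [Fintype σ] (y : σ → MvPolynomial σ ℝ) (m : ℤ) :
    Submodule ℝ (σ → σ → MvPolynomial σ ℝ) :=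
  Submodule.pi Set.univ (fun _ => Rc y m) ⊓ LinearMap.ker traceₗ

theorem mem_RbcSub {σ : Type*} [Fintype σ] {y : σ → MvPolynomial σ ℝ} {m : ℤ}
    {W : σ → σ → MvPolynomial σ ℝ} : W ∈ RbcSub y m ↔ W ∈ Rbc y m := by
  simp [RbcSub, Rbc, Submodule.mem_pi]

/-- `Rb` as a submodule. -/
def RbSub {σ : Type*} [Fintype σ] (I : MvPolynomial σ ℝ →ₗ[ℝ] ℝ) (y : σ → MvPolynomial σ ℝ)
    (m : ℤ) : Submodule ℝ (σ → σ → MvPolynomial σ ℝ) :=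
  Submodule.pi Set.univ (fun _ => Rc y m) ⊓
    ((Poly σ m ⊓ LinearMap.ker I).map (grad σ)).comap tdivₗ

theorem mem_RbSub {σ : Type*} [Fintype σ] {I : MvPolynomial σ ℝ →ₗ[ℝ] ℝ}
    {y : σ → MvPolynomial σ ℝ} {m : ℤ} {W : σ → σ → MvPolynomial σ ℝ} :
    W ∈ RbSub I y m ↔ W ∈ Rb I y m := by
  simp [RbSub, Rb, Submodule.mem_pi, and_assoc, eq_comm]

instance {σ : Type*} [Fintype σ] (y : σ → MvPolynomial σ ℝ) (m : ℤ) :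
    FiniteDimensional ℝ (RbcSub y m) :=
  Submodule.finiteDimensional_of_le inf_le_left

instance {σ : Type*} [Fintype σ] (I : MvPolynomial σ ℝ →ₗ[ℝ] ℝ) (y : σ → MvPolynomial σ ℝ)
    (m : ℤ) : FiniteDimensional ℝ (RbSub I y m) :=
  Submodule.finiteDimensional_of_le inf_le_left

/-- The data `w ↦ (tdiv V₁, tdiv V₂)` of a Jacobian are determined by the sum `V₁ + V₂ + V₃`. The
divergence of the rows shows that `V₁ + V₂ = 0`, so that `V₂` has zero trace. Its rows are
`y ∂ᵢ s`, where `(n - 1 + E) s = q` for the Euler operator `E`; the trace is then `E s`, so that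
`s` and `q` are constant. -/
theorem tdiv_eq_zero_of_add_eq_zero {σ : Type*} [Fintype σ] (hσ : 2 ≤ Fintype.card σ) (a : σ → ℝ)
    {m m' n : ℤ} {V₁ V₂ V₃ : σ → σ → MvPolynomial σ ℝ} (h₁ : V₁ ∈ Rbc (posV a) m)
    (h₂ : ∀ i, V₂ i ∈ Rc (posV a) m') {q : MvPolynomial σ ℝ} (hq : q ∈ Poly σ n)
    (hq₂ : tdiv V₂ = grad σ q) (h₃ : ∀ i, div (V₃ i) = 0) (h : V₁ + V₂ + V₃ = 0) :
    tdiv V₁ = 0 ∧ tdiv V₂ = 0 := by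
  have : Nonempty σ := Fintype.card_pos_iff.1 (by omega)
  have h12 : ∀ i, V₁ i + V₂ i = 0 := by
    intro i
    refine eq_zero_of_div_eq_zero a (m := max m m') (Submodule.add_mem _
      (Rc_mono a (le_max_left _ _) (h₁.1 i)) (Rc_mono a (le_max_right _ _) (h₂ i))) ?_
    have h4 := congrArg div (congrFun h i)
    rw [Pi.add_apply, Pi.add_apply, map_add, h₃ i, add_zero] at h4
    exact h4.trans (map_zero _)
  have htr : ∑ i, V₂ i i = 0 := by
    have h5 : ∑ i, (V₁ i i + V₂ i i) = 0 :=
      Finset.sum_eq_zero fun i _ => congrFun (h12 i) i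
    rwa [Finset.sum_add_distrib, h₁.2, zero_add] at h5
  have hc : (0 : ℝ) < Fintype.card σ - 1 := by
    have : (2 : ℝ) ≤ Fintype.card σ := by exact_mod_cast hσ
    linarith
  obtain ⟨s, -, hs⟩ := exists_eul_eq a hc hq
  have hrow : ∀ i, V₂ i = smulVec (posV a) (pd i s) := by
    intro i
    obtain ⟨p, -, hp⟩ := h₂ i
    rw [← hp]
    congr 1
    have h6 := congrFun hq₂ i
    rw [tdiv, ← hp, div_smulVec, grad_apply, ← hs, pd_eul, sub_add_cancel] at h6
    exact eul_injective a (by linarith) h6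
  have hE : eul a 0 s = 0 := by
    rw [← htr, eul_apply, zero_smul, zero_add]
    exact Finset.sum_congr rfl fun i _ => by rw [hrow, smulVec_apply]
  have h2 : tdiv V₂ = 0 := by
    rw [hq₂, ← hs, eq_C_of_eul_zero a hE]
    funext i
    rw [grad_apply, pd_eul, pd_C, map_zero, Pi.zero_apply]
  refine ⟨?_, h2⟩
  funext i
  have h7 := congrArg div (h12 i)
  rw [map_add, map_zero] at h7
  have h8 : div (V₂ i) = 0 := congrFun h2 i
  rw [h8, add_zero] at h7
  exact h7

theorem div_eq_zero_of_mem_RolyF {m : ℤ} {v : Fin 2 → P2} (h : v ∈ RolyF m) : div v = 0 := by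
  obtain ⟨r, -, rfl⟩ := h
  exact div_vrot r

theorem div_eq_zero_of_mem_RolyT {m : ℤ} {v : Fin 3 → P3} (h : v ∈ RolyT m) : div v = 0 := by
  obtain ⟨r, -, rfl⟩ := h
  exact div_curl r

namespace MeshData

variable {𝒯 ℱ ℰ 𝒱 : Type*} [Fintype 𝒯] [Fintype ℱ] [Fintype ℰ] [Fintype 𝒱]
  {M : MeshData 𝒯 ℱ ℰ 𝒱} {Ω : Set R3}

/-- `faceTensor` as a linear map. -/
def faceTensorₗ : (Fin 2 → Fin 2 → P2) × (Fin 2 → P2) →ₗ[ℝ] (Fin 3 → Fin 2 → P2) where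
  toFun z := faceTensor z.1 z.2
  map_add' z w := by
    funext i
    fin_cases i <;> rfl
  map_smul' c z := by
    funext i
    fin_cases i <;> rfl

@[simp] theorem faceTensorₗ_apply (z : (Fin 2 → Fin 2 → P2) × (Fin 2 → P2)) :
    faceTensorₗ z = faceTensor z.1 z.2 := rfl

/-- `edgeFlux` as a bilinear form. -/
def edgeFluxForm (M : MeshData 𝒯 ℱ ℰ 𝒱) (F : ℱ) :
    JacDofs 𝒯 ℱ ℰ →ₗ[ℝ] (Fin 3 → Fin 2 → P2) →ₗ[ℝ] ℝ :=
  ∑ E ∈ M.edgesOf F, M.ωF F E • ∑ i, mulForm (M.intEₗ E)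
    ((dotcₗ (M.frame3 F i)).comp
      (IsLinearMap.mk' (fun w : JacDofs 𝒯 ℱ ℰ => w.wE E) ⟨fun _ _ => rfl, fun _ _ => rfl⟩))
    ((M.dotNFEₗ F E).comp (LinearMap.proj i))

@[simp] theorem edgeFluxForm_apply (F : ℱ) (w : JacDofs 𝒯 ℱ ℰ) (V : Fin 3 → Fin 2 → P2) :
    M.edgeFluxForm F w V = M.edgeFlux F w V := by
  simp only [edgeFluxForm, edgeFlux, LinearMap.sum_apply, LinearMap.smul_apply, mulForm_apply,
    ← intEₗ_apply, map_sum, smul_eq_mul]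
  simp

/-- The linear combination of the rows of `V` with the coefficients `b`. -/
def rowComb (b : R3) : (Fin 3 → Fin 3 → P3) →ₗ[ℝ] (Fin 3 → P3) :=
  LinearMap.pi fun j => (dotcₗ b).comp (LinearMap.pi fun i =>
    (LinearMap.proj (R := ℝ) (φ := fun _ : Fin 3 => P3) j).comp (LinearMap.proj i))

@[simp] theorem rowComb_apply (b : R3) (V : Fin 3 → Fin 3 → P3) :
    rowComb b V = fun j => dotc b fun i => V i j := by
  funext j
  simp [rowComb]
  rfl

namespace IsPolyhedralMesh

variable (hM : M.IsPolyhedralMesh Ω)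
include hM

theorem exists_jacF (k : ℤ) (F : ℱ) :
    ∃ R : JacDofs 𝒯 ℱ ℰ →ₗ[ℝ] (Fin 3 → Fin 2 → P2), ∀ w J, M.IsJacF k F w J ↔ J = R w := by
  let S : Submodule ℝ (((Fin 2 → Fin 2 → P2) × (Fin 2 → Fin 2 → P2) × (Fin 2 → Fin 2 → P2)) ×
      (Fin 2 → P2)) :=
    ((RbcSub posF (k + 1)).prod ((RbSub (hM.intFₗ F) posF (k + 1)).prod
      (Submodule.pi Set.univ fun _ => RolyF (k + 1)))).prod (VPoly (Fin 2) (Fin 2) (k + 1))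
  let d : ((Fin 2 → Fin 2 → P2) × (Fin 2 → Fin 2 → P2) × (Fin 2 → Fin 2 → P2)) ×
      (Fin 2 → P2) →ₗ[ℝ] (Fin 3 → Fin 2 → P2) :=
    { toFun := fun x => faceTensor (x.1.1 + x.1.2.1 + x.1.2.2) x.2
      map_add' := fun x y => by
        rw [← faceTensorₗ_apply (_, x.2), ← faceTensorₗ_apply (_, y.2), ← map_add,
          faceTensorₗ_apply]
        congr 1
        simp only [Prod.fst_add, Prod.snd_add]
        abel
      map_smul' := fun c x => by
        rw [← faceTensorₗ_apply (_, x.2), ← map_smul, faceTensorₗ_apply]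
        congr 1
        simp only [Prod.smul_fst, Prod.smul_snd, smul_add, RingHom.id_apply] }
  have hd : ∀ V₁ V₂ V₃ z, d ((V₁, V₂, V₃), z) = faceTensor (V₁ + V₂ + V₃) z :=
    fun _ _ _ _ => rfl
  have hS : ∀ V₁ V₂ V₃ z, ((V₁, V₂, V₃), z) ∈ S ↔ V₁ ∈ Rbc posF (k + 1) ∧
      V₂ ∈ Rb (M.intF F) posF (k + 1) ∧ (∀ i, V₃ i ∈ RolyF (k + 1)) ∧
      z ∈ VPoly (Fin 2) (Fin 2) (k + 1) := by
    intro V₁ V₂ V₃ z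
    simp only [S, Submodule.mem_prod, mem_RbcSub, mem_RbSub, Submodule.mem_pi, Set.mem_univ,
      forall_true_left, and_assoc]
    rfl
  obtain ⟨R, hR⟩ := exists_solution_operator (tdotForm (hM.intFₗ F) LinearMap.id LinearMap.id)
    S d (fun y _ h => hM.eq_zero_of_intF_tdot_self F ((tdotForm_apply _ _ _ _ _).symm.trans h))
    (Z := JacDofs 𝒯 ℱ ℰ)
    (-dotForm (hM.intFₗ F)
        (IsLinearMap.mk' (fun w : JacDofs 𝒯 ℱ ℰ => w.gcF F) ⟨fun _ _ => rfl, fun _ _ => rfl⟩)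
        (tdivₗ.comp ((LinearMap.fst ℝ _ _).comp (LinearMap.fst ℝ _ _))) -
      dotForm (hM.intFₗ F)
        (IsLinearMap.mk' (fun w : JacDofs 𝒯 ℱ ℰ => w.gF F) ⟨fun _ _ => rfl, fun _ _ => rfl⟩)
        (tdivₗ.comp ((LinearMap.fst ℝ _ _).comp
          ((LinearMap.snd ℝ _ _).comp (LinearMap.fst ℝ _ _)))) -
      mulForm (hM.intFₗ F)
        (IsLinearMap.mk' (fun w : JacDofs 𝒯 ℱ ℰ => w.wF F) ⟨fun _ _ => rfl, fun _ _ => rfl⟩)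
        (div.comp (LinearMap.snd ℝ _ _)) +
      (M.edgeFluxForm F).compl₂ d)
    (by
      rintro w ⟨⟨V₁, V₂, V₃⟩, z⟩ hx h
      obtain ⟨h₁, ⟨h₂, q, hq, -, hq₂⟩, h₃, -⟩ := (hS _ _ _ _).1 hx
      have hz : z = 0 := congrFun h 2
      have hV : V₁ + V₂ + V₃ = 0 := by
        funext i
        fin_cases i
        · exact congrFun h 0
        · exact congrFun h 1
      rw [posF_eq] at h₁ h₂
      obtain ⟨h4, h5⟩ := tdiv_eq_zero_of_add_eq_zero (by simp) 0 h₁ h₂ hq hq₂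
        (fun i => div_eq_zero_of_mem_RolyF (h₃ i)) hV
      subst hz
      simp [h4, h5, LinearMap.compl₂_apply, h, -edgeFluxForm_apply])
  refine ⟨R, fun w J => ?_⟩
  rw [← hR]
  refine and_congr ⟨?_, ?_⟩ ⟨?_, ?_⟩
  · rintro ⟨V₁, h₁, V₂, h₂, V₃, h₃, z, hz, rfl⟩
    exact ⟨((V₁, V₂, V₃), z), (hS _ _ _ _).2 ⟨h₁, h₂, h₃, hz⟩, rfl⟩
  · rintro ⟨⟨⟨V₁, V₂, V₃⟩, z⟩, hx, rfl⟩
    obtain ⟨h₁, h₂, h₃, hz⟩ := (hS _ _ _ _).1 hx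
    exact ⟨V₁, h₁, V₂, h₂, V₃, h₃, z, hz, rfl⟩
  · rintro h ⟨⟨V₁, V₂, V₃⟩, z⟩ hx
    obtain ⟨h₁, h₂, h₃, hz⟩ := (hS _ _ _ _).1 hx
    simpa [LinearMap.compl₂_apply, hd, intFₗ_apply] using h V₁ h₁ V₂ h₂ V₃ h₃ z hz
  · intro h V₁ h₁ V₂ h₂ V₃ h₃ z hz
    simpa [LinearMap.compl₂_apply, hd, intFₗ_apply] using
      h ((V₁, V₂, V₃), z) ((hS _ _ _ _).2 ⟨h₁, h₂, h₃, hz⟩)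

omit hM in
theorem map_tdiv_Rc (k : ℤ) :
    (Submodule.pi Set.univ fun _ : Fin 3 => Rc posF (k + 3)).map tdivₗ =
      VPoly (Fin 3) (Fin 2) (k + 2) := by
  rw [posF_eq]
  have h := map_div_Rc (0 : R2) (k + 3)
  rw [show k + 3 - 1 = k + 2 by ring] at h
  ext g
  rw [mem_VPoly_iff, Submodule.mem_map]
  constructor
  · rintro ⟨V, hV, rfl⟩ i
    rw [← h]
    exact ⟨V i, hV i trivial, rfl⟩
  · intro hg
    simp only [← h, Submodule.mem_map] at hg
    choose V hV hVg using hg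
    exact ⟨V, fun i _ => hV i, funext hVg⟩

theorem exists_traceJacF (k : ℤ) (F : ℱ) :
    ∃ R : JacDofs 𝒯 ℱ ℰ →ₗ[ℝ] (Fin 3 → P2), ∀ w g, M.IsTraceJacF k F w g ↔ g = R w := by
  obtain ⟨G, hG⟩ := hM.exists_jacF k F
  obtain ⟨R, hR⟩ := exists_solution_operator (dotForm (hM.intFₗ F) LinearMap.id LinearMap.id)
    (Submodule.pi Set.univ fun _ : Fin 3 => Rc posF (k + 3)) tdivₗ
    (fun y _ h => hM.eq_zero_of_intF_sq F ((dotForm_apply _ _ _ _ _).symm.trans h))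
    (Z := JacDofs 𝒯 ℱ ℰ)
    (-tdotForm (hM.intFₗ F) G LinearMap.id + M.edgeFluxForm F)
    (fun z V hV h => by
      have hV0 : V = 0 := by
        funext i
        have := hV i trivial
        rw [posF_eq] at this
        exact eq_zero_of_div_eq_zero 0 this (congrFun h i)
      rw [hV0, map_zero])
  refine ⟨R, fun w g => ?_⟩
  rw [← hR, map_tdiv_Rc, IsTraceJacF, show M.jacF k F w = G w from theUnique_eq (hG w)]
  simp [intFₗ_apply, Submodule.mem_pi]

theorem exists_jacT (k : ℤ) (T : 𝒯) :
    ∃ R : JacDofs 𝒯 ℱ ℰ →ₗ[ℝ] (Fin 3 → Fin 3 → P3), ∀ w J, M.IsJacT k T w J ↔ J = R w := by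
  choose G hG using hM.exists_traceJacF k
  let y := posT (M.center T)
  let S : Submodule ℝ ((Fin 3 → Fin 3 → P3) × (Fin 3 → Fin 3 → P3) × (Fin 3 → Fin 3 → P3)) :=
    (RbcSub y (k + 1)).prod ((RbSub (hM.intTₗ T) y k).prod
      (Submodule.pi Set.univ fun _ => RolyT k))
  let d : (Fin 3 → Fin 3 → P3) × (Fin 3 → Fin 3 → P3) × (Fin 3 → Fin 3 → P3) →ₗ[ℝ]
      (Fin 3 → Fin 3 → P3) :=
    LinearMap.fst ℝ _ _ + (LinearMap.fst ℝ _ _).comp (LinearMap.snd ℝ _ _) +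
      (LinearMap.snd ℝ _ _).comp (LinearMap.snd ℝ _ _)
  have hd : ∀ V₁ V₂ V₃, d (V₁, V₂, V₃) = V₁ + V₂ + V₃ := fun _ _ _ => rfl
  have hS : ∀ V₁ V₂ V₃, (V₁, V₂, V₃) ∈ S ↔ V₁ ∈ Rbc y (k + 1) ∧
      V₂ ∈ Rb (M.intT T) y k ∧ (∀ i, V₃ i ∈ RolyT k) := by
    intro V₁ V₂ V₃
    simp only [S, Submodule.mem_prod, mem_RbcSub, mem_RbSub, Submodule.mem_pi, Set.mem_univ,
      forall_true_left]
    rfl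
  obtain ⟨R, hR⟩ := exists_solution_operator (tdotForm (hM.intTₗ T) LinearMap.id LinearMap.id)
    S d (fun y _ h => hM.eq_zero_of_intT_tdot_self T ((tdotForm_apply _ _ _ _ _).symm.trans h))
    (Z := JacDofs 𝒯 ℱ ℰ)
    (-dotForm (hM.intTₗ T)
        (IsLinearMap.mk' (fun w : JacDofs 𝒯 ℱ ℰ => w.gcT T) ⟨fun _ _ => rfl, fun _ _ => rfl⟩)
        (tdivₗ.comp (LinearMap.fst ℝ _ _)) -
      dotForm (hM.intTₗ T)
        (IsLinearMap.mk' (fun w : JacDofs 𝒯 ℱ ℰ => w.gT T) ⟨fun _ _ => rfl, fun _ _ => rfl⟩)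
        (tdivₗ.comp ((LinearMap.fst ℝ _ _).comp (LinearMap.snd ℝ _ _))) +
      (∑ F ∈ M.facesOf T, M.ωT T F • ∑ a, mulForm (hM.intFₗ F) ((LinearMap.proj a).comp (G F))
        ((M.dotNFₗ F).comp (rowComb (M.frame3 F a)))).compl₂ d)
    (by
      rintro w ⟨V₁, V₂, V₃⟩ hx h
      obtain ⟨h₁, ⟨h₂, q, hq, -, hq₂⟩, h₃⟩ := (hS _ _ _).1 hx
      obtain ⟨h4, h5⟩ := tdiv_eq_zero_of_add_eq_zero (by simp) (M.center T) h₁ h₂ hq hq₂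
        (fun i => div_eq_zero_of_mem_RolyT (h₃ i)) h
      simp only [LinearMap.add_apply, LinearMap.sub_apply, LinearMap.neg_apply, dotForm_apply,
        LinearMap.comp_apply, LinearMap.fst_apply, LinearMap.snd_apply, tdivₗ_apply, h4, h5,
        LinearMap.compl₂_apply, h, map_zero, dotProduct_zero, neg_zero, sub_zero, add_zero])
  refine ⟨R, fun w J => ?_⟩
  have hG' : ∀ F, M.traceJacF k F w = G F w := fun F => theUnique_eq (hG F w)
  rw [← hR]
  refine and_congr ⟨?_, ?_⟩ ⟨?_, ?_⟩
  · rintro ⟨V₁, h₁, V₂, h₂, V₃, h₃, rfl⟩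
    exact ⟨(V₁, V₂, V₃), (hS _ _ _).2 ⟨h₁, h₂, h₃⟩, rfl⟩
  · rintro ⟨⟨V₁, V₂, V₃⟩, hx, rfl⟩
    obtain ⟨h₁, h₂, h₃⟩ := (hS _ _ _).1 hx
    exact ⟨V₁, h₁, V₂, h₂, V₃, h₃, rfl⟩
  · rintro h ⟨V₁, V₂, V₃⟩ hx
    obtain ⟨h₁, h₂, h₃⟩ := (hS _ _ _).1 hx
    have := h V₁ h₁ V₂ h₂ V₃ h₃
    simp only [← hM.intFₗ_apply, map_sum, hG'] at this
    simpa [LinearMap.compl₂_apply, hd, intTₗ_apply] using this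
  · intro h V₁ h₁ V₂ h₂ V₃ h₃
    have := h (V₁, V₂, V₃) ((hS _ _ _).2 ⟨h₁, h₂, h₃⟩)
    simp only [← hM.intFₗ_apply, map_sum, hG']
    simpa [LinearMap.compl₂_apply, hd, intTₗ_apply] using this

end IsPolyhedralMesh

end MeshData

/-! ### The local operators and the global maps -/

theorem theUnique_spec {α : Type*} [Zero α] {p : α → Prop} {a : α} (h : ∀ x, p x ↔ x = a) :
    p (theUnique p) := by
  rw [theUnique_eq h]
  exact (h a).2 rfl

theorem theUnique_eq_of {α : Type*} [Zero α] {p : α → Prop} {a : α} (h : ∀ x, p x ↔ x = a) {b : α}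
    (hb : p b) : theUnique p = b :=
  (theUnique_eq h).trans ((h b).1 hb).symm

instance {σ : Type*} [Finite σ] (m : ℤ) : FiniteDimensional ℝ (Goly σ m) := by
  unfold Goly
  infer_instance

instance (m : ℤ) : FiniteDimensional ℝ (GcF m) := by
  unfold GcF
  infer_instance

instance (a : R3) (m : ℤ) : FiniteDimensional ℝ (GcT a m) := by
  unfold GcT
  infer_instance

theorem mem_PolyE_mul_C {m : ℤ} {p : ℝ[X]} (hp : p ∈ PolyE m) (c : ℝ) : p * C c ∈ PolyE m := by
  have := PolyE_mul hp (C_mem_PolyE le_rfl c)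
  rwa [add_zero] at this

namespace MeshData

variable {𝒯 ℱ ℰ 𝒱 : Type*} [Fintype 𝒯] [Fintype ℱ] [Fintype ℰ] [Fintype 𝒱]
  {M : MeshData 𝒯 ℱ ℰ 𝒱} {Ω : Set R3}

theorem integral_eval_mul_eval (E : ℰ) (p r : ℝ[X]) :
    (∫ s in (0 : ℝ)..(M.len E), p.eval s * r.eval s) = M.intE E (p * r) := by
  simp only [intE, eval_mul]

theorem crossTE_mem {m : ℤ} {E : ℰ} {v : Fin 3 → ℝ[X]} (hv : ∀ i, v i ∈ PolyE m) (i : Fin 3) :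
    M.crossTE E v i ∈ PolyE m := by
  rw [crossTE, cross_apply]
  fin_cases i <;>
    exact Submodule.sub_mem _ (mem_PolyE_mul_C (hv _) _) (mem_PolyE_mul_C (hv _) _)

namespace IsPolyhedralMesh

variable (hM : M.IsPolyhedralMesh Ω)
include hM

theorem isProjF (F : ℱ) (S : Submodule ℝ (Fin 2 → P2)) [FiniteDimensional ℝ S]
    (x : Fin 2 → P2) : M.IsProjF F S x (M.projF F S x) :=
  theUnique_spec ((hM.exists_projF F S).choose_spec x)

theorem isProjT (T : 𝒯) (S : Submodule ℝ (Fin 3 → P3)) [FiniteDimensional ℝ S]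
    (x : Fin 3 → P3) : M.IsProjT T S x (M.projT T S x) :=
  theUnique_spec ((hM.exists_projT T S).choose_spec x)

theorem isEdgePoly (E : ℰ) {m : ℤ} (hm : -1 ≤ m) (f : ℝ[X]) (a b : ℝ) :
    M.IsEdgePoly E m (fun s => f.eval s) a b (M.edgePoly E m (fun s => f.eval s) a b) :=
  theUnique_spec ((hM.exists_edgePoly E hm).choose_spec f a b)

theorem edgePoly_eq {E : ℰ} {m : ℤ} (hm : -1 ≤ m) {f : ℝ[X]} {a b : ℝ} {p : ℝ[X]}
    (h : M.IsEdgePoly E m (fun s => f.eval s) a b p) :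
    M.edgePoly E m (fun s => f.eval s) a b = p :=
  theUnique_eq_of ((hM.exists_edgePoly E hm).choose_spec f a b) h

theorem isGradF (k : ℤ) (F : ℱ) (q : GradDofs 𝒯 ℱ ℰ 𝒱) : M.IsGradF k F q (M.gradF k F q) :=
  theUnique_spec ((hM.exists_gradF k F).choose_spec q)

theorem isGradPerpF (k : ℤ) (F : ℱ) (q : GradDofs 𝒯 ℱ ℰ 𝒱) :
    M.IsGradPerpF k F q (M.gradPerpF k F q) :=
  theUnique_spec ((hM.exists_gradPerpF k F).choose_spec q)

theorem isTraceGradF (k : ℤ) (F : ℱ) (q : GradDofs 𝒯 ℱ ℰ 𝒱) :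
    M.IsTraceGradF k F q (M.traceGradF k F q) :=
  theUnique_spec ((hM.exists_traceGradF k F).choose_spec q)

theorem isGradT (k : ℤ) (T : 𝒯) (q : GradDofs 𝒯 ℱ ℰ 𝒱) : M.IsGradT k T q (M.gradT k T q) :=
  theUnique_spec ((hM.exists_gradT k T).choose_spec q)

theorem isCurlF (k : ℤ) (F : ℱ) (v : CurlDofs 𝒯 ℱ ℰ 𝒱) : M.IsCurlF k F v (M.curlF k F v) :=
  theUnique_spec ((hM.exists_curlF k F).choose_spec v)

theorem isTraceTF {k : ℤ} (hk : 0 ≤ k) (F : ℱ) (v : CurlDofs 𝒯 ℱ ℰ 𝒱) :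
    M.IsTraceTF k F v (M.traceTF k F v) :=
  theUnique_spec ((hM.exists_traceTF k hk F).choose_spec v)

theorem isCurlT {k : ℤ} (hk : 0 ≤ k) (T : 𝒯) (v : CurlDofs 𝒯 ℱ ℰ 𝒱) :
    M.IsCurlT k T v (M.curlT k T v) :=
  theUnique_spec ((hM.exists_curlT k hk T).choose_spec v)

theorem isJacF (k : ℤ) (F : ℱ) (w : JacDofs 𝒯 ℱ ℰ) : M.IsJacF k F w (M.jacF k F w) :=
  theUnique_spec ((hM.exists_jacF k F).choose_spec w)

theorem isTraceJacF (k : ℤ) (F : ℱ) (w : JacDofs 𝒯 ℱ ℰ) :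
    M.IsTraceJacF k F w (M.traceJacF k F w) :=
  theUnique_spec ((hM.exists_traceJacF k F).choose_spec w)

theorem isJacT (k : ℤ) (T : 𝒯) (w : JacDofs 𝒯 ℱ ℰ) : M.IsJacT k T w (M.jacT k T w) :=
  theUnique_spec ((hM.exists_jacT k T).choose_spec w)

theorem wellPosed {k : ℤ} (hk : 0 ≤ k) : M.WellPosed k where
  projF F S hS x := by
    have := Submodule.finiteDimensional_of_le hS
    exact existsUnique_of_iff ((hM.exists_projF F S).choose_spec x)
  projT T S hS x := by
    have := Submodule.finiteDimensional_of_le hS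
    exact existsUnique_of_iff ((hM.exists_projT T S).choose_spec x)
  edgePoly E _ f a b hm := existsUnique_of_iff ((hM.exists_edgePoly E hm).choose_spec f a b)
  gradF F q _ := existsUnique_of_iff ((hM.exists_gradF k F).choose_spec q)
  gradPerpF F q _ := existsUnique_of_iff ((hM.exists_gradPerpF k F).choose_spec q)
  traceGradF F q _ := existsUnique_of_iff ((hM.exists_traceGradF k F).choose_spec q)
  gradT T q _ := existsUnique_of_iff ((hM.exists_gradT k T).choose_spec q)
  curlF F v _ := existsUnique_of_iff ((hM.exists_curlF k F).choose_spec v)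
  vcurlF F v _ := existsUnique_of_iff ((hM.exists_vcurlF k F).choose_spec v)
  traceTF F v _ := existsUnique_of_iff ((hM.exists_traceTF k hk F).choose_spec v)
  curlT T v _ := existsUnique_of_iff ((hM.exists_curlT k hk T).choose_spec v)
  jacF F w _ := existsUnique_of_iff ((hM.exists_jacF k F).choose_spec w)
  traceJacF F w _ := existsUnique_of_iff ((hM.exists_traceJacF k F).choose_spec w)
  jacT T w _ := existsUnique_of_iff ((hM.exists_jacT k T).choose_spec w)

theorem exists_gradH {k : ℤ} (hk : 0 ≤ k) :
    ∃ L : GradDofs 𝒯 ℱ ℰ 𝒱 →ₗ[ℝ] CurlDofs 𝒯 ℱ ℰ 𝒱, ∀ q, M.gradH k q = L q := by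
  choose RE hRE using fun E => hM.exists_edgePoly E (by omega : -1 ≤ k)
  choose RF hRF using hM.exists_gradF k
  choose RP hRP using hM.exists_gradPerpF k
  choose RT hRT using hM.exists_gradT k
  choose A hA using fun F => hM.exists_projF F (RolyF (k - 1))
  choose B hB using fun F => hM.exists_projF F (Rc posF k)
  choose C' hC using fun F => hM.exists_projF F (Goly (Fin 2) k)
  choose D hD using fun F => hM.exists_projF F (GcF k)
  choose A' hA' using fun T => hM.exists_projT T (RolyT (k - 1))
  choose B' hB' using fun T => hM.exists_projT T (Rc (posT (M.center T)) k)
  let gE : ∀ _ : ℰ, GradDofs 𝒯 ℱ ℰ 𝒱 →ₗ[ℝ] (Fin 3 → ℝ[X]) := fun E => LinearMap.pi fun i =>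
    (RE E).comp <| LinearMap.prod
      ((LinearMap.mulRight ℝ (Polynomial.C (M.tangent E i))).comp (derivative.comp
        (IsLinearMap.mk' (fun q : GradDofs 𝒯 ℱ ℰ 𝒱 => q.qE E) ⟨fun _ _ => rfl, fun _ _ => rfl⟩)) +
        IsLinearMap.mk' (fun q : GradDofs 𝒯 ℱ ℰ 𝒱 => q.GE E i)
          ⟨fun _ _ => rfl, fun _ _ => rfl⟩) <| LinearMap.prod
      (IsLinearMap.mk' (fun q : GradDofs 𝒯 ℱ ℰ 𝒱 => q.GV (M.src E) i)
        ⟨fun _ _ => rfl, fun _ _ => rfl⟩)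
      (IsLinearMap.mk' (fun q : GradDofs 𝒯 ℱ ℰ 𝒱 => q.GV (M.tgt E) i)
        ⟨fun _ _ => rfl, fun _ _ => rfl⟩)
  have hgE : ∀ q E, M.gradE k q E = gE E q := fun q E => funext fun i =>
    theUnique_eq (hRE E _ _ _)
  let dl : (Fin 3 → ℝ[X]) →ₗ[ℝ] (Fin 3 → ℝ[X]) :=
    LinearMap.pi fun i => derivative.comp (LinearMap.proj i)
  refine ⟨LinearMap.prod 0 <| LinearMap.prod (LinearMap.pi gE) <|
    LinearMap.prod (LinearMap.pi fun E => (M.crossTEₗ E).comp (dl.comp (gE E))) <|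
    LinearMap.prod (LinearMap.pi fun F => (A F).comp (RF F)) <|
    LinearMap.prod (LinearMap.pi fun F => (B F).comp (RF F)) <|
    LinearMap.prod (IsLinearMap.mk' (fun q : GradDofs 𝒯 ℱ ℰ 𝒱 => q.GF)
      ⟨fun _ _ => rfl, fun _ _ => rfl⟩) <|
    LinearMap.prod (LinearMap.pi fun F => (C' F).comp (RP F)) <|
    LinearMap.prod (LinearMap.pi fun F => (D F).comp (RP F)) <|
    LinearMap.prod (LinearMap.pi fun T => (A' T).comp (RT T)) <|
    LinearMap.pi fun T => (B' T).comp (RT T), fun q => ?_⟩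
  have e1 : ∀ F, M.gradF k F q = RF F q := fun F => theUnique_eq (hRF F q)
  have e2 : ∀ F, M.gradPerpF k F q = RP F q := fun F => theUnique_eq (hRP F q)
  have e3 : ∀ T, M.gradT k T q = RT T q := fun T => theUnique_eq (hRT T q)
  have e4 : ∀ F x, M.projF F (RolyF (k - 1)) x = A F x := fun F x => theUnique_eq (hA F x)
  have e5 : ∀ F x, M.projF F (Rc posF k) x = B F x := fun F x => theUnique_eq (hB F x)
  have e6 : ∀ F x, M.projF F (Goly (Fin 2) k) x = C' F x := fun F x => theUnique_eq (hC F x)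
  have e7 : ∀ F x, M.projF F (GcF k) x = D F x := fun F x => theUnique_eq (hD F x)
  have e8 : ∀ T x, M.projT T (RolyT (k - 1)) x = A' T x := fun T x => theUnique_eq (hA' T x)
  have e9 : ∀ T x, M.projT T (Rc (posT (M.center T)) k) x = B' T x :=
    fun T x => theUnique_eq (hB' T x)
  simp only [gradH, hgE, e1, e2, e3, e4, e5, e6, e7, e8, e9, ← crossTEₗ_apply]
  rfl

theorem exists_curlH {k : ℤ} (hk : 0 ≤ k) :
    ∃ L : CurlDofs 𝒯 ℱ ℰ 𝒱 →ₗ[ℝ] JacDofs 𝒯 ℱ ℰ, ∀ v, M.curlH k v = L v := by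
  choose RE hRE using fun E => hM.exists_edgePoly E (by omega : -1 ≤ k + 1)
  choose RF hRF using hM.exists_curlF k
  choose RP hRP using hM.exists_vcurlF k
  choose RT hRT using hM.exists_curlT k hk
  choose C' hC using fun F => hM.exists_projF F (Goly (Fin 2) k)
  choose D hD using fun F => hM.exists_projF F (GcF k)
  choose A' hA' using fun T => hM.exists_projT T (Goly (Fin 3) (k - 1))
  choose B' hB' using fun T => hM.exists_projT T (GcT (M.center T) k)
  let dl : (Fin 3 → ℝ[X]) →ₗ[ℝ] (Fin 3 → ℝ[X]) :=
    LinearMap.pi fun i => derivative.comp (LinearMap.proj i)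
  let cE : ∀ _ : ℰ, CurlDofs 𝒯 ℱ ℰ 𝒱 →ₗ[ℝ] (Fin 3 → ℝ[X]) := fun E => LinearMap.pi fun i =>
    (RE E).comp <| LinearMap.prod
      (IsLinearMap.mk' (fun v : CurlDofs 𝒯 ℱ ℰ 𝒱 => v.RE E i) ⟨fun _ _ => rfl, fun _ _ => rfl⟩ -
        (LinearMap.proj i).comp ((M.crossTEₗ E).comp (dl.comp
          (IsLinearMap.mk' (fun v : CurlDofs 𝒯 ℱ ℰ 𝒱 => v.vE E)
            ⟨fun _ _ => rfl, fun _ _ => rfl⟩)))) <| LinearMap.prod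
      (IsLinearMap.mk' (fun v : CurlDofs 𝒯 ℱ ℰ 𝒱 => v.RV (M.src E) i)
        ⟨fun _ _ => rfl, fun _ _ => rfl⟩)
      (IsLinearMap.mk' (fun v : CurlDofs 𝒯 ℱ ℰ 𝒱 => v.RV (M.tgt E) i)
        ⟨fun _ _ => rfl, fun _ _ => rfl⟩)
  have hcE : ∀ v E, M.curlE k v E = cE E v := fun v E => funext fun i =>
    theUnique_eq (hRE E _ _ _)
  refine ⟨LinearMap.prod (LinearMap.pi cE) <| LinearMap.prod (LinearMap.pi RF) <|
    LinearMap.prod (LinearMap.pi fun F => (C' F).comp (RP F) +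
      IsLinearMap.mk' (fun v : CurlDofs 𝒯 ℱ ℰ 𝒱 => v.GF F) ⟨fun _ _ => rfl, fun _ _ => rfl⟩) <|
    LinearMap.prod (LinearMap.pi fun F => (D F).comp (RP F) +
      IsLinearMap.mk' (fun v : CurlDofs 𝒯 ℱ ℰ 𝒱 => v.GcF F) ⟨fun _ _ => rfl, fun _ _ => rfl⟩) <|
    LinearMap.prod (LinearMap.pi fun T => (A' T).comp (RT T)) <|
    LinearMap.pi fun T => (B' T).comp (RT T), fun v => ?_⟩
  have e1 : ∀ F, M.curlF k F v = RF F v := fun F => theUnique_eq (hRF F v)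
  have e2 : ∀ F, M.vcurlF k F v = RP F v := fun F => theUnique_eq (hRP F v)
  have e3 : ∀ T, M.curlT k T v = RT T v := fun T => theUnique_eq (hRT T v)
  have e6 : ∀ F x, M.projF F (Goly (Fin 2) k) x = C' F x := fun F x => theUnique_eq (hC F x)
  have e7 : ∀ F x, M.projF F (GcF k) x = D F x := fun F x => theUnique_eq (hD F x)
  have e8 : ∀ T x, M.projT T (Goly (Fin 3) (k - 1)) x = A' T x :=
    fun T x => theUnique_eq (hA' T x)
  have e9 : ∀ T x, M.projT T (GcT (M.center T) k) x = B' T x := fun T x => theUnique_eq (hB' T x)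
  simp only [curlH, hcE, e1, e2, e3, e6, e7, e8, e9]
  rfl

theorem exists_divH (k : ℤ) :
    ∃ L : JacDofs 𝒯 ℱ ℰ →ₗ[ℝ] (𝒯 → P3), ∀ w, M.divH k w = L w := by
  choose R hR using hM.exists_jacT k
  refine ⟨LinearMap.pi fun T => traceₗ.comp (R T), fun w => funext fun T => ?_⟩
  rw [divH, show M.jacT k T w = R T w from theUnique_eq (hR T w)]
  simp

/-! ### The range spaces of the global maps -/

theorem gradE_mem {k : ℤ} (hk : 0 ≤ k) (q : GradDofs 𝒯 ℱ ℰ 𝒱) (E : ℰ) (i : Fin 3) :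
    M.gradE k q E i ∈ PolyE (k + 2) := (hM.isEdgePoly E (by omega) _ _ _).1

theorem gradH_mem {k : ℤ} (hk : 0 ≤ k) {q : GradDofs 𝒯 ℱ ℰ 𝒱} (hq : q ∈ M.XGrad k) :
    M.gradH k q ∈ M.XCurl k := by
  obtain ⟨-, -, -, -, hGF, -⟩ := hq
  refine ⟨trivial, fun i => ⟨fun E => hM.gradE_mem hk q E i, fun V => q.GV V i, fun E => ?_⟩,
    fun E _ i _ => crossTE_mem (fun j => ?_) i, fun F _ => (hM.isProjF F _ _).1,
    fun F _ => (hM.isProjF F _ _).1, hGF, fun F _ => (hM.isProjF F _ _).1,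
    fun F _ => (hM.isProjF F _ _).1, fun T _ => (hM.isProjT T _ _).1,
    fun T _ => (hM.isProjT T _ _).1⟩
  · exact (hM.isEdgePoly E (by omega) _ _ _).2.2
  · have := derivative_mem_PolyE (by omega) (hM.gradE_mem hk q E j)
    rwa [show k + 2 - 1 = k + 1 by ring] at this

theorem curlH_mem {k : ℤ} (hk : 0 ≤ k) {v : CurlDofs 𝒯 ℱ ℰ 𝒱} (hv : v ∈ M.XCurl k) :
    M.curlH k v ∈ M.XJac k := by
  obtain ⟨-, -, -, -, -, -, hG, hGc, -, -⟩ := hv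
  refine ⟨fun i => ⟨fun E => ?_, fun V => v.RV V i, fun E => ?_⟩, fun F _ => (hM.isCurlF k F v).1,
    fun F hF => Submodule.add_mem _ (hM.isProjF F _ _).1 (hG F hF),
    fun F hF => Submodule.add_mem _ (hM.isProjF F _ _).1 (hGc F hF),
    fun T _ => (hM.isProjT T _ _).1, fun T _ => (hM.isProjT T _ _).1⟩
  · have := (hM.isEdgePoly E (by omega : -1 ≤ k + 1) (v.RE E i - M.crossTE E (dE (v.vE E)) i)
      (v.RV (M.src E) i) (v.RV (M.tgt E) i)).1
    rwa [show k + 1 + 2 = k + 3 by ring] at this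
  · exact (hM.isEdgePoly E (by omega) _ _ _).2.2

theorem divH_mem (k : ℤ) (w : JacDofs 𝒯 ℱ ℰ) : M.divH k w ∈ M.BrokenPoly k := by
  intro T _
  obtain ⟨⟨V₁, h₁, V₂, h₂, V₃, h₃, hJ⟩, -⟩ := hM.isJacT k T w
  have h : M.divH k w T = ∑ i, (V₂ i i + V₃ i i) := by
    rw [divH, hJ]
    simp only [Pi.add_apply, Finset.sum_add_distrib, h₁.2, zero_add]
  rw [h]
  exact Submodule.sum_mem _ fun i _ => Submodule.add_mem _
    (mem_VPoly_iff.1 (Rc_le _ _ (h₂.1 i)) i) (mem_VPoly_iff.1 (RolyT_le _ (h₃ i)) i)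

/-! ### The curl of a gradient -/

omit hM in
theorem intT_zero (T : 𝒯) : M.intT T 0 = 0 := by simp [intT]

omit hM in
theorem intF_zero (F : ℱ) : M.intF F 0 = 0 := by simp [intF]

omit hM in
theorem intE_zero (E : ℰ) : M.intE E 0 = 0 := by simp [intE]

omit hM in
theorem eval_resE (F : ℱ) (E : ℰ) (r : P2) (s : ℝ) :
    (M.resE F E r).eval s = MvPolynomial.eval (fun i =>
      M.tang F (M.pt (M.src E) - M.origin F) i + s * M.tang F (M.tangent E) i) r := by
  rw [resE, eval_aeval_polynomial]
  congr 1
  congr 1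
  funext i
  simp only [eval_add, eval_mul, eval_C, eval_X, mul_comm s]

/-- Restrictions to the edges of a polynomial on a face agree at the vertices. -/
theorem exists_vertex_values (F : ℱ) (r : P2) : ∃ u : 𝒱 → ℝ, ∀ E,
    (M.resE F E r).eval 0 = u (M.src E) ∧ (M.resE F E r).eval (M.len E) = u (M.tgt E) := by
  refine ⟨fun V => MvPolynomial.eval (M.tang F (M.pt V - M.origin F)) r, fun E => ⟨?_, ?_⟩⟩
  · rw [eval_resE]
    congr 2
    funext i
    ring
  · rw [eval_resE]
    congr 2
    funext i
    have h : M.pt (M.tgt E) = M.pt (M.src E) + M.len E • M.tangent E := by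
      rw [hM.len_smul_tangent]
      abel
    simp only [tang, h, dotProduct_sub, dotProduct_add, dotProduct_smul, smul_eq_mul]
    ring

/-- Tested with polynomials of degree at most `k`, the edge gradient is `q_E' t_E + G_E`. -/
theorem intE_dotc_gradE {k : ℤ} (hk : 0 ≤ k) (q : GradDofs 𝒯 ℱ ℰ 𝒱) (E : ℰ) (b : R3) {s : ℝ[X]}
    (hs : s ∈ PolyE k) :
    M.intE E (dotc b (M.gradE k q E) * s) =
      (b ⬝ᵥ M.tangent E) * M.intE E (derivative (q.qE E) * s) +
        M.intE E (dotc b (q.GE E) * s) := by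
  have h : ∀ i, M.intE E (M.gradE k q E i * s) =
      M.tangent E i * M.intE E (derivative (q.qE E) * s) + M.intE E (q.GE E i * s) := by
    intro i
    have := (hM.isEdgePoly E (by omega : -1 ≤ k)
      (derivative (q.qE E) * Polynomial.C (M.tangent E i) + q.GE E i) (q.GV (M.src E) i)
      (q.GV (M.tgt E) i)).2.1 s hs
    rw [integral_eval_mul_eval, integral_eval_mul_eval] at this
    rw [gradE, this, add_mul, intE_add, ← intE_smul, Polynomial.smul_eq_C_mul]
    congr 2
    ring
  simp only [dotc, Finset.sum_mul, smul_mul_assoc, ← intEₗ_apply, map_sum, map_smul, smul_eq_mul,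
    dotProduct] at h ⊢
  rw [← Finset.sum_add_distrib]
  exact Finset.sum_congr rfl fun i _ => by rw [h]; ring

theorem curlE_gradH {k : ℤ} (hk : 0 ≤ k) (q : GradDofs 𝒯 ℱ ℰ 𝒱) (E : ℰ) :
    M.curlE k (M.gradH k q) E = 0 := by
  funext i
  have h : (M.gradH k q).RE E i - M.crossTE E (dE ((M.gradH k q).vE E)) i = 0 := sub_self _
  rw [curlE, h]
  refine hM.edgePoly_eq (by omega) ⟨Submodule.zero_mem _, fun r _ => ?_, ?_, ?_⟩
  · simp
  · exact eval_zero
  · exact eval_zero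

/-- By the product rule, the edge terms of the face curl of a gradient are the differences of the
values of `q_E r` at the end points, and their sum around the face vanishes. -/
theorem curlF_gradH {k : ℤ} (hk : 0 ≤ k) {q : GradDofs 𝒯 ℱ ℰ 𝒱} (hq : q ∈ M.XGrad k) (F : ℱ) :
    M.curlF k F (M.gradH k q) = 0 := by
  refine theUnique_eq_of ((hM.exists_curlF k F).choose_spec _)
    ⟨Submodule.zero_mem _, fun r hr => ?_⟩
  obtain ⟨-, ⟨hqE, u, hu⟩, hGE, -⟩ := hq
  have hr' : vrot r ∈ RolyF (k - 1) := ⟨r, by rwa [sub_add_cancel], rfl⟩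
  have h1 : M.intF F ((M.gradH k q).rF F ⬝ᵥ vrot r) = M.intF F (M.gradF k F q ⬝ᵥ vrot r) :=
    (hM.isProjF F _ _).2 _ hr'
  rw [h1, (hM.isGradF k F q).2 _ (VPoly_mono (by omega) (RolyF_le _ hr')), div_vrot, mul_zero,
    ← hM.intFₗ_apply, ← hM.intFₗ_apply, map_zero, zero_mul, map_zero, neg_zero, zero_add,
    ← Finset.sum_sub_distrib]
  obtain ⟨p, hp⟩ := hM.exists_vertex_values F r
  rw [← hM.sum_edgesOf_vertex F fun V => -(u V * p V)]
  refine Finset.sum_congr rfl fun E _ => ?_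
  have hGE0 : dotc (M.tangent E) (q.GE E) = 0 := (hGE E trivial).2
  have h2 := hM.intE_dotc_gradE hk q E (M.tangent E) (resE_mem hr : M.resE F E r ∈ _)
  rw [hM.tangent_dot_self, one_mul, hGE0, zero_mul, ← intEₗ_apply, ← intEₗ_apply, ← intEₗ_apply,
    map_zero, add_zero] at h2
  have h3 := hM.intE_derivative E (q.qE E * M.resE F E r)
  have hu' : (q.qE E).eval 0 = u (M.src E) ∧ (q.qE E).eval (M.len E) = u (M.tgt E) := hu E
  rw [derivative_mul, eval_mul, eval_mul, (hp E).1, (hp E).2, hu'.1, hu'.2, ← intEₗ_apply,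
    map_add] at h3
  change _ = M.ωF F E * _ - M.ωF F E * M.intEₗ E (dotc (M.tangent E) (M.gradE k q E) * _)
  rw [h2, hM.dotNFE_vrot, mul_neg, ← intEₗ_apply, map_neg]
  linear_combination M.ωF F E * h3

/-- The edge gradient and `G_E` have the same normal moments, since `t_E · n_F = 0`. -/
theorem vcurlF_gradH {k : ℤ} (hk : 0 ≤ k) (q : GradDofs 𝒯 ℱ ℰ 𝒱) (F : ℱ) :
    M.vcurlF k F (M.gradH k q) = -M.gradPerpF k F q := by
  obtain ⟨hG, hG'⟩ := hM.isGradPerpF k F q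
  refine theUnique_eq_of ((hM.exists_vcurlF k F).choose_spec _)
    ⟨Submodule.neg_mem _ hG, fun r hr => ?_⟩
  rw [neg_dotProduct, ← hM.intFₗ_apply, map_neg, hM.intFₗ_apply, hG' r hr, neg_sub', neg_neg,
    sub_neg_eq_add]
  congr 1
  refine Finset.sum_congr rfl fun E hE => ?_
  congr 1
  have hs : M.dotTE F E r ∈ PolyE k := resE_mem (dotc_mem _ hr)
  have h := hM.intE_dotc_gradE hk q E (M.normal F) hs
  rw [hM.normal_dot_tangent hE, zero_mul, zero_add] at h
  exact h.symm

theorem projF_vcurlF_gradH {k : ℤ} (hk : 0 ≤ k) (q : GradDofs 𝒯 ℱ ℰ 𝒱) (F : ℱ)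
    (S : Submodule ℝ (Fin 2 → P2)) [FiniteDimensional ℝ S] :
    M.projF F S (M.vcurlF k F (M.gradH k q)) + M.projF F S (M.gradPerpF k F q) = 0 := by
  obtain ⟨R, hR⟩ := hM.exists_projF F S
  have h : ∀ x, M.projF F S x = R x := fun x => theUnique_eq (hR x)
  rw [h, h, ← map_add, hM.vcurlF_gradH hk, neg_add_cancel, map_zero]

/-- The tangential trace tested with rotationals of polynomials of degree at most `k`. -/
theorem intF_traceTF_vrot {k : ℤ} (hk : 0 ≤ k) (v : CurlDofs 𝒯 ℱ ℰ 𝒱) (F : ℱ) {r : P2}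
    (hr : r ∈ Poly (Fin 2) k) :
    M.intF F (M.traceTF k F v ⬝ᵥ vrot r) = M.intF F (v.rF F ⬝ᵥ vrot r) := by
  -- Only polynomials of zero integral are test functions, but the mean value has no rotational.
  set c := M.intF F r / M.intF F (MvPolynomial.C 1) with hc
  have hr0 : r - c • MvPolynomial.C 1 ∈ Poly (Fin 2) k :=
    Submodule.sub_mem _ hr (Submodule.smul_mem _ _ (C_mem_Poly hk _))
  have hmean : M.intF F (r - c • MvPolynomial.C 1) = 0 := by
    rw [← hM.intFₗ_apply, map_sub, map_smul, intFₗ_apply, intFₗ_apply,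
      smul_eq_mul, hc, div_mul_cancel₀ _ (hM.intF_C_ne_zero F one_ne_zero), sub_self]
  have hvrot : vrot (r - c • MvPolynomial.C 1) = vrot r := by
    have : vrot (MvPolynomial.C 1) = 0 := by
      funext i
      fin_cases i
      · exact pd_C 1 1
      · exact neg_eq_zero.2 (pd_C 0 1)
    rw [map_sub, map_smul, this, smul_zero, sub_zero]
  have h1 := (hM.isTraceTF hk F v).2 _ (Poly_mono (by omega) hr0) hmean 0 (Submodule.zero_mem _)
  have h2 := (hM.isCurlF k F v).2 _ hr0
  rw [hvrot] at h1 h2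
  rw [add_zero, dotProduct_zero, intF_zero, add_zero] at h1
  rw [h1, h2, sub_add_cancel]

theorem intF_traceTF_Rc {k : ℤ} (hk : 0 ≤ k) (v : CurlDofs 𝒯 ℱ ℰ 𝒱) (F : ℱ) {w : Fin 2 → P2}
    (hw : w ∈ Rc posF k) :
    M.intF F (M.traceTF k F v ⬝ᵥ w) = M.intF F (v.rcF F ⬝ᵥ w) := by
  have h := (hM.isTraceTF hk F v).2 0 (Submodule.zero_mem _)
    (intF_zero F) w hw
  simpa only [map_zero, zero_add, mul_zero, ← hM.intFₗ_apply, ← intEₗ_apply,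
    Finset.sum_const_zero] using h

/-- On a face, the tangential trace of a discrete gradient and the face gradient have the same
moments against the fields in `𝒫^{k-1}`. -/
theorem intF_traceTF_gradH {k : ℤ} (hk : 0 ≤ k) (q : GradDofs 𝒯 ℱ ℰ 𝒱) (F : ℱ)
    {w w' : Fin 2 → P2} (hw : w ∈ VPoly (Fin 2) (Fin 2) (k - 1)) (hw' : w' ∈ Rc posF k) :
    M.intF F (M.traceTF k F (M.gradH k q) ⬝ᵥ (w + w')) = M.intF F (M.gradF k F q ⬝ᵥ (w + w')) := by
  have hRc : ∀ z ∈ Rc posF k, M.intF F (M.traceTF k F (M.gradH k q) ⬝ᵥ z) =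
      M.intF F (M.gradF k F q ⬝ᵥ z) := fun z hz =>
    (hM.intF_traceTF_Rc hk _ F hz).trans ((hM.isProjF F _ _).2 _ hz)
  have hw2 : M.intF F (M.traceTF k F (M.gradH k q) ⬝ᵥ w) = M.intF F (M.gradF k F q ⬝ᵥ w) := by
    obtain ⟨r, hr, z, hz, rfl⟩ := exists_vrot_add_Rc hw
    have hz' : z ∈ Rc posF k := by
      rw [posF_eq] at hz ⊢
      exact Rc_mono 0 (by omega) hz
    have h1 := (hM.intF_traceTF_vrot hk (M.gradH k q) F
      (by rwa [sub_add_cancel] at hr)).trans ((hM.isProjF F _ _).2 (vrot r) ⟨r, hr, rfl⟩)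
    rw [dotProduct_add, dotProduct_add, hM.intF_add, hM.intF_add, h1, hRc z hz']
  rw [dotProduct_add, dotProduct_add, hM.intF_add, hM.intF_add, hw2, hRc w' hw']

/-- The scalar trace satisfies its defining relation for all the fields in `𝒫^k`: for rotationals
this is the definition of the face gradient. -/
theorem intF_traceGradF_div {k : ℤ} (q : GradDofs 𝒯 ℱ ℰ 𝒱) (F : ℱ) {w : Fin 2 → P2}
    (hw : w ∈ VPoly (Fin 2) (Fin 2) k) :
    M.intF F (M.traceGradF k F q * div w) = -M.intF F (M.gradF k F q ⬝ᵥ w) +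
      ∑ E ∈ M.edgesOf F, M.ωF F E * M.intE E (q.qE E * M.dotNFE F E w) := by
  obtain ⟨r, hr, z, hz, rfl⟩ := exists_vrot_add_Rc hw
  have h1 := (hM.isGradF k F q).2 _ (vrot_mem hr)
  have h2 := (hM.isTraceGradF k F q).2 z (by
    rw [posF_eq] at hz ⊢
    exact Rc_mono 0 (by omega) hz)
  rw [div_vrot, mul_zero, intF_zero, neg_zero, zero_add] at h1
  rw [map_add, div_vrot, zero_add, h2, dotProduct_add, hM.intF_add, h1]
  simp only [← dotNFEₗ_apply, map_add, mul_add, intE_add, Finset.sum_add_distrib]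
  ring

/-- The cell curl of a discrete gradient, tested with a field whose tangential traces on the faces
belong to `𝒫^{k-1} + ℛ^{c,k}`. -/
theorem intT_curlT_gradH {k : ℤ} (hk : 0 ≤ k) (q : GradDofs 𝒯 ℱ ℰ 𝒱) (T : 𝒯) {r : Fin 3 → P3}
    (hr : r ∈ VPoly (Fin 3) (Fin 3) k)
    (h : ∀ F, ∃ w ∈ VPoly (Fin 2) (Fin 2) (k - 1), ∃ w' ∈ Rc posF k, M.crossNF F r = w + w') :
    M.intT T (M.curlT k T (M.gradH k q) ⬝ᵥ r) = 0 := by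
  have hcurl : curl r ∈ RolyT (k - 1) := ⟨r, by rwa [sub_add_cancel], rfl⟩
  have hcross : ∀ F, M.crossNF F r ∈ VPoly (Fin 2) (Fin 2) k := by
    intro F
    obtain ⟨w, hw, w', hw', hr'⟩ := h F
    rw [posF_eq] at hw'
    rw [hr']
    exact Submodule.add_mem _ (VPoly_mono (by omega) hw) (Rc_le 0 k hw')
  have h1 : M.intT T ((M.gradH k q).rT T ⬝ᵥ curl r) = M.intT T (M.gradT k T q ⬝ᵥ curl r) :=
    (hM.isProjT T _ _).2 _ hcurl
  have h2 := (hM.isGradT k T q).2 _ (VPoly_mono (by omega) (RolyT_le _ hcurl))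
  rw [div_curl, mul_zero, intT_zero, neg_zero, zero_add] at h2
  rw [(hM.isCurlT hk T _).2 r hr, h1, h2, ← Finset.sum_add_distrib,
    ← hM.sum_facesOf_edgesOf T fun E => -M.intE E (q.qE E * M.lineE E (dotc (M.tangent E) r))]
  refine Finset.sum_congr rfl fun F _ => ?_
  obtain ⟨w, hw, w', hw', hr'⟩ := h F
  rw [← mul_add]
  congr 1
  rw [← hM.div_crossNF, hM.intF_traceGradF_div q F (hcross F)]
  have h3 := hM.intF_traceTF_gradH hk q F hw hw'
  rw [← hr'] at h3
  rw [h3, add_right_comm, neg_add_cancel, zero_add]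
  refine Finset.sum_congr rfl fun E hE => ?_
  rw [hM.dotNFE_crossNF hE, mul_neg, ← intEₗ_apply, map_neg, intEₗ_apply]

theorem crossNF_mem {m : ℤ} {r : Fin 3 → P3} (hr : r ∈ VPoly (Fin 3) (Fin 3) m) (F : ℱ) :
    M.crossNF F r ∈ VPoly (Fin 2) (Fin 2) m := by
  refine mem_VPoly_iff.2 fun i => ?_
  have h : ∀ b : R3, M.resF F (dotc b r) ∈ Poly (Fin 2) m := fun b =>
    resF_mem (dotc_mem b hr)
  fin_cases i
  · rw [show ((⟨0, by norm_num⟩ : Fin 2)) = 0 from rfl, hM.crossNF_zero]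
    exact h _
  · rw [show ((⟨1, by norm_num⟩ : Fin 2)) = 1 from rfl, hM.crossNF_one]
    exact Submodule.neg_mem _ (h _)

omit hM in
theorem dotc_cross (b : R3) (y p : Fin 3 → P3) (n : R3) :
    dotc b (crossProduct (crossProduct y p) fun j => MvPolynomial.C (n j)) =
      dotc n y * dotc b p - dotc b y * dotc n p := by
  simp only [dotc_three, cross_apply, Matrix.cons_val_zero, Matrix.cons_val_one, Matrix.cons_val,
    MvPolynomial.smul_eq_C_mul]
  ring

/-- `((x - x_T) × p) × n_F = ((x - x_T) · n_F) p - (p · n_F) (x - x_T)`, where the first factor is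
constant on `F` and the tangential part of `x - x_T` differs from `x - x_F` by a constant. -/
theorem exists_crossNF_GcT {k : ℤ} {T : 𝒯} {r : Fin 3 → P3} (hr : r ∈ GcT (M.center T) k)
    (F : ℱ) : ∃ w ∈ VPoly (Fin 2) (Fin 2) (k - 1), ∃ w' ∈ Rc posF k, M.crossNF F r = w + w' := by
  obtain ⟨p, hp, rfl⟩ := hr
  set y := posT (M.center T) with hy
  set a : R3 := M.origin F - M.center T with ha
  have hpos : ∀ b : R3, M.resF F (dotc b y) = MvPolynomial.C (b ⬝ᵥ a) +
      ∑ i, MvPolynomial.C (b ⬝ᵥ M.frame F i) * MvPolynomial.X i := by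
    intro b
    simp only [dotc_three, hy, posT, map_add, map_sub, resF, MvPolynomial.aeval_X,
      MvPolynomial.algHom_C, MvPolynomial.algebraMap_eq, Fin.sum_univ_two, dotProduct,
      Fin.sum_univ_three, ha, Pi.sub_apply, MvPolynomial.smul_eq_C_mul, map_mul]
    ring
  have hres : ∀ b : R3, M.resF F (dotc b p) ∈ Poly (Fin 2) (k - 1) := fun b =>
    resF_mem (dotc_mem b hp)
  have hfr : ∀ i, M.resF F (dotc (M.frame F i) y) =
      MvPolynomial.C (M.frame F i ⬝ᵥ a) + MvPolynomial.X i := by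
    intro i
    rw [hpos]
    congr 1
    simp [hM.frame_dot]
  have hn : M.resF F (dotc (M.normal F) y) = MvPolynomial.C (M.normal F ⬝ᵥ a) := by
    rw [hpos]
    simp [normal_dot_frame]
  refine ⟨fun i => (M.normal F ⬝ᵥ a) • M.resF F (dotc (M.frame F i) p) -
      (M.frame F i ⬝ᵥ a) • M.resF F (dotc (M.normal F) p), mem_VPoly_iff.2 fun i =>
      Submodule.sub_mem _ (Submodule.smul_mem _ _ (hres _)) (Submodule.smul_mem _ _ (hres _)),
    smulVec posF (-M.resF F (dotc (M.normal F) p)), ⟨_, Submodule.neg_mem _ (hres _), rfl⟩, ?_⟩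
  funext i
  rw [crossNF]
  change M.resF F (dotc (M.frame F i) (crossProduct (crossProduct y p) _)) = _
  rw [dotc_cross, map_sub, map_mul, map_mul, hfr, hn, Pi.add_apply, smulVec_apply, posF,
    MvPolynomial.smul_eq_C_mul, MvPolynomial.smul_eq_C_mul]
  ring

theorem projT_curlT_gradH {k : ℤ} (hk : 0 ≤ k) (q : GradDofs 𝒯 ℱ ℰ 𝒱) (T : 𝒯)
    (S : Submodule ℝ (Fin 3 → P3)) (hS : S ≤ VPoly (Fin 3) (Fin 3) k)
    (h : ∀ r ∈ S, ∀ F, ∃ w ∈ VPoly (Fin 2) (Fin 2) (k - 1), ∃ w' ∈ Rc posF k,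
      M.crossNF F r = w + w') :
    M.projT T S (M.curlT k T (M.gradH k q)) = 0 := by
  have := Submodule.finiteDimensional_of_le hS
  refine theUnique_eq_of ((hM.exists_projT T S).choose_spec _)
    ⟨Submodule.zero_mem _, fun r hr => ?_⟩
  rw [hM.intT_curlT_gradH hk q T (hS hr) (h r hr), zero_dotProduct, intT_zero]

theorem curlH_gradH {k : ℤ} (hk : 0 ≤ k) {q : GradDofs 𝒯 ℱ ℰ 𝒱} (hq : q ∈ M.XGrad k) :
    M.curlH k (M.gradH k q) = 0 := by
  have h1 : ∀ F, M.projF F (Goly (Fin 2) k) (M.vcurlF k F (M.gradH k q)) + (M.gradH k q).GF F = 0 :=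
    fun F => hM.projF_vcurlF_gradH hk q F _
  have h2 : ∀ F, M.projF F (GcF k) (M.vcurlF k F (M.gradH k q)) + (M.gradH k q).GcF F = 0 :=
    fun F => hM.projF_vcurlF_gradH hk q F _
  have h3 : ∀ T, M.projT T (Goly (Fin 3) (k - 1)) (M.curlT k T (M.gradH k q)) = 0 := fun T =>
    hM.projT_curlT_gradH hk q T _ ((Goly_le _).trans (VPoly_mono (by omega))) fun r hr F =>
      ⟨_, hM.crossNF_mem (Goly_le _ hr) F, 0, Submodule.zero_mem _, (add_zero _).symm⟩
  have h4 : ∀ T, M.projT T (GcT (M.center T) k) (M.curlT k T (M.gradH k q)) = 0 := fun T =>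
    hM.projT_curlT_gradH hk q T _ (GcT_le _ _) fun r hr F => hM.exists_crossNF_GcT hr F
  simp only [curlH, hM.curlE_gradH hk, hM.curlF_gradH hk hq, h1, h2, h3, h4]
  rfl

/-! ### The divergence of a curl -/

/-- On a cell, the matrix `q I` is a test function of the Jacobian, and the corresponding moments
determine the divergence. -/
theorem intT_divH {k : ℤ} (hk : 0 ≤ k) (w : JacDofs 𝒯 ℱ ℰ) (T : 𝒯) {q : P3}
    (hq : q ∈ Poly (Fin 3) k) :
    M.intT T (M.divH k w T * q) = -M.intT T (w.gT T ⬝ᵥ grad (Fin 3) q) +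
      ∑ F ∈ M.facesOf T, M.ωT T F * M.intF F (w.wF F * M.resF F q) := by
  classical
  have hgrad : ∀ i, pd i q ∈ Poly (Fin 3) (k - 1) := fun i => pd_mem_Poly i hq
  choose W hW hWdiv using fun i => exists_Rc_div_eq (M.center T) (hgrad i)
  let Q : Fin 3 → Fin 3 → P3 := fun i j => if i = j then q else 0
  have hQdiv : ∀ i, div (Q i) = pd i q := by
    intro i
    rw [div_apply, Finset.sum_eq_single i]
    · simp [Q]
    · intro j _ hj
      simp [Q, hj.symm]
    · simp
  have hQm : ∀ i, Q i ∈ VPoly (Fin 3) (Fin 3) k := by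
    refine fun i => mem_VPoly_iff.2 fun j => ?_
    simp only [Q]
    split_ifs
    · exact hq
    · exact Submodule.zero_mem _
  have hW2 : W ∈ Rb (M.intT T) (posT (M.center T)) k := by
    set c := M.intT T q / M.intT T (MvPolynomial.C 1) with hc
    have hne : M.intT T (MvPolynomial.C 1) ≠ 0 := by
      intro h
      have := hM.eq_zero_of_intT_sq T (κ := Fin 1) (v := fun _ => MvPolynomial.C 1)
        (by simpa using h)
      simpa using congrFun this 0
    refine ⟨hW, q - c • MvPolynomial.C 1, Submodule.sub_mem _ hq
      (Submodule.smul_mem _ _ (C_mem_Poly hk _)), ?_, ?_⟩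
    · rw [← hM.intTₗ_apply, map_sub, map_smul, intTₗ_apply, intTₗ_apply, smul_eq_mul, hc,
        div_mul_cancel₀ _ hne, sub_self]
    · funext i
      rw [tdiv, hWdiv, grad_apply, map_sub, map_smul, pd_C, smul_zero, sub_zero]
  have hV₃ : ∀ i, (Q - W) i ∈ RolyT k := by
    intro i
    obtain ⟨u, hu, hu'⟩ := exists_curl_eq (v := Q i - W i)
      (Submodule.sub_mem _ (hQm i) (Rc_le _ _ (hW i))) (by rw [map_sub, hQdiv, hWdiv, sub_self])
    exact ⟨u, hu, hu'⟩
  have h0 : (0 : Fin 3 → Fin 3 → P3) ∈ Rbc (posT (M.center T)) (k + 1) :=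
    ⟨fun i => Submodule.zero_mem _, by simp⟩
  have h := (hM.isJacT k T w).2 0 h0 W hW2 (Q - W) hV₃
  have hsum : (0 : Fin 3 → Fin 3 → P3) + W + (Q - W) = Q := by abel
  have hdiv0 : tdiv (0 : Fin 3 → Fin 3 → P3) = 0 := map_zero (tdivₗ (σ := Fin 3) (ι := Fin 3))
  have hdivW : tdiv W = grad (Fin 3) q := funext hWdiv
  have htr : tdot (M.jacT k T w) Q = M.divH k w T * q := by
    simp only [tdot, Q, mul_ite, mul_zero, Finset.sum_ite_eq, Finset.mem_univ, if_true, divH,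
      Finset.sum_mul]
  rw [hsum, htr, hdiv0, hdivW, dotProduct_zero, intT_zero, neg_zero,
    zero_sub] at h
  rw [h]
  congr 1
  refine Finset.sum_congr rfl fun F _ => ?_
  congr 1
  -- Only the normal component of the trace contributes.
  have hrow : ∀ a, M.dotNF F (fun j => dotc (M.frame3 F a) fun i => Q i j) =
      (M.normal F ⬝ᵥ M.frame3 F a) • M.resF F q := by
    intro a
    have : (fun j => dotc (M.frame3 F a) fun i => Q i j) = fun j => M.frame3 F a j • q := by
      funext j
      simp [dotc, Q]
    rw [dotNF, this, ← map_smul]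
    congr 1
    simp only [dotc, dotProduct, Finset.sum_smul, smul_smul]
  have hF : M.intF F (∑ a, M.traceJacF k F w a * M.dotNF F
      (fun j => dotc (M.frame3 F a) fun i => Q i j)) =
      M.intF F (M.traceJacF k F w 2 * M.resF F q) := by
    simp only [hrow, Fin.sum_univ_three]
    rw [show M.frame3 F 0 = M.frame F 0 from rfl, show M.frame3 F 1 = M.frame F 1 from rfl,
      show M.frame3 F 2 = M.normal F from rfl, normal_dot_frame, normal_dot_frame,
      hM.normal_dot_self]
    simp
  rw [hF]
  have hqF : M.resF F q ∈ Poly (Fin 2) (k + 1 - 1) := by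
    rw [add_sub_cancel_right]
    exact resF_mem hq
  obtain ⟨z, hz, hzdiv⟩ := exists_Rc_div_eq (0 : R2) hqF
  let V : Fin 3 → Fin 2 → P2 := faceTensor 0 z
  have hV0 : V 0 = 0 := rfl
  have hV1 : V 1 = 0 := rfl
  have hV2 : V 2 = z := rfl
  have h1 := (hM.isTraceJacF k F w).2 V (by
    rw [posF_eq]
    intro i
    fin_cases i
    · exact Submodule.zero_mem _
    · exact Submodule.zero_mem _
    · exact Rc_mono 0 (by omega) hz)
  have h2 := (hM.isJacF k F w).2 0 ⟨fun i => Submodule.zero_mem _, by simp⟩ 0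
    ⟨fun i => Submodule.zero_mem _, 0, Submodule.zero_mem _, intF_zero F,
      (map_zero (tdivₗ (σ := Fin 2) (ι := Fin 2))).trans (map_zero _).symm⟩ 0
    (fun i => Submodule.zero_mem _) z (Rc_le 0 _ hz)
  have hdiv0' : tdiv (0 : Fin 2 → Fin 2 → P2) = 0 := map_zero (tdivₗ (σ := Fin 2) (ι := Fin 2))
  have hdot : M.traceJacF k F w ⬝ᵥ tdiv V = M.traceJacF k F w 2 * M.resF F q := by
    simp only [dotProduct, Fin.sum_univ_three, tdiv, hV0, hV1, hV2, map_zero, mul_zero, zero_add,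
      hzdiv]
  rw [hdiv0', dotProduct_zero, dotProduct_zero, intF_zero, hzdiv, add_zero,
    add_zero] at h2
  rw [hdot] at h1
  change M.intF F (tdot (M.jacF k F w) V) = - 0 - 0 - _ + M.edgeFlux F w V at h2
  rw [h1, h2]
  ring

/-- A polynomial on a cell that is orthogonal to the polynomials of its degree vanishes. -/
theorem eq_of_forall_intT {k : ℤ} {T : 𝒯} {p p' : P3} (hp : p ∈ Poly (Fin 3) k)
    (hp' : p' ∈ Poly (Fin 3) k) (h : ∀ q ∈ Poly (Fin 3) k, M.intT T (p * q) = M.intT T (p' * q)) :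
    p = p' := by
  have h1 := h _ (Submodule.sub_mem _ hp hp')
  rw [← sub_eq_zero, ← hM.intTₗ_apply, ← hM.intTₗ_apply, ← map_sub, ← sub_mul] at h1
  exact sub_eq_zero.1 (congrFun (hM.eq_zero_of_intT_sq T (κ := Fin 1) (v := fun _ => p - p')
    (by simpa [intTₗ_apply] using h1)) 0)

/-- Tested with `q`, the divergence of a curl reduces to a combination of the integrals of
`(v_E · t_E) q` over the boundary of the boundary of the cell. -/
theorem divH_curlH {k : ℤ} (hk : 0 ≤ k) (v : CurlDofs 𝒯 ℱ ℰ 𝒱) :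
    M.divH k (M.curlH k v) = 0 := by
  funext T
  refine hM.eq_of_forall_intT (T := T) (hM.divH_mem k _ T trivial) (Submodule.zero_mem _)
    fun q hq => ?_
  have hgrad : grad (Fin 3) q ∈ Goly (Fin 3) (k - 1) := ⟨q, by rwa [sub_add_cancel], rfl⟩
  have h1 : M.intT T ((M.curlH k v).gT T ⬝ᵥ grad (Fin 3) q) =
      M.intT T (M.curlT k T v ⬝ᵥ grad (Fin 3) q) := (hM.isProjT T _ _).2 _ hgrad
  have h2 := (hM.isCurlT hk T v).2 _ (VPoly_mono (by omega) (Goly_le _ hgrad))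
  rw [curl_grad, dotProduct_zero, intT_zero, zero_add] at h2
  rw [hM.intT_divH hk _ T hq, h1, h2, Pi.zero_apply, zero_mul, intT_zero,
    ← Finset.sum_neg_distrib, ← Finset.sum_add_distrib, ← hM.sum_facesOf_edgesOf T fun E =>
      -M.intE E (dotc (M.tangent E) (v.vE E) * M.lineE E q)]
  refine Finset.sum_congr rfl fun F _ => ?_
  have hqF : M.resF F q ∈ Poly (Fin 2) k := resF_mem hq
  have h3 : M.intF F ((M.curlH k v).wF F * M.resF F q) = _ := (hM.isCurlF k F v).2 _ hqF
  rw [h3, hM.crossNF_grad, hM.intF_traceTF_vrot hk v F hqF, ← mul_neg, ← mul_add]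
  congr 1
  rw [neg_add_eq_sub, sub_sub_cancel_left, ← Finset.sum_neg_distrib]
  refine Finset.sum_congr rfl fun E hE => ?_
  rw [hM.resE_resF hE, mul_neg]

/-! ### Surjectivity of the divergence -/

/-- The outward fluxes through the faces can be prescribed on each cell separately: this is dual to
`eq_zero_of_sum_cells`. -/
theorem exists_face_flux (b : 𝒯 → ℝ) :
    ∃ x : ℱ → ℝ, ∀ T, ∑ F ∈ M.facesOf T, M.ωT T F * x F = b T := by
  classical
  let A : (ℱ → ℝ) →ₗ[ℝ] (𝒯 → ℝ) :=
    LinearMap.pi fun T => ∑ F ∈ M.facesOf T, M.ωT T F • LinearMap.proj F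
  have hA : ∀ x T, A x T = ∑ F ∈ M.facesOf T, M.ωT T F * x F := fun x T => by simp [A]
  have htop : LinearMap.range A = ⊤ := by
    by_contra hne
    obtain ⟨f, hf, hfA⟩ := Submodule.exists_le_ker_of_lt_top _ (lt_top_iff_ne_top.2 hne)
    refine hf (LinearMap.pi_ext' fun T => LinearMap.ext_ring ?_)
    have h := hM.eq_zero_of_sum_cells (fun T => f (Pi.single T 1)) fun F => ?_
    · exact congrFun h T
    · have h1 : f (A (Pi.single F 1)) = 0 := hfA ⟨_, rfl⟩
      rw [LinearMap.pi_apply_eq_sum_univ f] at h1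
      refine (Finset.sum_congr rfl fun T _ => ?_).trans h1
      rw [hA, smul_eq_mul]
      have h2 : (fun j => if T = j then (1 : ℝ) else 0) = Pi.single T 1 := by
        funext j
        simp [Pi.single_apply, eq_comm]
      rw [h2]
      simp only [Pi.single_apply, mul_ite, mul_one, mul_zero, Finset.sum_ite_eq']
      split_ifs <;> ring
  obtain ⟨x, hx⟩ := LinearMap.range_eq_top.1 htop b
  exact ⟨x, fun T => by rw [← hA, hx]⟩

/-- The face components are chosen constant, with the fluxes that the integrals of `p` require; the
gradient components account for the other moments of `p`. -/
theorem exists_divH_eq {k : ℤ} (hk : 0 ≤ k) {p : 𝒯 → P3} (hp : p ∈ M.BrokenPoly k) :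
    ∃ w ∈ M.XJac k, M.divH k w = p := by
  obtain ⟨x, hx⟩ := hM.exists_face_flux fun T => M.intT T (p T)
  set c : ℱ → P2 := fun F => MvPolynomial.C (x F / M.intF F (MvPolynomial.C 1)) with hc
  have hcint : ∀ F, M.intF F (c F) = x F := by
    intro F
    have h := intF_smul (M := M) F (x F / M.intF F (MvPolynomial.C 1)) (MvPolynomial.C 1)
    rwa [MvPolynomial.smul_eq_C_mul, ← MvPolynomial.C_mul, mul_one,
      div_mul_cancel₀ _ (hM.intF_C_ne_zero F one_ne_zero)] at h
  have key : ∀ T, ∃ y ∈ Goly (Fin 3) (k - 1), ∀ q ∈ Poly (Fin 3) k,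
      M.intT T (y ⬝ᵥ grad (Fin 3) q) =
        ∑ F ∈ M.facesOf T, M.ωT T F * M.intF F (c F * M.resF F q) - M.intT T (p T * q) := by
    intro T
    let l : P3 →ₗ[ℝ] ℝ := ∑ F ∈ M.facesOf T, M.ωT T F • (hM.intFₗ F).comp
        ((LinearMap.mulLeft ℝ (c F)).comp (M.resF F).toLinearMap) -
      (hM.intTₗ T).comp (LinearMap.mulLeft ℝ (p T))
    have hl : ∀ q, l q = ∑ F ∈ M.facesOf T, M.ωT T F * M.intF F (c F * M.resF F q) -
        M.intT T (p T * q) := fun q => by simp [l, intFₗ_apply, intTₗ_apply]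
    obtain ⟨y, ⟨hy, hy'⟩, -⟩ := existsUnique_variational
      (dotForm (hM.intTₗ T) LinearMap.id LinearMap.id) (Poly (Fin 3) k) (grad (Fin 3))
      (fun y _ h => hM.eq_zero_of_intT_sq T ((dotForm_apply _ _ _ _ _).symm.trans h)) l
      (fun q _ h => by
        -- A polynomial without gradient is constant, and the fluxes match the integral of `p`.
        obtain ⟨a, ha⟩ : ∃ a : ℝ, q = a • 1 := ⟨_, by
          rw [MvPolynomial.smul_eq_C_mul, mul_one]
          exact eq_C_of_pd_eq_zero fun i => congrFun h i⟩
        rw [ha, map_smul, hl]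
        simp only [map_one, mul_one, hcint, hx, sub_self, smul_zero])
    refine ⟨y, by rwa [Goly, sub_add_cancel], fun q hq => ?_⟩
    rw [← hl, ← hy' q hq]
    exact (dotForm_apply (hM.intTₗ T) LinearMap.id LinearMap.id y (grad (Fin 3) q)).symm
  choose y hy hy' using key
  let w : JacDofs 𝒯 ℱ ℰ := (0, c, 0, 0, y, 0)
  have hw : w ∈ M.XJac k := ⟨Submodule.zero_mem _, fun F _ => C_mem_Poly hk _,
    Submodule.zero_mem _, Submodule.zero_mem _, fun T _ => hy T, Submodule.zero_mem _⟩
  refine ⟨w, hw, funext fun T => ?_⟩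
  refine hM.eq_of_forall_intT (T := T) (hM.divH_mem k w T trivial) (hp T trivial) fun q hq => ?_
  rw [hM.intT_divH hk w T hq]
  change -M.intT T (y T ⬝ᵥ _) + ∑ F ∈ M.facesOf T, M.ωT T F * M.intF F (c F * _) = _
  rw [hy' T q hq]
  ring

/-! ### The kernel of the gradient -/

theorem exists_projFunF (m : ℤ) (F : ℱ) (c : ℝ) : ∃ a : P2, ∀ p,
    (p ∈ Poly (Fin 2) m ∧ ∀ r ∈ Poly (Fin 2) m,
      ∫ y in M.faceDom F, MvPolynomial.eval y p * MvPolynomial.eval y r =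
        ∫ y in M.faceDom F, c * MvPolynomial.eval y r) ↔ p = a := by
  obtain ⟨R, hR⟩ := exists_riesz_operator (mulForm (hM.intFₗ F) LinearMap.id LinearMap.id)
    (Poly (Fin 2) m) (fun y _ h => hM.eq_zero_of_intF_mul_self F h)
    (mulForm (hM.intFₗ F) LinearMap.id LinearMap.id)
  refine ⟨R (MvPolynomial.C c), fun p => ?_⟩
  rw [← hR]
  simp [intFₗ_apply, intF]

theorem exists_projFunT (m : ℤ) (T : 𝒯) (c : ℝ) : ∃ a : P3, ∀ p,
    (p ∈ Poly (Fin 3) m ∧ ∀ r ∈ Poly (Fin 3) m,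
      ∫ x in M.cell T, MvPolynomial.eval x p * MvPolynomial.eval x r =
        ∫ x in M.cell T, c * MvPolynomial.eval x r) ↔ p = a := by
  obtain ⟨R, hR⟩ := exists_riesz_operator (mulForm (hM.intTₗ T) LinearMap.id LinearMap.id)
    (Poly (Fin 3) m) (fun y _ h => congrFun (hM.eq_zero_of_intT_sq T (κ := Fin 1)
      (v := fun _ => y) (by simpa [intTₗ_apply] using h)) 0)
    (mulForm (hM.intTₗ T) LinearMap.id LinearMap.id)
  refine ⟨R (MvPolynomial.C c), fun p => ?_⟩
  rw [← hR]
  simp [intTₗ_apply, intT]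

theorem exists_projFunE (m : ℤ) (E : ℰ) : ∃ a : ℝ[X], ∀ p,
    (p ∈ PolyE m ∧ ∀ r ∈ PolyE m, ∫ s in (0 : ℝ)..(M.len E), p.eval s * r.eval s =
        ∫ s in (0 : ℝ)..(M.len E), 0 * r.eval s) ↔ p = a := by
  obtain ⟨R, hR⟩ := exists_riesz_operator (mulForm (M.intEₗ E) LinearMap.id LinearMap.id)
    (PolyE m) (fun y _ h => hM.eq_zero_of_intE_mul_self E h)
    (mulForm (M.intEₗ E) LinearMap.id LinearMap.id)
  refine ⟨R 0, fun p => ?_⟩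
  rw [← hR]
  simp [intEₗ_apply, intE]

/-- `q` has the components of the interpolate of the constant function `c`. -/
structure IsConst (M : MeshData 𝒯 ℱ ℰ 𝒱) (k : ℤ) (c : ℝ) (q : GradDofs 𝒯 ℱ ℰ 𝒱) : Prop where
  GV : q.GV = 0
  qE : ∀ E, q.qE E = C c
  GE : q.GE = 0
  GF : q.GF = 0
  qF_mem : ∀ F, q.qF F ∈ Poly (Fin 2) (k - 1)
  qF : ∀ F, ∀ r ∈ Poly (Fin 2) (k - 1), M.intF F (q.qF F * r) = c * M.intF F r
  qT_mem : ∀ T, q.qT T ∈ Poly (Fin 3) (k - 1)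
  qT : ∀ T, ∀ r ∈ Poly (Fin 3) (k - 1), M.intT T (q.qT T * r) = c * M.intT T r

theorem isConst_interpGrad {k : ℤ} (hk : 0 ≤ k) (c : ℝ) :
    IsConst M k c (M.interpGrad k fun _ => c) := by
  have hg : ∀ x, gradFun (fun _ : R3 => c) x = 0 := fun x => by
    funext i
    simp [gradFun]
  have hE0 : ∀ E, M.projFunE E k (fun _ => 0) = 0 := fun E => by
    obtain ⟨a, ha⟩ := hM.exists_projFunE k E
    exact theUnique_eq_of ha ⟨Submodule.zero_mem _, fun r _ => by simp⟩
  have hF0 : ∀ F, M.projFunF F (k - 1) (fun _ => 0) = 0 := fun F => by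
    obtain ⟨a, ha⟩ := hM.exists_projFunF (k - 1) F 0
    exact theUnique_eq_of ha ⟨Submodule.zero_mem _, fun r _ => by simp⟩
  have hF : ∀ F, M.projFunF F (k - 1) (fun _ => c) ∈ Poly (Fin 2) (k - 1) ∧
      ∀ r ∈ Poly (Fin 2) (k - 1),
        M.intF F (M.projFunF F (k - 1) (fun _ => c) * r) = c * M.intF F r := fun F => by
    obtain ⟨a, ha⟩ := hM.exists_projFunF (k - 1) F c
    refine ⟨(theUnique_spec ha).1, fun r hr => ?_⟩
    have h := (theUnique_spec ha).2 r hr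
    rw [integral_const_mul] at h
    simp only [intF, map_mul]
    exact h
  have hT : ∀ T, M.projFunT T (k - 1) (fun _ => c) ∈ Poly (Fin 3) (k - 1) ∧
      ∀ r ∈ Poly (Fin 3) (k - 1),
        M.intT T (M.projFunT T (k - 1) (fun _ => c) * r) = c * M.intT T r := fun T => by
    obtain ⟨a, ha⟩ := hM.exists_projFunT (k - 1) T c
    refine ⟨(theUnique_spec ha).1, fun r hr => ?_⟩
    have h := (theUnique_spec ha).2 r hr
    rw [integral_const_mul] at h
    simp only [intT, map_mul]
    exact h
  refine ⟨funext fun V => hg _, fun E => ?_, ?_, ?_, fun F => (hF F).1, fun F => (hF F).2,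
    fun T => (hT T).1, fun T => (hT T).2⟩
  · have h : M.edgePoly E (k - 1) (fun s => (C c : ℝ[X]).eval s) c c = C c :=
      hM.edgePoly_eq (by omega) ⟨C_mem_PolyE (by omega) c, fun r _ => rfl, eval_C, eval_C⟩
    simp only [eval_C] at h
    exact h
  · funext E i
    have h : (fun x => crossProduct (M.tangent E) (crossProduct (gradFun (fun _ : R3 => c) x)
        (M.tangent E)) i) = fun _ => 0 := funext fun x => by rw [hg]; simp
    exact (congrArg (M.projFunE E k) h).trans (hE0 E)
  · funext F
    have h : (fun x => gradFun (fun _ : R3 => c) x ⬝ᵥ M.normal F) = fun _ => 0 :=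
      funext fun x => by rw [hg]; simp
    exact (congrArg (M.projFunF F (k - 1)) h).trans (hF0 F)

theorem IsConst.eq {k : ℤ} {c : ℝ} {q q' : GradDofs 𝒯 ℱ ℰ 𝒱} (h : IsConst M k c q)
    (h' : IsConst M k c q') : q = q' := by
  have hE : q.qE = q'.qE := funext fun E => (h.qE E).trans (h'.qE E).symm
  have hF : q.qF = q'.qF := by
    funext F
    have h1 := Submodule.sub_mem _ (h.qF_mem F) (h'.qF_mem F)
    have h2 := (h.qF F _ h1).trans (h'.qF F _ h1).symm
    rw [← sub_eq_zero, ← hM.intFₗ_apply, ← hM.intFₗ_apply, ← map_sub, ← sub_mul] at h2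
    exact sub_eq_zero.1 (hM.eq_zero_of_intF_mul_self F h2)
  have hT : q.qT = q'.qT := funext fun T => hM.eq_of_forall_intT (h.qT_mem T) (h'.qT_mem T)
    fun r hr => (h.qT T r hr).trans (h'.qT T r hr).symm
  exact Prod.ext (h.GV.trans h'.GV.symm) (Prod.ext hE (Prod.ext (h.GE.trans h'.GE.symm)
    (Prod.ext hF (Prod.ext (h.GF.trans h'.GF.symm) hT))))

omit hM in
theorem IsConst.mem {k : ℤ} (hk : 0 ≤ k) {c : ℝ} {q : GradDofs 𝒯 ℱ ℰ 𝒱} (h : IsConst M k c q) :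
    q ∈ M.XGrad k := by
  refine ⟨trivial, ⟨fun E => ?_, fun _ => c, fun E => ?_⟩, fun E _ => ?_, fun F _ => h.qF_mem F,
    fun F _ => ?_, fun T _ => h.qT_mem T⟩
  · change q.qE E ∈ _
    rw [h.qE]
    exact C_mem_PolyE (by omega) c
  · change (q.qE E).eval 0 = c ∧ (q.qE E).eval (M.len E) = c
    rw [h.qE]
    exact ⟨eval_C, eval_C⟩
  · change q.GE E ∈ _
    rw [h.GE]
    exact Submodule.zero_mem _
  · change q.GF F ∈ _
    rw [h.GF]
    exact Submodule.zero_mem _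

/-- The edge terms of the operators on a face, if `q_E` is the constant `c` on all edges. -/
theorem sum_edgesOf_const {q : GradDofs 𝒯 ℱ ℰ 𝒱} {c : ℝ} (hq : ∀ E, q.qE E = C c) (F : ℱ)
    (w : Fin 2 → P2) :
    ∑ E ∈ M.edgesOf F, M.ωF F E * M.intE E (q.qE E * M.dotNFE F E w) = c * M.intF F (div w) := by
  rw [hM.intF_div, Finset.mul_sum]
  refine Finset.sum_congr rfl fun E _ => ?_
  rw [hq, ← Polynomial.smul_eq_C_mul, intE_smul]
  ring

theorem traceGradF_eq_C {k : ℤ} (hk : 0 ≤ k) {q : GradDofs 𝒯 ℱ ℰ 𝒱} {c : ℝ}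
    (hq : ∀ E, q.qE E = C c) {F : ℱ} (hG : M.gradF k F q = 0) :
    M.traceGradF k F q = MvPolynomial.C c := by
  refine theUnique_eq_of ((hM.exists_traceGradF k F).choose_spec q)
    ⟨C_mem_Poly (by omega) c, fun v _ => ?_⟩
  rw [hG, zero_dotProduct, intF_zero, neg_zero, zero_add, hM.sum_edgesOf_const hq,
    ← MvPolynomial.smul_eq_C_mul, intF_smul]

theorem sum_facesOf_const {k : ℤ} (hk : 0 ≤ k) {q : GradDofs 𝒯 ℱ ℰ 𝒱} {c : ℝ}
    (hq : ∀ E, q.qE E = C c) (hG : ∀ F, M.gradF k F q = 0) (T : 𝒯) (w : Fin 3 → P3) :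
    ∑ F ∈ M.facesOf T, M.ωT T F * M.intF F (M.traceGradF k F q * M.dotNF F w) =
      c * M.intT T (div w) := by
  rw [hM.intT_div, Finset.mul_sum]
  refine Finset.sum_congr rfl fun F _ => ?_
  rw [hM.traceGradF_eq_C hk hq (hG F), ← MvPolynomial.smul_eq_C_mul, intF_smul]
  ring

theorem IsConst.gradH_eq_zero {k : ℤ} (hk : 0 ≤ k) {c : ℝ} {q : GradDofs 𝒯 ℱ ℰ 𝒱}
    (h : IsConst M k c q) : M.gradH k q = 0 := by
  have hE : ∀ E, M.gradE k q E = 0 := by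
    intro E
    funext i
    have h0 : derivative (q.qE E) * Polynomial.C (M.tangent E i) + q.GE E i = 0 := by
      rw [h.qE, derivative_C, zero_mul, zero_add, h.GE]
      rfl
    rw [gradE, h0]
    refine hM.edgePoly_eq (by omega) ⟨Submodule.zero_mem _, fun r _ => by simp, ?_, ?_⟩ <;>
    · rw [h.GV]
      exact eval_zero
  have hF : ∀ F, M.gradF k F q = 0 := by
    intro F
    refine theUnique_eq_of ((hM.exists_gradF k F).choose_spec q)
      ⟨Submodule.zero_mem _, fun w hw => ?_⟩
    rw [zero_dotProduct, intF_zero, hM.sum_edgesOf_const h.qE,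
      h.qF F _ (div_mem (mem_VPoly_iff.1 hw)), neg_add_cancel]
  have hP : ∀ F, M.gradPerpF k F q = 0 := by
    intro F
    refine theUnique_eq_of ((hM.exists_gradPerpF k F).choose_spec q)
      ⟨Submodule.zero_mem _, fun w hw => ?_⟩
    have hn : ∀ E, dotc (M.normal F) (q.GE E) = 0 := fun E => by rw [h.GE]; simp [dotc]
    simp [h.GF, hn, intF_zero, intE_zero]
  have hT : ∀ T, M.gradT k T q = 0 := by
    intro T
    refine theUnique_eq_of ((hM.exists_gradT k T).choose_spec q)
      ⟨Submodule.zero_mem _, fun w hw => ?_⟩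
    rw [zero_dotProduct, intT_zero, hM.sum_facesOf_const hk h.qE hF,
      h.qT T _ (div_mem (mem_VPoly_iff.1 hw)), neg_add_cancel]
  have hpF : ∀ F (S : Submodule ℝ (Fin 2 → P2)) [FiniteDimensional ℝ S], M.projF F S 0 = 0 := by
    intro F S _
    exact theUnique_eq_of ((hM.exists_projF F S).choose_spec 0)
      ⟨Submodule.zero_mem _, fun _ _ => rfl⟩
  have hpT : ∀ T (S : Submodule ℝ (Fin 3 → P3)) [FiniteDimensional ℝ S], M.projT T S 0 = 0 := by
    intro T S _
    exact theUnique_eq_of ((hM.exists_projT T S).choose_spec 0)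
      ⟨Submodule.zero_mem _, fun _ _ => rfl⟩
  have hd : dE 0 = 0 := funext fun i => derivative_zero
  have hc : ∀ E, M.crossTE E 0 = 0 := fun E => by rw [← crossTEₗ_apply, map_zero]
  simp only [gradH, hE, hF, hP, hT, hpF, hpT, hd, hc, h.GF]
  rfl

/-- The edge part of the kernel: the gradient vanishes on each edge, so that the function on the
edge skeleton is constant, since the skeleton is connected. -/
theorem exists_qE_eq_of_gradE {k : ℤ} (hk : 0 ≤ k) (hΩ : IsConnected Ω) {q : GradDofs 𝒯 ℱ ℰ 𝒱}
    (hq : q ∈ M.XGrad k) (h : ∀ E, M.gradE k q E = 0) :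
    q.GE = 0 ∧ ∃ c, ∀ E, q.qE E = C c := by
  obtain ⟨-, ⟨hqE, u, hu⟩, hGE, -⟩ := hq
  replace hqE : ∀ E, q.qE E ∈ PolyE (k + 1) := hqE
  replace hGE : ∀ E, (∀ i, q.GE E i ∈ PolyE k) ∧ dotc (M.tangent E) (q.GE E) = 0 :=
    fun E => hGE E trivial
  replace hu : ∀ E, (q.qE E).eval 0 = u (M.src E) ∧ (q.qE E).eval (M.len E) = u (M.tgt E) := hu
  have hd : ∀ E, derivative (q.qE E) ∈ PolyE k := fun E => by
    have := derivative_mem_PolyE (by omega) (hqE E)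
    rwa [add_sub_cancel_right] at this
  have hd0 : ∀ E, derivative (q.qE E) = 0 := by
    intro E
    have h1 := hM.intE_dotc_gradE hk q E (M.tangent E) (hd E)
    rw [h E, hM.tangent_dot_self, (hGE E).2, zero_mul, intE_zero, add_zero, one_mul,
      show dotc (M.tangent E) (0 : Fin 3 → ℝ[X]) = 0 by simp [dotc], zero_mul, intE_zero] at h1
    exact hM.eq_zero_of_intE_mul_self E h1.symm
  refine ⟨?_, ?_⟩
  · funext E i
    have h1 := hM.intE_dotc_gradE hk q E (Pi.single i 1) ((hGE E).1 i)
    have h2 : ∀ v : Fin 3 → ℝ[X], dotc (Pi.single i (1 : ℝ)) v = v i := fun v => by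
      simp [dotc, Pi.single_apply, ite_smul]
    rw [h E, h2, h2, hd0, zero_mul, intE_zero, mul_zero, zero_add, Pi.zero_apply, zero_mul,
      intE_zero] at h1
    exact hM.eq_zero_of_intE_mul_self E h1.symm
  · have hC : ∀ E, q.qE E = C (u (M.src E)) := by
      intro E
      have := derivative_eq_zero.1 (hd0 E)
      rw [natDegree_eq_zero] at this
      obtain ⟨c, hc⟩ := this
      have h1 := (hu E).1
      rw [← hc, eval_C] at h1
      rw [← hc, h1]
    have hsame : ∀ E, u (M.src E) = u (M.tgt E) := fun E => by
      have h1 := (hu E).2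
      rwa [hC, eval_C] at h1
    by_cases hV : Nonempty ℰ
    · obtain ⟨E₀⟩ := hV
      exact ⟨u (M.src E₀), fun E => by rw [hC, hM.label_const hΩ hsame]⟩
    · exact ⟨0, fun E => absurd ⟨E⟩ hV⟩

/-- The face gradient is orthogonal to the rotationals, because `q_E` is constant, and to `ℛ^c` by
hypothesis; it is in the sum of these two spaces. -/
theorem gradF_eq_zero {k : ℤ} {q : GradDofs 𝒯 ℱ ℰ 𝒱} {c : ℝ} (hq : ∀ E, q.qE E = C c) {F : ℱ}
    (h : M.projF F (Rc posF k) (M.gradF k F q) = 0) : M.gradF k F q = 0 := by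
  obtain ⟨hG, hG'⟩ := hM.isGradF k F q
  obtain ⟨r, hr, w, hw, hrw⟩ := exists_vrot_add_Rc hG
  have h1 := hG' _ (vrot_mem hr)
  rw [hM.sum_edgesOf_const hq, div_vrot, mul_zero, intF_zero, mul_zero, neg_zero, zero_add] at h1
  have h2 := (hM.isProjF F (Rc posF k) (M.gradF k F q)).2 w hw
  rw [h, zero_dotProduct, intF_zero] at h2
  refine hM.eq_zero_of_intF_sq F ?_
  change M.intF F (M.gradF k F q ⬝ᵥ M.gradF k F q) = 0
  conv_lhs => rw [hrw, dotProduct_add, ← hrw, hM.intF_add, h1, ← h2]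
  exact add_zero 0

/-- The edge components are constant by `exists_qE_eq_of_gradE`. The moments of `q_F` and `q_T` are
obtained by testing the vanishing gradients with the fields in `ℛ^c`, whose divergences are all the
polynomials. -/
theorem exists_isConst_of_gradH_eq_zero {k : ℤ} (hk : 0 ≤ k) (hΩ : IsConnected Ω)
    {q : GradDofs 𝒯 ℱ ℰ 𝒱} (hq : q ∈ M.XGrad k) (h : M.gradH k q = 0) :
    ∃ c, IsConst M k c q := by
  have hE : ∀ E, M.gradE k q E = 0 := fun E =>
    congrFun (congrArg (fun v : CurlDofs 𝒯 ℱ ℰ 𝒱 => v.vE) h) E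
  obtain ⟨hGE, c, hc⟩ := hM.exists_qE_eq_of_gradE hk hΩ hq hE
  have hF : ∀ F, M.projF F (Rc posF k) (M.gradF k F q) = 0 := fun F =>
    congrFun (congrArg (fun v : CurlDofs 𝒯 ℱ ℰ 𝒱 => v.rcF) h) F
  have hT : ∀ T, M.projT T (Rc (posT (M.center T)) k) (M.gradT k T q) = 0 := fun T =>
    congrFun (congrArg (fun v : CurlDofs 𝒯 ℱ ℰ 𝒱 => v.rcT) h) T
  have hGF : q.GF = 0 := congrArg (fun v : CurlDofs 𝒯 ℱ ℰ 𝒱 => v.vF) h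
  have hG : ∀ F, M.gradF k F q = 0 := fun F => hM.gradF_eq_zero hc (hF F)
  obtain ⟨-, -, -, hqF, -, hqT⟩ := hq
  refine ⟨c, funext fun V => funext fun i => ?_, hc, hGE, hGF, fun F => hqF F trivial,
    fun F r hr => ?_, fun T => hqT T trivial, fun T r hr => ?_⟩
  · obtain ⟨E, hEV⟩ := hM.vertex_used V
    have hv : ∀ s, (M.gradE k q E i).eval s = 0 := fun s => by
      rw [hE]
      exact eval_zero
    have h2 := (hM.isEdgePoly E (by omega : -1 ≤ k)
      (derivative (q.qE E) * Polynomial.C (M.tangent E i) + q.GE E i) (q.GV (M.src E) i)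
      (q.GV (M.tgt E) i)).2.2
    rcases hEV with rfl | rfl
    · exact h2.1.symm.trans (hv 0)
    · exact h2.2.symm.trans (hv _)
  · obtain ⟨w, hw, rfl⟩ := exists_Rc_div_eq (0 : R2) hr
    have h3 := (hM.isGradF k F q).2 w (Rc_le 0 k hw)
    rw [hG, zero_dotProduct, intF_zero, hM.sum_edgesOf_const hc] at h3
    linarith
  · obtain ⟨w, hw, rfl⟩ := exists_Rc_div_eq (M.center T) hr
    have h3 := (hM.isGradT k T q).2 w (Rc_le _ k hw)
    have h4 := (hM.isProjT T (Rc (posT (M.center T)) k) (M.gradT k T q)).2 w hw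
    rw [hT, zero_dotProduct, intT_zero] at h4
    rw [← h4, hM.sum_facesOf_const hk hc hG] at h3
    linarith

end IsPolyhedralMesh

end MeshData

end StokesComplex

end

theorem mainTheorem1 {𝒯 ℱ ℰ 𝒱 : Type*} [Fintype 𝒯] [Fintype ℱ] [Fintype ℰ] [Fintype 𝒱]
    (M : StokesComplex.MeshData 𝒯 ℱ ℰ 𝒱) (Ω : Set (Fin 3 → ℝ)) (hΩ_open : IsOpen Ω)
    (hΩ_conn : IsConnected Ω) (hM : M.IsPolyhedralMesh Ω) (k : ℤ) (hk : 0 ≤ k) :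
    M.WellPosed k ∧
    ∃ (G : M.XGrad k →ₗ[ℝ] M.XCurl k) (C : M.XCurl k →ₗ[ℝ] M.XJac k)
      (D : M.XJac k →ₗ[ℝ] M.BrokenPoly k),
      (∀ q : M.XGrad k, (G q : StokesComplex.CurlDofs 𝒯 ℱ ℰ 𝒱) = M.gradH k q) ∧
      (∀ v : M.XCurl k, (C v : StokesComplex.JacDofs 𝒯 ℱ ℰ) = M.curlH k v) ∧
      (∀ w : M.XJac k, (D w : 𝒯 → StokesComplex.P3) = M.divH k w) ∧
      Set.range (fun c : ℝ => M.interpGrad k (fun _ => c)) =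
        (fun q : M.XGrad k => (q : StokesComplex.GradDofs 𝒯 ℱ ℰ 𝒱)) '' (LinearMap.ker G) ∧
      LinearMap.range G ≤ LinearMap.ker C ∧
      LinearMap.range C ≤ LinearMap.ker D ∧
      LinearMap.range D = ⊤ := by
  obtain ⟨LG, hG⟩ := hM.exists_gradH hk
  obtain ⟨LC, hC⟩ := hM.exists_curlH hk
  obtain ⟨LD, hD⟩ := hM.exists_divH k
  refine ⟨hM.wellPosed hk, LG.restrict fun q hq => hG q ▸ hM.gradH_mem hk hq,
    LC.restrict fun v hv => hC v ▸ hM.curlH_mem hk hv,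
    LD.restrict fun w _ => hD w ▸ hM.divH_mem k w, fun q => (hG q).symm, fun v => (hC v).symm,
    fun w => (hD w).symm, ?_, ?_, ?_, ?_⟩
  · ext q
    constructor
    · rintro ⟨c, rfl⟩
      have h := hM.isConst_interpGrad hk c
      exact ⟨⟨_, h.mem hk⟩, Subtype.ext ((hG _).symm.trans (h.gradH_eq_zero hM hk)), rfl⟩
    · rintro ⟨q, hq, rfl⟩
      obtain ⟨c, hc⟩ := hM.exists_isConst_of_gradH_eq_zero hk hΩ_conn q.2
        ((hG _).trans (congrArg Subtype.val hq))
      exact ⟨c, (hM.isConst_interpGrad hk c).eq hM hc⟩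
  · rintro _ ⟨q, rfl⟩
    refine Subtype.ext ?_
    change LC (LG q) = 0
    rw [← hC, ← hG, hM.curlH_gradH hk q.2]
  · rintro _ ⟨v, rfl⟩
    refine Subtype.ext ?_
    change LD (LC v) = 0
    rw [← hD, ← hC, hM.divH_curlH hk]
  · rw [LinearMap.range_eq_top]
    rintro ⟨p, hp⟩
    obtain ⟨w, hw, rfl⟩ := hM.exists_divH_eq hk hp
    exact ⟨⟨w, hw⟩, Subtype.ext (hD w).symm⟩
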